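/- **Setting.** For each $n$ let $X_{kt}=\mu_{1k}\mathbf 1\{t\le n\tau_n\}+\mu_{2k}\mathbf 1\{t>n\tau_n\}+\varepsilon_{kt}$, $1\le k\le p$, $1\le t\le n$, where $p=p(n)\to\infty$, $\mu_1,\mu_2\in\mathbb R^p$ and the matrices $A_j$ may depend on $n$, and $\varepsilon_t=\sum_{j\ge0}A_j\eta_{t-j}$ with $(\eta_{kt})_{k\ge 1,t\in\mathbb Z}$ i.i.d., $E\eta_{kt}=0$, $E\eta_{kt}^2=1$, $E\eta_{kt}^4<\infty$. Fix $0<c^*<1/2$; for all large $n$, $n\tau_n$ is an integer and $\tau_n\in(c^*,1-c^*)$. Let $\hat\tau_n$ be any measurable least squares estimator, i.e. a minimiser, over $b\in(c^*,1-c^*)$ with $nb\in\mathbb N$, of $$L(b)=\frac1n\sum_{k=1}^p\Big[\sum_{t\le nb}\Big(X_{kt}-\frac1{nb}\sum_{s\le nb}X_{ks}\Big)^2+\sum_{t>nb}\Big(X_{kt}-\frac1{n(1-b)}\sum_{s>nb}X_{ks}\Big)^2\Big].$$ Assume cross-sectional independence: $A_j=\mathrm{Diag}(a_{j,k}:1\le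 k\le p)$ for all $j$. All suprema below are over $n$ and $k\le p(n)$. Put $\delta=\mu_1-\mu_2$ and consider * (BC) $\sup_k\sum_{j\ge0}|a_{j,k}|<\infty$; (SNR\*) $\frac np\|\delta\|_2^2\to\infty$; * (1) $\sup_k\sum_{j\ge0} j|a_{j,k}|<\infty$; (2) $p^{-1/2}\|\delta\|_2^2\to\infty$; (3) $\|\delta\|_2\to\infty$ and $n^{-1}p\log\log n\to0$. **(A)** (i) If $\sup_k|a_{0,k}|<\infty$, then (1) implies (BC). Assumption (3) implies (SNR\*), but (SNR\*) does not imply (3), and neither of (SNR\*) and (2) implies the other. Moreover $n^{-1}p\log\log n\to0$ implies $p/n\to0$. (ii) Under (BC), (SNR\*) and $\|\delta\|_2\to\infty$, $P(\hat\tau_n=\tau_n)\to1$. (iii) Consequently Bai's result holds: if $\sup_k|a_{0,k}|<\infty$ and (1) and (3) hold, then $P(\hat\tau_n=\tau_n)\to1$. **(B)** Assume (BC), $a_{j,k}=0$ for all $j\ne0$ (errors uncorrelated over time), $\|\delta\|_2^2\to c>0$ and $\tau_n\to\tau^*\in(c^*,1-c^*)$. Let $\mathcal K_n$ be the set of $k\le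 p(n)$ for which $\mu_{1k}-\mu_{2k}\to0$ as the row index tends to infinity, let $\mathcal K_0$ be its complement in $\{1,\dots,p(n)\}$, and assume that $\sigma^{*2}=\lim_n\sum_{k\in\mathcal K_n}(\mu_{1k}-\mu_{2k})^2a_{0,k}^2$ exists, $\sigma^*\ge0$. Let $B$ be a standard two-sided Brownian motion at integer times. For $c>0$ and $\sigma\ge0$ the process $h\mapsto-\tfrac12c|h|+\sigma B_h$, $h\in\mathbb Z$, has almost surely a unique maximiser (and such a process with a measurable maximiser exists). (i) If $p/n\to0$, $\mathcal K_0=\varnothing$ and (A9) $\sup_{k\in\mathcal K_n}|\mu_{1k}-\mu_{2k}|\to0$, then $$n(\hat\tau_n-\tau_n)\xrightarrow{\ \mathcal D\ }\arg\max_{h\in\mathbb Z}\big(-\tfrac12c|h|+\sigma^*B_h\big).$$ (ii) Neither extra condition can be dropped, even when $n^{-1}p\log\log n\to0$: there is a model as in (B) with $n^{-1}p\log\log n\to0$ and $\mathcal K_0=\varnothing$, and there is another one with $n^{-1}p\log\log n\to0$ and (A9), with least squares estimators for which $n(\hat\tau_n-\tau_n)$ does not converge in distribution to $\arg\max_{h\in\mathbb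 Z}(-\frac12c|h|+sB_h)$ for any $s\ge0$ (in particular not for $s=\sigma^*$). -/

import Mathlib

open MeasureTheory ProbabilityTheory Filter Topology

noncomputable section

/-- The panel data model with a common change point and multivariate MA(∞) errors.
Row `n` of the triangular array has `n` time points and `p n` panels. The panels of row `n` are
indexed by `Fin (p n)`, so panel `k` of the usual numbering `1, …, p n` is the index `k - 1`.
The innovations `η k t` form one array, so that the innovation vectors of different dimensions
are nested. -/
structure PanelModel {Ω : Type*} [MeasurableSpace Ω] (P : Measure Ω) where
  /-- number of panels -/
  p : ℕ → ℕ
  /-- mean vector before the change -/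
  μ₁ : ∀ n, EuclideanSpace ℝ (Fin (p n))
  /-- mean vector after the change -/
  μ₂ : ∀ n, EuclideanSpace ℝ (Fin (p n))
  /-- change point, as a fraction of the sample -/
  τ : ℕ → ℝ
  /-- trimming constant of the estimator -/
  cstar : ℝ
  /-- moving average coefficient matrices -/
  A : ∀ n, ℕ → Matrix (Fin (p n)) (Fin (p n)) ℝ
  /-- innovations -/
  η : ℕ → ℤ → Ω → ℝ
  p_tendsto : Tendsto p atTop atTop
  cstar_pos : 0 < cstar
  cstar_lt : cstar < 1 / 2
  τ_mem : ∀ᶠ n in atTop, τ n ∈ Set.Ioo cstar (1 - cstar)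
  τ_grid : ∀ᶠ n : ℕ in atTop, ∃ m : ℕ, (n : ℝ) * τ n = m
  η_measurable : ∀ k t, Measurable (η k t)
  η_indep : iIndepFun (fun q : ℕ × ℤ => η q.1 q.2) P
  η_ident : ∀ k t, IdentDistrib (η k t) (η 0 0) P P
  η_mean : ∫ ω, η 0 0 ω ∂P = 0
  η_var : ∫ ω, (η 0 0 ω) ^ 2 ∂P = 1
  η_fourth : MemLp (η 0 0) 4 P

namespace PanelModel

variable {Ω : Type*} [MeasurableSpace Ω] {P : Measure Ω}

/-- The jump `μ₁ - μ₂` in row `n`. -/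
def δ (M : PanelModel P) (n : ℕ) : EuclideanSpace ℝ (Fin (M.p n)) := M.μ₁ n - M.μ₂ n

/-- The error process `ε_t = ∑_{j ≥ 0} A_j η_{t-j}`, panel by panel. -/
def ε (M : PanelModel P) (n : ℕ) (k : Fin (M.p n)) (t : ℤ) (ω : Ω) : ℝ :=
  ∑' j : ℕ, (M.A n j).mulVec (fun i => M.η i (t - j) ω) k

/-- The observation of panel `k` at time `t` in row `n`. -/
def X (M : PanelModel P) (n : ℕ) (k : Fin (M.p n)) (t : ℕ) (ω : Ω) : ℝ :=
  (if t ≤ ⌊(n : ℝ) * M.τ n⌋₊ then M.μ₁ n k else M.μ₂ n k) + M.ε n k t ω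

/-- Sample mean of panel `k` over the times `1, …, m`. -/
def meanBefore (M : PanelModel P) (n : ℕ) (k : Fin (M.p n)) (m : ℕ) (ω : Ω) : ℝ :=
  (∑ t ∈ Finset.Icc 1 m, M.X n k t ω) / m

/-- Sample mean of panel `k` over the times `m + 1, …, n`. -/
def meanAfter (M : PanelModel P) (n : ℕ) (k : Fin (M.p n)) (m : ℕ) (ω : Ω) : ℝ :=
  (∑ t ∈ Finset.Icc (m + 1) n, M.X n k t ω) / ((n : ℝ) - m)

/-- The least squares criterion `L(b)` at the grid point `b = m / n`. -/
def L (M : PanelModel P) (n m : ℕ) (ω : Ω) : ℝ :=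
  (1 / (n : ℝ)) * ∑ k : Fin (M.p n),
    (∑ t ∈ Finset.Icc 1 m, (M.X n k t ω - M.meanBefore n k m ω) ^ 2 +
      ∑ t ∈ Finset.Icc (m + 1) n, (M.X n k t ω - M.meanAfter n k m ω) ^ 2)

/-- `b` minimises the least squares criterion over the grid points `m / n` in `(c*, 1 - c*)`. -/
def IsMinimiser (M : PanelModel P) (n : ℕ) (ω : Ω) (b : ℝ) : Prop :=
  ∃ m : ℕ, b = m / n ∧ b ∈ Set.Ioo M.cstar (1 - M.cstar) ∧
    ∀ m' : ℕ, (m' : ℝ) / n ∈ Set.Ioo M.cstar (1 - M.cstar) → M.L n m ω ≤ M.L n m' ω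

/-- `τhat` is a least squares estimator of the change point; ties may be broken in any
measurable way. (For small `n` there may be no grid point in `(c*, 1 - c*)`.) -/
def IsLSE (M : PanelModel P) (τhat : ℕ → Ω → ℝ) : Prop :=
  (∀ n, Measurable (τhat n)) ∧ ∀ᶠ n in atTop, ∀ᵐ ω ∂P, M.IsMinimiser n ω (τhat n ω)

/-- Cross-sectional independence: all coefficient matrices are diagonal. -/
def IsDiagonal (M : PanelModel P) : Prop := ∀ n j, (M.A n j).IsDiag

/-- The diagonal coefficient `a_{j,k}` in row `n`. -/
def a (M : PanelModel P) (n : ℕ) (j : ℕ) (k : Fin (M.p n)) : ℝ := M.A n j k k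

/-- `sup_k ∑_j |a_{j,k}|` is bounded. -/
def BoundedCoeff (M : PanelModel P) : Prop :=
  ∃ C : ℝ, ∀ n k, Summable (fun j => |M.a n j k|) ∧ ∑' j, |M.a n j k| ≤ C

/-- `sup_k |a_{0,k}|` is bounded. -/
def BoundedLead (M : PanelModel P) : Prop := ∃ C : ℝ, ∀ n k, |M.a n 0 k| ≤ C

/-- Bai's assumption (1): `sup_k ∑_j j |a_{j,k}|` is bounded. -/
def Bai1 (M : PanelModel P) : Prop :=
  ∃ C : ℝ, ∀ n k, Summable (fun j : ℕ => (j : ℝ) * |M.a n j k|) ∧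
    ∑' j : ℕ, (j : ℝ) * |M.a n j k| ≤ C

/-- No correlation over time: `a_{j,k} = 0` for all `j ≠ 0`. -/
def Uncorrelated (M : PanelModel P) : Prop := ∀ n j k, j ≠ 0 → M.a n j k = 0

/-- The jump of the panel with number `k` as a sequence in `n` (zero while `k ≥ p n`, which
happens for finitely many `n` only). -/
def jump (M : PanelModel P) (k n : ℕ) : ℝ := if h : k < M.p n then M.δ n ⟨k, h⟩ else 0

open Classical in
/-- The panels of row `n` whose jump tends to zero. -/
def Kn (M : PanelModel P) (n : ℕ) : Finset (Fin (M.p n)) :=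
  {k | Tendsto (M.jump k) atTop (𝓝 0)}

/-- The panels of row `n` whose jump does not tend to zero. -/
def K0 (M : PanelModel P) (n : ℕ) : Finset (Fin (M.p n)) := (M.Kn n)ᶜ

/-- The largest jump over the panels of `Kn` is asymptotically negligible. -/
def NegligibleJumps (M : PanelModel P) : Prop :=
  Tendsto (fun n => ⨆ k : M.Kn n, |M.δ n k|) atTop (𝓝 0)

/-- The change point converges to a point inside `(c*, 1 - c*)`. -/
def ChangePointConverges (M : PanelModel P) : Prop :=
  ∃ τstar ∈ Set.Ioo M.cstar (1 - M.cstar), Tendsto M.τ atTop (𝓝 τstar)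

/-- `σ` is the nonnegative number with `σ² = lim ∑_{k ∈ Kn} (μ₁ₖ - μ₂ₖ)² a_{0,k}²`;
in particular this limit exists. -/
def IsSigmaStar (M : PanelModel P) (σ : ℝ) : Prop :=
  0 ≤ σ ∧ Tendsto (fun n => ∑ k ∈ M.Kn n, (M.δ n k) ^ 2 * (M.a n 0 k) ^ 2) atTop (𝓝 (σ ^ 2))

end PanelModel

/-- (SNR*): `(n / p) ‖δ‖² → ∞`. -/
def SNRStar (p : ℕ → ℕ) (δ : ∀ n, EuclideanSpace ℝ (Fin (p n))) : Prop :=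
  Tendsto (fun n : ℕ => (n : ℝ) / (p n : ℝ) * ‖δ n‖ ^ 2) atTop atTop

/-- Bai's assumption (2): `p^{-1/2} ∑_k δ_k² → ∞`. -/
def Bai2 (p : ℕ → ℕ) (δ : ∀ n, EuclideanSpace ℝ (Fin (p n))) : Prop :=
  Tendsto (fun n => (∑ k, (δ n k) ^ 2) / √(p n : ℝ)) atTop atTop

/-- `n⁻¹ p log log n → 0`. -/
def LogLogGrowth (p : ℕ → ℕ) : Prop :=
  Tendsto (fun n : ℕ => (p n : ℝ) * Real.log (Real.log n) / n) atTop (𝓝 0)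

/-- `p / n → 0`. -/
def SublinearGrowth (p : ℕ → ℕ) : Prop :=
  Tendsto (fun n : ℕ => (p n : ℝ) / n) atTop (𝓝 0)

/-- Bai's assumption (3): `‖δ‖ → ∞` and `n⁻¹ p log log n → 0`. -/
def Bai3 (p : ℕ → ℕ) (δ : ∀ n, EuclideanSpace ℝ (Fin (p n))) : Prop :=
  Tendsto (fun n => ‖δ n‖) atTop atTop ∧ LogLogGrowth p

/-- `B` has the law of a standard two-sided Brownian motion observed at integer times:
it starts at `0` and has independent increments, `B t - B s` being `N(0, t - s)` for `s ≤ t`. -/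
structure IsBrownianAtIntegers {Ω : Type*} [MeasurableSpace Ω] (B : ℤ → Ω → ℝ)
    (P : Measure Ω) : Prop where
  zero : ∀ᵐ ω ∂P, B 0 ω = 0
  indep : HasIndepIncrements B P
  law : ∀ s t : ℤ, s ≤ t →
    HasLaw (fun ω => B t ω - B s ω) (gaussianReal 0 (Real.toNNReal ((t : ℝ) - s))) P

/-- The process `h ↦ -0.5 c |h| + σ B_h` on the integers. -/
def driftProcess {Ω : Type*} (c σ : ℝ) (B : ℤ → Ω → ℝ) (h : ℤ) (ω : Ω) : ℝ :=
  -(1 / 2) * c * |(h : ℝ)| + σ * B h ω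

/-- `H` is distributed as `argmax_{h ∈ ℤ} (-0.5 c |h| + σ B_h)`. -/
def IsBrownianArgmax {Ω : Type*} [MeasurableSpace Ω] (P : Measure Ω) (c σ : ℝ)
    (H : Ω → ℤ) : Prop :=
  ∃ B : ℤ → Ω → ℝ, IsBrownianAtIntegers B P ∧ Measurable H ∧
    ∀ᵐ ω ∂P, ∀ h : ℤ, driftProcess c σ B h ω ≤ driftProcess c σ B (H ω) ω

/-- Bai's setting for a jump of moderate size: cross-sectionally independent panels with bounded
coefficients and no correlation over time, `‖μ₁ - μ₂‖² → c > 0`, a change point that stays inside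
`(c*, 1 - c*)`, and existence of `σ* = σ`. -/
structure ModerateJump {Ω : Type*} [MeasurableSpace Ω] {P : Measure Ω} (M : PanelModel P)
    (c σ : ℝ) : Prop where
  diagonal : M.IsDiagonal
  bounded : M.BoundedCoeff
  uncorrelated : M.Uncorrelated
  c_pos : 0 < c
  jump_size : Tendsto (fun n => ‖M.δ n‖ ^ 2) atTop (𝓝 c)
  changePoint : M.ChangePointConverges
  sigma : M.IsSigmaStar σ

end

/-! Write D = ‖δ‖², let m₀ be the true change point and m₀ + h a competing split. The total sum of
squares does not depend on the split, so n (L(m₀ + h) − L(m₀)) is a difference of between-group sums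
of squares. By `between_sq_sub` and `PanelModel.L_expansion` it equals r (|h| D − 2 W(h)) + E(h).
Here c* ≤ r ≤ 1, W is the noise sum `walk` weighted by the jump, and E collects the quadratic noise
terms and one linear term over a whole side of the sample. Two estimates, uniform in h, carry the
theorem.

Remainder: |E(h)| ≤ const · θ D |h| for all h at once, with probability tending to one, under (SNR*)
and D bounded below (`tendsto_measure_not_goodRow`). The cross terms of E are inner products over p
panels of two block sums. Their means are O(p |h|), negligible against n D |h| precisely by (SNR*).
Their variances are O(p n |h|), and Chebyshev's inequality along the squares h = j², together with
the short blocks between squares, gives summable bounds (`NoiseRow.measure_cross_uniform`). Hence no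
iterated logarithm is needed.

Linear term: fourth moments give P(|W(h)| > θ |h| D) = O(D⁻² h⁻²), which is summable in h. The
probability that W beats the drift somewhere at distance at least H is therefore at most a constant
times D⁻² times a tail of ∑ h⁻² (`measure_walk_gt`). If D → ∞, H = 1 already works and the estimator
is exact. If D → c, large H gives tightness of n(τ̂ − τ).

For the limit law the steps of W are independent over time, and their characteristic functions are
products over panels. Negligible jumps make all weights small, so these products converge to
Gaussian ones. Finite windows of W then converge in law. If the limiting drifted walk has its
maximum at h separated from its other values on the window, which is an open condition, the
estimator sits at h. This bounds the point masses from below, and Fatou's lemma turns that into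
convergence in distribution.

Both counterexamples put the whole jump, of size one, into one panel whose noise takes the values
1/4 and −1. To the right of m₀ the walk never overcomes the drift, while one step to the left it
does so with probability 1/5. A limit law would live on h ≤ 0 and charge h < 0, but the Brownian
argmax is symmetric. If the loaded panel is the last one, each fixed panel's jump vanishes
eventually; if it is the first one, all other jumps are zero. -/

set_option linter.unusedSectionVars false

noncomputable section

/-! ### Moments of sums of independent centred variables -/

section Moments

variable {Ω : Type*} [MeasurableSpace Ω] {P : Measure Ω}

/-- `(E X Y)² ≤ E X² E Y²` in square root free form. -/
lemma integral_mul_le_of_sq_le {X Y : Ω → ℝ} (hX : MemLp X 2 P) (hY : MemLp Y 2 P) {u v : ℝ}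
    (hu : 0 ≤ u) (hv : 0 ≤ v) (hXu : ∫ ω, X ω ^ 2 ∂P ≤ u ^ 2) (hYv : ∫ ω, Y ω ^ 2 ∂P ≤ v ^ 2) :
    ∫ ω, X ω * Y ω ∂P ≤ u * v := by
  have hXi := hX.integrable_sq
  have hYi := hY.integrable_sq
  have hXY : Integrable (fun ω => X ω * Y ω) P := hX.integrable_mul hY
  -- The arithmetic-geometric mean inequality with weight s. The optimal choice is s = v/u; if u or
  -- v is zero, s is taken large or small instead, at the cost of ε.
  have key : ∀ s : ℝ, 0 < s → ∫ ω, X ω * Y ω ∂P ≤ (s * u ^ 2 + s⁻¹ * v ^ 2) / 2 := by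
    intro s hs
    calc ∫ ω, X ω * Y ω ∂P ≤ ∫ ω, (s * X ω ^ 2 + s⁻¹ * Y ω ^ 2) / 2 ∂P := by
          refine integral_mono hXY (((hXi.const_mul s).add (hYi.const_mul s⁻¹)).div_const 2) ?_
          intro ω
          have : s * (s⁻¹ * Y ω) = Y ω := by field_simp
          have h2 : 0 ≤ s * (X ω - s⁻¹ * Y ω) ^ 2 := by positivity
          have h3 : s * (X ω - s⁻¹ * Y ω) ^ 2 = s * X ω ^ 2 - 2 * (X ω * Y ω) + s⁻¹ * Y ω ^ 2 := by
            field_simp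
            ring
          simp only
          linarith
      _ = (s * ∫ ω, X ω ^ 2 ∂P + s⁻¹ * ∫ ω, Y ω ^ 2 ∂P) / 2 := by
          rw [integral_div, integral_add (hXi.const_mul s) (hYi.const_mul s⁻¹),
            integral_const_mul, integral_const_mul]
      _ ≤ _ := by gcongr
  refine le_of_forall_pos_le_add fun ε hε => ?_
  rcases hu.eq_or_lt with rfl | hu'
  · have := key ((v ^ 2 + 1) / ε) (by positivity)
    have h1 : ((v ^ 2 + 1) / ε)⁻¹ * v ^ 2 ≤ ε := by
      rw [inv_div, div_mul_eq_mul_div, div_le_iff₀ (by positivity)]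
      nlinarith
    nlinarith
  rcases hv.eq_or_lt with rfl | hv'
  · have := key (ε / u ^ 2) (by positivity)
    have h1 : ε / u ^ 2 * u ^ 2 = ε := by field_simp
    rw [h1] at this
    nlinarith
  · have := key (v / u) (by positivity)
    have h1 : (v / u * u ^ 2 + (v / u)⁻¹ * v ^ 2) / 2 = u * v := by field_simp; ring
    linarith

lemma integral_add_sq_of_indep {X Y : Ω → ℝ} (hX : MemLp X 2 P) (hY : MemLp Y 2 P)
    (hXY : IndepFun X Y P) (hX0 : ∫ ω, X ω ∂P = 0) :
    ∫ ω, (X ω + Y ω) ^ 2 ∂P = ∫ ω, X ω ^ 2 ∂P + ∫ ω, Y ω ^ 2 ∂P := by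
  have hmul : ∫ ω, X ω * Y ω ∂P = 0 := by
    rw [hXY.integral_fun_mul_eq_mul_integral hX.1 hY.1, hX0, zero_mul]
  have hexp : ∀ ω, (X ω + Y ω) ^ 2 = X ω ^ 2 + 2 * (X ω * Y ω) + Y ω ^ 2 := fun ω => by ring
  have hXYi : Integrable (fun ω => X ω * Y ω) P := hX.integrable_mul hY
  simp_rw [hexp]
  rw [integral_add (hX.integrable_sq.fun_add (hXYi.const_mul 2)) hY.integrable_sq,
    integral_add hX.integrable_sq (hXYi.const_mul 2), integral_const_mul, hmul]
  ring

variable [IsProbabilityMeasure P]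

lemma memLp_two_of_four {X : Ω → ℝ} (hX : MemLp X 4 P) : MemLp X 2 P :=
  hX.mono_exponent (by norm_num)

lemma integrable_of_memLp_four {X : Ω → ℝ} (hX : MemLp X 4 P) : Integrable X P :=
  memLp_one_iff_integrable.1 (hX.mono_exponent (by norm_num))

lemma integrable_pow_of_memLp_four {X : Ω → ℝ} (hX : MemLp X 4 P) {q : ℕ} (hq : q ≤ 4) :
    Integrable (fun ω => X ω ^ q) P := by
  rcases Nat.eq_zero_or_pos q with rfl | hq0
  · simp
  · have h : MemLp X q P := hX.mono_exponent (by exact_mod_cast hq)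
    have := h.integrable_norm_pow hq0.ne'
    refine this.mono (hX.1.pow q) (ae_of_all _ fun ω => by simp)

lemma memLp_sq_of_memLp_four {X : Ω → ℝ} (hX : MemLp X 4 P) :
    MemLp (fun ω => X ω ^ 2) 2 P := by
  rw [memLp_two_iff_integrable_sq (f := fun ω => X ω ^ 2) (hX.1.pow 2)]
  simpa [← pow_mul] using integrable_pow_of_memLp_four hX (q := 4) le_rfl

/-- `(E X²)² ≤ E X⁴`. -/
lemma integral_sq_sq_le_integral_four {X : Ω → ℝ} (hX : MemLp X 4 P) :
    (∫ ω, X ω ^ 2 ∂P) ^ 2 ≤ ∫ ω, X ω ^ 4 ∂P := by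
  have h := variance_eq_sub (memLp_sq_of_memLp_four hX)
  have h0 := variance_nonneg (fun ω => X ω ^ 2) P
  simp only [Pi.pow_apply, ← pow_mul] at h
  norm_num at h
  linarith

lemma integral_sq_le_of_integral_four_le {X : Ω → ℝ} (hX : MemLp X 4 P) {v : ℝ} (hv : 0 ≤ v)
    (h : ∫ ω, X ω ^ 4 ∂P ≤ v ^ 2) : ∫ ω, X ω ^ 2 ∂P ≤ v :=
  le_of_sq_le_sq ((integral_sq_sq_le_integral_four hX).trans h) hv

lemma integral_add_pow_four {X Y : Ω → ℝ} (hX : MemLp X 4 P) (hY : MemLp Y 4 P)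
    (hXY : IndepFun X Y P) (hX0 : ∫ ω, X ω ∂P = 0) (hY0 : ∫ ω, Y ω ∂P = 0) :
    ∫ ω, (X ω + Y ω) ^ 4 ∂P = ∫ ω, X ω ^ 4 ∂P + 6 * ((∫ ω, X ω ^ 2 ∂P) * ∫ ω, Y ω ^ 2 ∂P) +
      ∫ ω, Y ω ^ 4 ∂P := by
  have hind : ∀ a b : ℕ, IndepFun (fun ω => X ω ^ a) (fun ω => Y ω ^ b) P := fun a b =>
    hXY.comp (φ := fun x => x ^ a) (ψ := fun x => x ^ b) (by fun_prop) (by fun_prop)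
  have hint : ∀ a b : ℕ, a ≤ 4 → b ≤ 4 → Integrable (fun ω => X ω ^ a * Y ω ^ b) P :=
    fun a b ha hb => (hind a b).integrable_mul (integrable_pow_of_memLp_four hX ha)
      (integrable_pow_of_memLp_four hY hb)
  have hval : ∀ a b : ℕ, a ≤ 4 → b ≤ 4 →
      ∫ ω, X ω ^ a * Y ω ^ b ∂P = (∫ ω, X ω ^ a ∂P) * ∫ ω, Y ω ^ b ∂P := fun a b ha hb =>
    (hind a b).integral_fun_mul_eq_mul_integral (hX.1.pow a) (hY.1.pow b)
  have hexp : ∀ ω, (X ω + Y ω) ^ 4 = X ω ^ 4 * Y ω ^ 0 + 4 * (X ω ^ 3 * Y ω ^ 1) +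
      6 * (X ω ^ 2 * Y ω ^ 2) + 4 * (X ω ^ 1 * Y ω ^ 3) + X ω ^ 0 * Y ω ^ 4 := fun ω => by ring
  simp_rw [hexp]
  have i40 := hint 4 0 (by norm_num) (by norm_num)
  have i31 := (hint 3 1 (by norm_num) (by norm_num)).const_mul 4
  have i22 := (hint 2 2 (by norm_num) (by norm_num)).const_mul 6
  have i13 := (hint 1 3 (by norm_num) (by norm_num)).const_mul 4
  have i04 := hint 0 4 (by norm_num) (by norm_num)
  rw [integral_add (((i40.fun_add i31).fun_add i22).fun_add i13) i04,
    integral_add ((i40.fun_add i31).fun_add i22) i13, integral_add (i40.fun_add i31) i22,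
    integral_add i40 i31, integral_const_mul, integral_const_mul, integral_const_mul,
    hval 4 0 (by norm_num) (by norm_num), hval 3 1 (by norm_num) (by norm_num),
    hval 2 2 (by norm_num) (by norm_num), hval 1 3 (by norm_num) (by norm_num),
    hval 0 4 (by norm_num) (by norm_num)]
  simp [hX0, hY0]

variable {ι : Type*} {Y : ι → Ω → ℝ}

/-- Second moment of a sum of independent centred variables. -/
lemma integral_sum_sq_le (hY : iIndepFun Y P) (hm : ∀ i, Measurable (Y i))
    (hL : ∀ i, MemLp (Y i) 2 P) (h0 : ∀ i, ∫ ω, Y i ω ∂P = 0) {v : ι → ℝ}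
    (hv : ∀ i, ∫ ω, Y i ω ^ 2 ∂P ≤ v i) (s : Finset ι) :
    ∫ ω, (∑ i ∈ s, Y i ω) ^ 2 ∂P ≤ ∑ i ∈ s, v i := by
  classical
  induction s using Finset.induction_on with
  | empty => simp
  | insert j s hj ih =>
    simp_rw [Finset.sum_insert hj]
    have hind : IndepFun (Y j) (fun ω => ∑ i ∈ s, Y i ω) P := by
      have := (hY.indepFun_finsetSum_of_notMem hm hj).symm
      convert this using 2
      simp
    rw [integral_add_sq_of_indep (hL j) (memLp_finsetSum _ fun i _ => hL i) hind (h0 j)]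
    exact add_le_add (hv j) ih

/-- Fourth moment of a sum of independent centred variables. -/
lemma integral_sum_four_le (hY : iIndepFun Y P) (hm : ∀ i, Measurable (Y i))
    (hL : ∀ i, MemLp (Y i) 4 P) (h0 : ∀ i, ∫ ω, Y i ω ∂P = 0) {v : ι → ℝ} (hv0 : ∀ i, 0 ≤ v i)
    (hv : ∀ i, ∫ ω, Y i ω ^ 4 ∂P ≤ v i ^ 2) (s : Finset ι) :
    ∫ ω, (∑ i ∈ s, Y i ω) ^ 4 ∂P ≤ 3 * (∑ i ∈ s, v i) ^ 2 := by
  classical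
  have hv2 : ∀ i, ∫ ω, Y i ω ^ 2 ∂P ≤ v i := fun i =>
    integral_sq_le_of_integral_four_le (hL i) (hv0 i) (hv i)
  induction s using Finset.induction_on with
  | empty => simp
  | insert j s hj ih =>
    simp_rw [Finset.sum_insert hj]
    have hind : IndepFun (Y j) (fun ω => ∑ i ∈ s, Y i ω) P := by
      have := (hY.indepFun_finsetSum_of_notMem hm hj).symm
      convert this using 2
      simp
    have hs0 : ∫ ω, ∑ i ∈ s, Y i ω ∂P = 0 := by
      rw [integral_finsetSum _ fun i _ => integrable_of_memLp_four (hL i)]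
      simp [h0]
    rw [integral_add_pow_four (hL j) (memLp_finsetSum _ fun i _ => hL i) hind (h0 j) hs0]
    have h2 := integral_sum_sq_le hY hm (fun i => memLp_two_of_four (hL i)) h0 hv2 s
    have hV : 0 ≤ ∑ i ∈ s, v i := Finset.sum_nonneg fun i _ => hv0 i
    have h2' : 0 ≤ ∫ ω, (∑ i ∈ s, Y i ω) ^ 2 ∂P := integral_nonneg fun ω => sq_nonneg _
    have h3 : (∫ ω, Y j ω ^ 2 ∂P) * ∫ ω, (∑ i ∈ s, Y i ω) ^ 2 ∂P ≤ v j * ∑ i ∈ s, v i :=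
      mul_le_mul (hv2 j) h2 h2' (hv0 j)
    -- With V the sum over `s`, the induction closes by v² + 6 v V + 3 V² ≤ 3 (v + V)²; the mixed
    -- term 6 is what fixes the constant 3.
    nlinarith [hv j, hv0 j, sq_nonneg (v j)]

/-- Markov's inequality for the fourth moment. -/
lemma measure_abs_gt_le_of_four {X : Ω → ℝ} (hX : MemLp X 4 P) {lam b : ℝ} (hlam : 0 < lam)
    (hb : ∫ ω, X ω ^ 4 ∂P ≤ b) : P {ω | lam < |X ω|} ≤ ENNReal.ofReal (b / lam ^ 4) := by
  have h := mul_meas_ge_le_integral_of_nonneg (μ := P) (f := fun ω => X ω ^ 4)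
    (ae_of_all _ fun ω => by positivity) (integrable_pow_of_memLp_four hX le_rfl) (lam ^ 4)
  rw [← ENNReal.ofReal_toReal (measure_ne_top P {ω | lam < |X ω|})]
  refine ENNReal.ofReal_le_ofReal ?_
  rw [le_div_iff₀ (by positivity), mul_comm]
  refine le_trans ?_ (h.trans hb)
  gcongr
  refine measureReal_mono (fun ω (hω : lam < |X ω|) => ?_)
  have : lam ^ 4 ≤ |X ω| ^ 4 := by gcongr
  simpa [show |X ω| ^ 4 = X ω ^ 4 from Even.pow_abs (by decide) _] using this

/-- Markov's inequality for the second moment. -/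
lemma measure_abs_gt_le_of_sq {X : Ω → ℝ} (hX : MemLp X 2 P) {lam b : ℝ} (hlam : 0 < lam)
    (hb : ∫ ω, X ω ^ 2 ∂P ≤ b) : P {ω | lam < |X ω|} ≤ ENNReal.ofReal (b / lam ^ 2) := by
  have h := mul_meas_ge_le_integral_of_nonneg (μ := P) (f := fun ω => X ω ^ 2)
    (ae_of_all _ fun ω => by positivity) hX.integrable_sq (lam ^ 2)
  rw [← ENNReal.ofReal_toReal (measure_ne_top P {ω | lam < |X ω|})]
  refine ENNReal.ofReal_le_ofReal ?_
  rw [le_div_iff₀ (by positivity), mul_comm]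
  refine le_trans ?_ (h.trans hb)
  gcongr
  refine measureReal_mono (fun ω (hω : lam < |X ω|) => ?_)
  have : lam ^ 2 ≤ |X ω| ^ 2 := by gcongr
  simpa using this

end Moments

/-! ### Independence of the rows of an array -/

/-- If an array is independent, so are its rows (rows of varying lengths). -/
lemma iIndepFun.rows_sigma {Ω ι : Type*} [MeasurableSpace Ω] {P : Measure Ω} {κ : ι → Type*}
    {η : (i : ι) → κ i → Ω → ℝ} (hm : ∀ i j, Measurable (η i j))
    (h : iIndepFun (fun q : (i : ι) × κ i => η q.1 q.2) P) :
    iIndepFun (fun i ω (j : κ i) => η i j ω) P := by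
  have := h.isProbabilityMeasure
  have hP : ∀ i j, IsProbabilityMeasure (P.map (η i j)) :=
    fun i j => Measure.isProbabilityMeasure_map (hm i j).aemeasurable
  have hrow : ∀ i, iIndepFun (η i) P := fun i =>
    h.precomp (g := fun j => (⟨i, j⟩ : (i : ι) × κ i)) fun a b hab => by simpa using hab
  have hm' : ∀ i, Measurable (fun ω (j : κ i) => η i j ω) := fun i =>
    measurable_pi_lambda _ fun j => hm i j
  rw [iIndepFun_iff_map_fun_eq_infinitePi_map (X := fun q : (i : ι) × κ i => η q.1 q.2)
    (fun q => hm q.1 q.2)] at h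
  rw [iIndepFun_iff_map_fun_eq_infinitePi_map hm']
  have e1 : ∀ i, P.map (fun ω j => η i j ω) = Measure.infinitePi fun j => P.map (η i j) :=
    fun i => (hrow i).map_fun_eq_infinitePi_map (hm i)
  simp_rw [e1]
  rw [← Measure.infinitePi_map_piCurry (fun i j => P.map (η i j)), ← h,
    Measure.map_map (MeasurableEquiv.piCurry fun i (j : κ i) => ℝ).measurable
      (measurable_pi_lambda _ fun q : (i : ι) × κ i => hm q.1 q.2)]
  rfl

/-- If an array is independent, so are its rows. -/
lemma iIndepFun.rows {Ω ι κ : Type*} [MeasurableSpace Ω] {P : Measure Ω} {η : ι → κ → Ω → ℝ}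
    (hm : ∀ i j, Measurable (η i j)) (h : iIndepFun (fun q : ι × κ => η q.1 q.2) P) :
    iIndepFun (fun i ω j => η i j ω) P :=
  iIndepFun.rows_sigma hm (h.precomp (Equiv.sigmaEquivProd ι κ).injective)

/-! ### Linear processes -/

section LinearProcess

variable {Ω : Type*} [MeasurableSpace Ω] {P : Measure Ω} [IsProbabilityMeasure P]

/-- Series are handled by Minkowski's inequality and Fatou for `eLpNorm`, the probability bounds by
plain fourth moments; this is the bridge. -/
lemma eLpNorm_four_le_iff {X : Ω → ℝ} (hX : MemLp X 4 P) {c : ℝ} (hc : 0 ≤ c) :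
    eLpNorm X 4 P ≤ ENNReal.ofReal c ↔ ∫ ω, X ω ^ 4 ∂P ≤ c ^ 4 := by
  have hI : 0 ≤ ∫ ω, X ω ^ 4 ∂P := integral_nonneg fun ω => by positivity
  rw [hX.eLpNorm_eq_integral_rpow_norm (by norm_num) (by norm_num),
    ENNReal.ofReal_le_ofReal_iff hc]
  have e : ∀ ω, ‖X ω‖ ^ ((4 : ENNReal).toReal) = X ω ^ 4 := fun ω => by
    have : ((4 : ENNReal).toReal) = ((4 : ℕ) : ℝ) := by norm_num
    rw [this, Real.rpow_natCast, Real.norm_eq_abs, Even.pow_abs (by decide)]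
  simp_rw [e]
  have h4 : ((4 : ENNReal).toReal)⁻¹ = (4 : ℝ)⁻¹ := by norm_num
  rw [h4, Real.rpow_inv_le_iff_of_pos hI hc (by norm_num)]
  norm_cast

section Series

variable {f : ℕ → Ω → ℝ} {a : ℕ → ℝ} {A c : ℝ}

/-- The L⁴ norms of the terms are at most |a j| c, which is summable, and this forces almost sure
absolute convergence. -/
lemma ae_summable_mul (hf : ∀ j, MemLp (f j) 4 P) (hc : 0 ≤ c)
    (h4 : ∀ j, ∫ ω, f j ω ^ 4 ∂P ≤ c ^ 4) (ha : Summable fun j => |a j|) :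
    ∀ᵐ ω ∂P, Summable fun j => a j * f j ω := by
  have := summable_norm_of_tsum_eLpNorm_ne_top (μ := P) (p := 4) (by norm_num)
    (f := fun j ω => a j * f j ω) (fun j => ((hf j).const_mul (a j)).1) ?_
  · filter_upwards [this] with ω hω using hω.of_norm
  · have hle : ∀ j, eLpNorm (fun ω => a j * f j ω) 4 P ≤ ENNReal.ofReal (|a j| * c) := fun j => by
      rw [eLpNorm_four_le_iff ((hf j).const_mul (a j)) (by positivity)]
      simp_rw [mul_pow]
      rw [integral_const_mul, Even.pow_abs (by decide)]
      gcongr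
      exact h4 j
    refine ne_top_of_le_ne_top ?_ (ENNReal.tsum_le_tsum hle)
    exact (ha.mul_right c).tsum_ofReal_ne_top

/-- Minkowski's inequality bounds the partial sums, and Fatou's lemma passes the bound to the limit.
-/
lemma eLpNorm_tsum_mul_le (hf : ∀ j, MemLp (f j) 4 P) (hc : 0 ≤ c)
    (h4 : ∀ j, ∫ ω, f j ω ^ 4 ∂P ≤ c ^ 4) (ha : Summable fun j => |a j|)
    (hA : ∑' j, |a j| ≤ A) :
    eLpNorm (fun ω => ∑' j, a j * f j ω) 4 P ≤ ENNReal.ofReal (A * c) := by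
  have hm : ∀ j, MemLp (fun ω => a j * f j ω) 4 P := fun j => (hf j).const_mul (a j)
  have hA0 : 0 ≤ A := (tsum_nonneg fun j => abs_nonneg (a j)).trans hA
  have hle : ∀ j, eLpNorm (fun ω => a j * f j ω) 4 P ≤ ENNReal.ofReal (|a j| * c) := fun j => by
    rw [eLpNorm_four_le_iff (hm j) (by positivity)]
    simp_rw [mul_pow]
    rw [integral_const_mul, Even.pow_abs (by decide)]
    gcongr
    exact h4 j
  refine (Lp.eLpNorm_lim_le_liminf_eLpNorm (f := fun N ω => ∑ j ∈ Finset.range N, a j * f j ω)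
    (fun N => (memLp_finsetSum _ fun j _ => hm j).1) _ ?_).trans ?_
  · filter_upwards [ae_summable_mul hf hc h4 ha] with ω hω using hω.hasSum.tendsto_sum_nat
  · refine (liminf_le_liminf (v := fun _ => ENNReal.ofReal (A * c))
      (Eventually.of_forall fun N => ?_)).trans (by simp)
    have e : (fun ω => ∑ j ∈ Finset.range N, a j * f j ω) =
        ∑ j ∈ Finset.range N, fun ω => a j * f j ω := by ext; simp
    simp only [e]
    refine (eLpNorm_sum_le (fun j _ => (hm j).1) (by norm_num)).trans ?_
    refine (Finset.sum_le_sum fun j _ => hle j).trans ?_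
    rw [← ENNReal.ofReal_sum_of_nonneg fun j _ => by positivity, ← Finset.sum_mul]
    refine ENNReal.ofReal_le_ofReal (mul_le_mul_of_nonneg_right ?_ hc)
    exact (ha.sum_le_tsum _ fun j _ => abs_nonneg _).trans hA

lemma memLp_tsum_mul (hf : ∀ j, MemLp (f j) 4 P) (hc : 0 ≤ c)
    (h4 : ∀ j, ∫ ω, f j ω ^ 4 ∂P ≤ c ^ 4) (ha : Summable fun j => |a j|)
    (hm : ∀ j, Measurable (f j)) :
    MemLp (fun ω => ∑' j, a j * f j ω) 4 P :=
  ⟨(Measurable.tsum fun j => (hm j).const_mul (a j)).aestronglyMeasurable,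
    (eLpNorm_tsum_mul_le hf hc h4 ha le_rfl).trans_lt ENNReal.ofReal_lt_top⟩

/-- By Cauchy–Schwarz the terms are summable in L¹, so integral and series may be exchanged. A bound
on the covariance of `G` with each term then survives with the factor ∑ |a j|. -/
lemma abs_integral_mul_tsum_le (hf : ∀ j, MemLp (f j) 4 P) (hc : 0 ≤ c)
    (h4 : ∀ j, ∫ ω, f j ω ^ 4 ∂P ≤ c ^ 4) (ha : Summable fun j => |a j|)
    (hA : ∑' j, |a j| ≤ A) {G : Ω → ℝ} (hG : MemLp G 4 P) {B : ℝ}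
    (hB : ∀ j, |∫ ω, G ω * f j ω ∂P| ≤ B) :
    |∫ ω, G ω * ∑' j, a j * f j ω ∂P| ≤ A * B := by
  have hG2 := memLp_two_of_four hG
  have hf2 := fun j => memLp_two_of_four (hf j)
  have hint : ∀ j, Integrable (fun ω => G ω * f j ω) P := fun j => hG2.integrable_mul (hf2 j)
  have hB0 : 0 ≤ B := (abs_nonneg _).trans (hB 0)
  have hGG : ∫ ω, |G ω| ^ 2 ∂P ≤ √(∫ ω, G ω ^ 2 ∂P) ^ 2 := by
    rw [Real.sq_sqrt (integral_nonneg fun ω => sq_nonneg _)]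
    simp
  have hff : ∀ j, ∫ ω, |f j ω| ^ 2 ∂P ≤ c ^ 2 := fun j => by
    simp only [sq_abs]
    refine integral_sq_le_of_integral_four_le (hf j) (by positivity) ((h4 j).trans (by ring_nf; rfl))
  have hsum : Summable fun j => ∫ ω, ‖a j * (G ω * f j ω)‖ ∂P := by
    refine Summable.of_nonneg_of_le (fun j => integral_nonneg fun ω => norm_nonneg _) (fun j => ?_)
      (ha.mul_right (√(∫ ω, G ω ^ 2 ∂P) * c))
    simp_rw [norm_mul, Real.norm_eq_abs]
    rw [integral_const_mul]
    refine mul_le_mul_of_nonneg_left ?_ (abs_nonneg _)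
    exact integral_mul_le_of_sq_le hG2.abs (hf2 j).abs (Real.sqrt_nonneg _) hc hGG (hff j)
  have h := hasSum_integral_of_summable_integral_norm
    (fun j => (hint j).const_mul (a j)) hsum
  have e : ∫ ω, G ω * ∑' j, a j * f j ω ∂P = ∫ ω, ∑' j, a j * (G ω * f j ω) ∂P := by
    refine integral_congr_ae (ae_of_all _ fun ω => ?_)
    simp only
    rw [← tsum_mul_left]
    exact tsum_congr fun j => by ring
  rw [e, ← h.tsum_eq]
  simp_rw [integral_const_mul]
  have hle : ∀ j, ‖a j * ∫ ω, G ω * f j ω ∂P‖ ≤ |a j| * B := fun j => by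
    rw [norm_mul, Real.norm_eq_abs, Real.norm_eq_abs]
    exact mul_le_mul_of_nonneg_left (hB j) (abs_nonneg _)
  refine (tsum_of_norm_bounded (ha.mul_right B).hasSum hle).trans ?_
  rw [tsum_mul_right]
  exact mul_le_mul_of_nonneg_right hA hB0

end Series

/-- Independent centred variables with unit variance and fourth moment at most `κ²`. -/
structure IsWhiteNoise (η : ℤ → Ω → ℝ) (P : Measure Ω) (κ : ℝ) : Prop where
  nonneg : 0 ≤ κ
  measurable : ∀ t, Measurable (η t)
  indep : iIndepFun η P
  memLp : ∀ t, MemLp (η t) 4 P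
  mean : ∀ t, ∫ ω, η t ω ∂P = 0
  var : ∀ t, ∫ ω, η t ω ^ 2 ∂P = 1
  fourth : ∀ t, ∫ ω, η t ω ^ 4 ∂P ≤ κ ^ 2

/-- The linear filter `t ↦ ∑_{j ≥ 0} a_j x_{t-j}`. -/
def linearFilter (a : ℕ → ℝ) (x : ℤ → ℝ) (t : ℤ) : ℝ := ∑' j : ℕ, a j * x (t - j)

lemma measurable_linearFilter (a : ℕ → ℝ) (t : ℤ) :
    Measurable fun x : ℤ → ℝ => linearFilter a x t :=
  Measurable.tsum fun _ => (measurable_pi_apply _).const_mul _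

namespace IsWhiteNoise

variable {η : ℤ → Ω → ℝ} {κ A : ℝ} {a : ℕ → ℝ}

lemma fourth_sum_shift (h : IsWhiteNoise η P κ) (I : Finset ℤ) (j : ℕ) :
    ∫ ω, (∑ t ∈ I, η (t - j) ω) ^ 4 ∂P ≤ 3 * (κ * I.card) ^ 2 := by
  have := integral_sum_four_le (Y := fun t : ℤ => η (t - j))
    (h.indep.precomp (g := fun t : ℤ => t - j) (sub_left_injective))
    (fun t => h.measurable _) (fun t => h.memLp _) (fun t => h.mean _) (v := fun _ => κ)
    (fun _ => h.nonneg) (fun t => h.fourth _) I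
  simpa [mul_comm] using this

lemma integral_mul_eq (h : IsWhiteNoise η P κ) (s t : ℤ) :
    ∫ ω, η s ω * η t ω ∂P = if s = t then 1 else 0 := by
  split_ifs with hst
  · subst hst
    simpa [sq] using h.var s
  · rw [(h.indep.indepFun hst).integral_fun_mul_eq_mul_integral (h.memLp s).1 (h.memLp t).1,
      h.mean, zero_mul]

/-- The fourth root of the bound in `fourth_sum_shift`. -/
lemma exists_fourth_root {b : ℝ} (hb : 0 ≤ b) : ∃ c : ℝ, 0 ≤ c ∧ c ^ 4 = b :=
  ⟨√√b, Real.sqrt_nonneg _, by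
    rw [show 4 = 2 * 2 from rfl, pow_mul, Real.sq_sqrt (Real.sqrt_nonneg _), Real.sq_sqrt hb]⟩

/-- Exchanging the two sums makes a block sum of the filtered process a filter of shifted block sums
of white noise, so only moments of the latter are needed. -/
lemma ae_sum_filter_eq (h : IsWhiteNoise η P κ) (ha : Summable fun j => |a j|) (I : Finset ℤ) :
    (fun ω => ∑ t ∈ I, linearFilter a (fun s => η s ω) t) =ᵐ[P]
      fun ω => ∑' j : ℕ, a j * ∑ t ∈ I, η (t - j) ω := by
  obtain ⟨c, hc, hc4⟩ := exists_fourth_root (sq_nonneg κ)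
  have hs : ∀ᵐ ω ∂P, ∀ t ∈ I, Summable fun j : ℕ => a j * η (t - j) ω := by
    refine (I.eventually_all).2 fun t _ => ?_
    exact ae_summable_mul (fun j => h.memLp _) hc (fun j => hc4 ▸ h.fourth _) ha
  filter_upwards [hs] with ω hω
  simp_rw [linearFilter, Finset.mul_sum]
  exact (Summable.tsum_finsetSum hω).symm

lemma memLp_filter (h : IsWhiteNoise η P κ) (ha : Summable fun j => |a j|) (t : ℤ) :
    MemLp (fun ω => linearFilter a (fun s => η s ω) t) 4 P := by
  obtain ⟨c, hc, hc4⟩ := exists_fourth_root (sq_nonneg κ)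
  exact memLp_tsum_mul (fun j => h.memLp _) hc (fun j => hc4 ▸ h.fourth _) ha
    fun j => h.measurable _

lemma integral_filter (h : IsWhiteNoise η P κ) (ha : Summable fun j => |a j|) (t : ℤ) :
    ∫ ω, linearFilter a (fun s => η s ω) t ∂P = 0 := by
  obtain ⟨c, hc, hc4⟩ := exists_fourth_root (sq_nonneg κ)
  have := abs_integral_mul_tsum_le (a := a) (f := fun (j : ℕ) ω => η (t - j) ω)
    (fun j => h.memLp _) hc (fun j => hc4 ▸ h.fourth _) ha le_rfl
    (G := fun _ => 1) (memLp_const 1) (B := 0) (fun j => by simp [h.mean])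
  simpa [linearFilter] using this

/-- Minkowski over the lags gives the random-walk bound 3 κ² |I|² times A⁴; the 3 is rounded up to 4
to make the bound a perfect square. -/
lemma fourth_filter (h : IsWhiteNoise η P κ) (ha : Summable fun j => |a j|)
    (hA : ∑' j, |a j| ≤ A) (I : Finset ℤ) :
    ∫ ω, (∑ t ∈ I, linearFilter a (fun s => η s ω) t) ^ 4 ∂P ≤ (2 * κ * A ^ 2 * I.card) ^ 2 := by
  obtain ⟨c, hc, hc4⟩ := exists_fourth_root (b := 3 * (κ * I.card) ^ 2) (by positivity)
  have hA0 : 0 ≤ A := (tsum_nonneg fun j => abs_nonneg (a j)).trans hA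
  have hf : ∀ j : ℕ, MemLp (fun ω => ∑ t ∈ I, η (t - j) ω) 4 P :=
    fun j => memLp_finsetSum _ fun t _ => h.memLp _
  have h4 : ∀ j : ℕ, ∫ ω, (∑ t ∈ I, η (t - j) ω) ^ 4 ∂P ≤ c ^ 4 :=
    fun j => hc4 ▸ h.fourth_sum_shift I j
  have hmem := memLp_tsum_mul (a := a) hf hc h4 ha
    fun _ => Finset.measurable_fun_sum _ fun t _ => h.measurable _
  have := (eLpNorm_four_le_iff hmem (by positivity)).1 (eLpNorm_tsum_mul_le hf hc h4 ha hA)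
  have hae := h.ae_sum_filter_eq ha I
  have e : ∫ ω, (∑ t ∈ I, linearFilter a (fun s => η s ω) t) ^ 4 ∂P =
      ∫ ω, (∑' j : ℕ, a j * ∑ t ∈ I, η (t - j) ω) ^ 4 ∂P :=
    integral_congr_ae (hae.mono fun ω hω => by simp only at hω; simp only [hω])
  rw [e]
  refine this.trans ?_
  rw [mul_pow, hc4]
  have : 0 ≤ A ^ 4 * (κ * I.card) ^ 2 := by positivity
  nlinarith

/-- For each lag at most one time of `I` meets a given innovation, so the block sum has covariance
at most A with any single innovation. Filtering the second factor costs another A. The bound does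
not see the size of `I`. -/
lemma abs_integral_filter_mul_le (h : IsWhiteNoise η P κ) (ha : Summable fun j => |a j|)
    (hA : ∑' j, |a j| ≤ A) (I : Finset ℤ) (u : ℤ) :
    |∫ ω, (∑ t ∈ I, linearFilter a (fun s => η s ω) t) * linearFilter a (fun s => η s ω) u ∂P| ≤
      A ^ 2 := by
  have hA0 : 0 ≤ A := (tsum_nonneg fun j => abs_nonneg (a j)).trans hA
  obtain ⟨c, hc, hc4⟩ := exists_fourth_root (sq_nonneg κ)
  have hmem : MemLp (fun ω => ∑ t ∈ I, linearFilter a (fun s => η s ω) t) 4 P :=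
    memLp_finsetSum _ fun t _ => h.memLp_filter ha t
  have hstep : ∀ v, |∫ ω, (∑ t ∈ I, linearFilter a (fun s => η s ω) t) * η v ω ∂P| ≤ A := fun v => by
    obtain ⟨c', hc', hc4'⟩ := exists_fourth_root (b := 3 * (κ * I.card) ^ 2) (by positivity)
    have hf : ∀ j : ℕ, MemLp (fun ω => ∑ t ∈ I, η (t - j) ω) 4 P :=
      fun j => memLp_finsetSum _ fun t _ => h.memLp _
    have h4 : ∀ j : ℕ, ∫ ω, (∑ t ∈ I, η (t - j) ω) ^ 4 ∂P ≤ c' ^ 4 :=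
      fun j => hc4' ▸ h.fourth_sum_shift I j
    have e : ∫ ω, (∑ t ∈ I, linearFilter a (fun s => η s ω) t) * η v ω ∂P =
        ∫ ω, η v ω * ∑' j : ℕ, a j * ∑ t ∈ I, η (t - j) ω ∂P :=
      integral_congr_ae ((h.ae_sum_filter_eq ha I).mono fun ω hω => by
        simp only at hω; simp only [hω, mul_comm])
    rw [e]
    refine (abs_integral_mul_tsum_le hf hc' h4 ha hA (h.memLp v) (B := 1) fun j => ?_).trans
      (by simp)
    simp_rw [Finset.mul_sum]
    have hint : ∀ t ∈ I, Integrable (fun ω => η v ω * η (t - j) ω) P := fun t _ =>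
      (memLp_two_of_four (h.memLp v)).integrable_mul (memLp_two_of_four (h.memLp _))
    rw [integral_finsetSum _ hint]
    simp_rw [h.integral_mul_eq]
    rw [Finset.sum_congr rfl fun t _ => if_congr
      (show v = t - j ↔ v + j = t from eq_sub_iff_add_eq) rfl rfl, Finset.sum_ite_eq]
    split_ifs <;> simp
  have := abs_integral_mul_tsum_le (a := a) (f := fun (j : ℕ) ω => η (u - j) ω)
    (fun j => h.memLp _) hc (fun j => hc4 ▸ h.fourth _) ha hA hmem fun j => hstep _
  rw [sq]
  exact this

end IsWhiteNoise

end LinearProcess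

/-! ### Rows of cross-sectionally independent errors -/

section NoiseRow

variable {Ω : Type*} [MeasurableSpace Ω] {P : Measure Ω} [IsProbabilityMeasure P]
  {ι : Type*} [Fintype ι]

/-- Finitely many independent centred error processes, with sums over time of fourth moment
comparable to that of a random walk, and with summable autocovariances. -/
structure NoiseRow (e : ι → ℤ → Ω → ℝ) (P : Measure Ω) (K : ℝ) : Prop where
  nonneg : 0 ≤ K
  measurable : ∀ k t, Measurable (e k t)
  indep : iIndepFun (fun k ω t => e k t ω) P
  memLp : ∀ k t, MemLp (e k t) 4 P
  mean : ∀ k t, ∫ ω, e k t ω ∂P = 0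
  fourth : ∀ k (I : Finset ℤ), ∫ ω, (∑ t ∈ I, e k t ω) ^ 4 ∂P ≤ (K * I.card) ^ 2
  cov : ∀ k (I : Finset ℤ) t, |∫ ω, (∑ s ∈ I, e k s ω) * e k t ω ∂P| ≤ K

/-- Sum of the errors of panel `k` over the times in `I`. -/
def blockSum (e : ι → ℤ → Ω → ℝ) (I : Finset ℤ) (k : ι) (ω : Ω) : ℝ := ∑ t ∈ I, e k t ω

namespace NoiseRow

variable {e : ι → ℤ → Ω → ℝ} {K : ℝ}

lemma measurable_blockSum (h : NoiseRow e P K) (I : Finset ℤ) (k : ι) :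
    Measurable (blockSum e I k) :=
  Finset.measurable_fun_sum _ fun t _ => h.measurable k t

lemma memLp_blockSum (h : NoiseRow e P K) (I : Finset ℤ) (k : ι) :
    MemLp (blockSum e I k) 4 P :=
  memLp_finsetSum _ fun t _ => h.memLp k t

lemma integral_blockSum (h : NoiseRow e P K) (I : Finset ℤ) (k : ι) :
    ∫ ω, blockSum e I k ω ∂P = 0 := by
  simp only [blockSum]
  rw [integral_finsetSum _ fun t _ => integrable_of_memLp_four (h.memLp k t)]
  simp [h.mean]

lemma four_blockSum (h : NoiseRow e P K) (I : Finset ℤ) (k : ι) :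
    ∫ ω, blockSum e I k ω ^ 4 ∂P ≤ (K * I.card) ^ 2 := h.fourth k I

/-- Only independence across panels is used: the two blocks of one panel may overlap or be
dependent. -/
lemma indep_comp_blockSum (h : NoiseRow e P K) (I J : Finset ℤ) {g : ι → ℝ → ℝ → ℝ}
    (hg : ∀ k, Measurable fun x : ℝ × ℝ => g k x.1 x.2) :
    iIndepFun (fun k ω => g k (blockSum e I k ω) (blockSum e J k ω)) P :=
  h.indep.comp (fun k x => g k (∑ t ∈ I, x t) (∑ t ∈ J, x t)) fun k =>
    (hg k).comp ((Finset.measurable_fun_sum _ fun t _ => measurable_pi_apply t).prodMk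
      (Finset.measurable_fun_sum _ fun t _ => measurable_pi_apply t))

lemma linear_indep (h : NoiseRow e P K) (d : ι → ℝ) (I : Finset ℤ) :
    iIndepFun (fun k ω => d k * blockSum e I k ω) P :=
  h.indep_comp_blockSum I I (g := fun k x _ => d k * x) fun k => by fun_prop

lemma four_linear (h : NoiseRow e P K) (d : ι → ℝ) (I : Finset ℤ) :
    ∫ ω, (∑ k, d k * blockSum e I k ω) ^ 4 ∂P ≤ 3 * (K * I.card * ∑ k, d k ^ 2) ^ 2 := by
  have := integral_sum_four_le (h.linear_indep d I)
    (fun k => (h.measurable_blockSum I k).const_mul (d k))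
    (fun k => (h.memLp_blockSum I k).const_mul (d k))
    (fun k => by rw [integral_const_mul, h.integral_blockSum, mul_zero])
    (v := fun k => K * I.card * d k ^ 2) (fun k => by have := h.nonneg; positivity)
    (fun k => by
      simp_rw [mul_pow (d k)]
      rw [integral_const_mul]
      have := h.four_blockSum I k
      nlinarith [show 0 ≤ d k ^ 4 by positivity]) Finset.univ
  rwa [← Finset.mul_sum] at this

lemma sq_linear (h : NoiseRow e P K) (d : ι → ℝ) (I : Finset ℤ) :
    ∫ ω, (∑ k, d k * blockSum e I k ω) ^ 2 ∂P ≤ K * I.card * ∑ k, d k ^ 2 := by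
  have := integral_sum_sq_le (h.linear_indep d I)
    (fun k => (h.measurable_blockSum I k).const_mul (d k))
    (fun k => memLp_two_of_four ((h.memLp_blockSum I k).const_mul (d k)))
    (fun k => by rw [integral_const_mul, h.integral_blockSum, mul_zero])
    (v := fun k => K * I.card * d k ^ 2)
    (fun k => by
      simp_rw [mul_pow (d k)]
      rw [integral_const_mul, mul_comm]
      have hk := h.nonneg
      gcongr
      exact integral_sq_le_of_integral_four_le (h.memLp_blockSum I k) (by positivity)
        (h.four_blockSum I k)) Finset.univ
  rwa [← Finset.mul_sum] at this

lemma memLp_linear (h : NoiseRow e P K) (d : ι → ℝ) (I : Finset ℤ) :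
    MemLp (fun ω => ∑ k, d k * blockSum e I k ω) 4 P :=
  memLp_finsetSum _ fun k _ => (h.memLp_blockSum I k).const_mul (d k)

lemma measure_linear_gt_four (h : NoiseRow e P K) (d : ι → ℝ) (I : Finset ℤ) {lam : ℝ}
    (hlam : 0 < lam) : P {ω | lam < |∑ k, d k * blockSum e I k ω|} ≤
      ENNReal.ofReal (3 * (K * I.card * ∑ k, d k ^ 2) ^ 2 / lam ^ 4) :=
  measure_abs_gt_le_of_four (h.memLp_linear d I) hlam (h.four_linear d I)

lemma measure_linear_gt_sq (h : NoiseRow e P K) (d : ι → ℝ) (I : Finset ℤ) {lam : ℝ}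
    (hlam : 0 < lam) : P {ω | lam < |∑ k, d k * blockSum e I k ω|} ≤
      ENNReal.ofReal (K * I.card * ∑ k, d k ^ 2 / lam ^ 2) := by
  have := measure_abs_gt_le_of_sq (memLp_two_of_four (h.memLp_linear d I)) hlam (h.sq_linear d I)
  rwa [mul_div_assoc, Finset.sum_div] at this

/-- The bound is linear in `J` and free of `I`, which is what makes the mean of a cross term
proportional to the short block even when the other block is a whole side of the sample. -/
lemma abs_integral_block_mul_le (h : NoiseRow e P K) (I J : Finset ℤ) (k : ι) :
    |∫ ω, blockSum e I k ω * blockSum e J k ω ∂P| ≤ K * J.card := by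
  have hint : ∀ t ∈ J, Integrable (fun ω => (∑ s ∈ I, e k s ω) * e k t ω) P := fun t _ =>
    (memLp_two_of_four (h.memLp_blockSum I k)).integrable_mul (memLp_two_of_four (h.memLp k t))
  simp only [blockSum]
  simp_rw [Finset.mul_sum (s := J)]
  rw [integral_finsetSum _ hint]
  refine (Finset.abs_sum_le_sum_abs _ _).trans ?_
  refine (Finset.sum_le_sum fun t _ => h.cov k I t).trans ?_
  simp [mul_comm]

lemma memLp_block_mul (h : NoiseRow e P K) (I J : Finset ℤ) (k : ι) :
    MemLp (fun ω => blockSum e I k ω * blockSum e J k ω) 2 P := by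
  have : ENNReal.HolderTriple 4 4 2 := ⟨by
    rw [← two_mul, show (4 : ENNReal) = 2 * 2 by norm_num,
      ENNReal.mul_inv (by simp) (by simp), ← mul_assoc,
      ENNReal.mul_inv_cancel (by simp) (by simp), one_mul]⟩
  exact (h.memLp_blockSum J k).mul (h.memLp_blockSum I k)

lemma integral_block_mul_sq_le (h : NoiseRow e P K) (I J : Finset ℤ) (k : ι) :
    ∫ ω, (blockSum e I k ω * blockSum e J k ω) ^ 2 ∂P ≤ K ^ 2 * I.card * J.card := by
  have hk := h.nonneg
  simp_rw [mul_pow]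
  refine (integral_mul_le_of_sq_le (memLp_sq_of_memLp_four (h.memLp_blockSum I k))
    (memLp_sq_of_memLp_four (h.memLp_blockSum J k)) (u := K * I.card) (v := K * J.card)
    (by positivity) (by positivity) ?_ ?_).trans_eq (by ring)
  · simp_rw [← pow_mul]
    exact h.four_blockSum I k
  · simp_rw [← pow_mul]
    exact h.four_blockSum J k

/-- Chebyshev's inequality for the cross-sectional inner product of two block sums. -/
lemma measure_cross_gt (h : NoiseRow e P K) (I J : Finset ℤ) {lam : ℝ} (hlam : 0 < lam)
    (hmean : 2 * (Fintype.card ι * (K * J.card)) ≤ lam) :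
    P {ω | lam < |∑ k, blockSum e I k ω * blockSum e J k ω|} ≤
      ENNReal.ofReal (4 * K ^ 2 * Fintype.card ι * I.card * J.card / lam ^ 2) := by
  -- Half of `lam` absorbs the means through `hmean`; the other half is left for Chebyshev's
  -- inequality applied to the centred independent products.
  set μ : ι → ℝ := fun k => ∫ ω, blockSum e I k ω * blockSum e J k ω ∂P with hμ
  have hLp := fun k => h.memLp_block_mul I J k
  have hint := fun k => (hLp k).integrable one_le_two
  have hind : iIndepFun (fun k ω => blockSum e I k ω * blockSum e J k ω - μ k) P :=
    h.indep_comp_blockSum I J (g := fun k x y => x * y - μ k) fun k => by fun_prop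
  have hsq := integral_sum_sq_le hind
    (fun k => ((h.measurable_blockSum I k).mul (h.measurable_blockSum J k)).sub_const _)
    (fun k => (hLp k).sub (memLp_const _))
    (fun k => by rw [integral_sub (hint k) (integrable_const _)]; simp [hμ])
    (v := fun _ => K ^ 2 * I.card * J.card)
    (fun k => by
      refine le_trans ?_ (h.integral_block_mul_sq_le I J k)
      have h1 := variance_eq_integral (hLp k).1.aemeasurable
      have h2 := variance_le_expectation_sq (hLp k).1
      simp only [Pi.pow_apply] at h1 h2
      rw [h1] at h2
      exact h2) Finset.univ
  have hmemS : MemLp (fun ω => ∑ k, (blockSum e I k ω * blockSum e J k ω - μ k)) 2 P :=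
    memLp_finsetSum _ fun k _ => (hLp k).sub (memLp_const _)
  refine (measure_mono fun ω (hω : lam < _) => ?_).trans
    ((measure_abs_gt_le_of_sq hmemS (half_pos hlam) hsq).trans_eq ?_)
  · have hμs : |∑ k, μ k| ≤ Fintype.card ι * (K * J.card) := by
      refine (Finset.abs_sum_le_sum_abs _ _).trans ?_
      refine (Finset.sum_le_sum fun k _ => h.abs_integral_block_mul_le I J k).trans ?_
      simp
    have htri : |∑ k, blockSum e I k ω * blockSum e J k ω| ≤
        |∑ k, (blockSum e I k ω * blockSum e J k ω - μ k)| + |∑ k, μ k| := by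
      rw [Finset.sum_sub_distrib]
      have := abs_add_le (∑ k, blockSum e I k ω * blockSum e J k ω - ∑ k, μ k) (∑ k, μ k)
      simpa using this
    show lam / 2 < _
    linarith
  · congr 1
    rw [Finset.sum_const, Finset.card_univ, nsmul_eq_mul]
    field_simp
    ring

end NoiseRow

end NoiseRow

/-! ### Uniform control of the noise terms -/

section Uniform

variable {Ω : Type*} [MeasurableSpace Ω] {P : Measure Ω} [IsProbabilityMeasure P]
  {ι : Type*} [Fintype ι]

lemma measure_exists_le_tsum {E : ℕ → Set Ω} {q : ℕ → Prop} {g : ℕ → ℝ} {c : ℝ} (hc : 0 ≤ c)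
    (hg : ∀ h, 0 ≤ g h) (hs : Summable g) (hE : ∀ h, q h → P (E h) ≤ ENNReal.ofReal (c * g h)) :
    P {ω | ∃ h, q h ∧ ω ∈ E h} ≤ ENNReal.ofReal (c * ∑' h, g h) := by
  have e : {ω | ∃ h, q h ∧ ω ∈ E h} = ⋃ h, {ω | q h ∧ ω ∈ E h} := by ext; simp
  rw [e, ← tsum_mul_left, ENNReal.ofReal_tsum_of_nonneg (fun h => mul_nonneg hc (hg h))
    (hs.mul_left c)]
  refine (measure_iUnion_le _).trans (ENNReal.tsum_le_tsum fun h => ?_)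
  by_cases hq : q h
  · simpa [hq] using hE h hq
  · simp [hq]

lemma measure_exists_le_card {E : ℕ → Set Ω} {n : ℕ} {c : ℝ}
    (hE : ∀ h, 1 ≤ h → h ≤ n → P (E h) ≤ ENNReal.ofReal c) :
    P {ω | ∃ h, (1 ≤ h ∧ h ≤ n) ∧ ω ∈ E h} ≤ ENNReal.ofReal (n * c) := by
  have e : {ω | ∃ h, (1 ≤ h ∧ h ≤ n) ∧ ω ∈ E h} = ⋃ h ∈ Finset.Icc 1 n, E h := by
    ext; simp
  rw [e]
  refine (measure_biUnion_finset_le _ _).trans ?_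
  refine (Finset.sum_le_sum fun h hh => hE h (Finset.mem_Icc.1 hh).1 (Finset.mem_Icc.1 hh).2).trans ?_
  rw [Finset.sum_const, Nat.card_Icc, Nat.add_sub_cancel, nsmul_eq_mul,
    ENNReal.ofReal_mul (by positivity), ENNReal.ofReal_natCast]

/-- For h > 0, √h ≤ 2 `Nat.sqrt h`, so the terms are at most 8 h^(−3/2). They arise from the blocks
between a square and the next one; the term at 0 is 1/0 = 0. -/
lemma summable_one_div_sqrt_pow_three : Summable fun h : ℕ => 1 / (Nat.sqrt h : ℝ) ^ 3 := by
  refine Summable.of_nonneg_of_le (fun h => by positivity) (fun h => ?_)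
    ((Real.summable_one_div_nat_rpow (p := 3 / 2)).2 (by norm_num) |>.mul_left 8)
  rcases Nat.eq_zero_or_pos h with rfl | hh
  · simp
  have hs : 0 < Nat.sqrt h := Nat.sqrt_pos.2 hh
  have hlt : h ≤ (2 * Nat.sqrt h) ^ 2 := by
    have := Nat.lt_succ_sqrt' h
    nlinarith
  have hs' : (0 : ℝ) < Nat.sqrt h := by exact_mod_cast hs
  have hle : (h : ℝ) ^ (3 / 2 : ℝ) ≤ 8 * (Nat.sqrt h : ℝ) ^ 3 := by
    have h1 : (h : ℝ) ≤ (2 * (Nat.sqrt h : ℝ)) ^ 2 := by exact_mod_cast hlt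
    calc (h : ℝ) ^ (3 / 2 : ℝ) ≤ ((2 * (Nat.sqrt h : ℝ)) ^ 2) ^ (3 / 2 : ℝ) :=
          Real.rpow_le_rpow (by positivity) h1 (by norm_num)
      _ = (2 * (Nat.sqrt h : ℝ)) ^ (3 : ℝ) := by
          rw [← Real.rpow_natCast, ← Real.rpow_mul (by positivity)]
          norm_num
      _ = 8 * (Nat.sqrt h : ℝ) ^ 3 := by
          rw [show (3 : ℝ) = ((3 : ℕ) : ℝ) by norm_num, Real.rpow_natCast]
          ring
  have hpos : (0 : ℝ) < (h : ℝ) ^ (3 / 2 : ℝ) := by positivity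
  rw [mul_one_div, div_le_div_iff₀ (by positivity) hpos]
  linarith

lemma summable_one_div_sq : Summable fun h : ℕ => 1 / (h : ℝ) ^ 2 :=
  Real.summable_one_div_nat_pow.2 one_lt_two

/-- The constant of `NoiseRow.measure_cross_uniform`. -/
def crossConst : ℝ := 16 * ∑' j : ℕ, 1 / (j : ℝ) ^ 2 + 32 * ∑' h : ℕ, 1 / (Nat.sqrt h : ℝ) ^ 3

/-- The tails of `∑ 1 / h²`. -/
def sqTail (H : ℕ) : ℝ := ∑' h : ℕ, 1 / ((h + H : ℕ) : ℝ) ^ 2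

lemma sqTail_nonneg (H : ℕ) : 0 ≤ sqTail H := tsum_nonneg fun h => by positivity

lemma tendsto_sqTail : Tendsto sqTail atTop (𝓝 0) :=
  tendsto_sum_nat_add fun h : ℕ => 1 / (h : ℝ) ^ 2

lemma crossConst_nonneg : 0 ≤ crossConst := by
  have h1 : 0 ≤ ∑' j : ℕ, 1 / (j : ℝ) ^ 2 := tsum_nonneg fun _ => by positivity
  have h2 : 0 ≤ ∑' h : ℕ, 1 / (Nat.sqrt h : ℝ) ^ 3 := tsum_nonneg fun _ => by positivity
  unfold crossConst
  positivity

namespace NoiseRow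

variable {e : ι → ℤ → Ω → ℝ} {K : ℝ}

lemma blockSum_of_subset {I J : Finset ℤ} (hIJ : I ⊆ J) (k : ι) (ω : Ω) :
    blockSum e J k ω = blockSum e I k ω + blockSum e (J \ I) k ω := by
  simp only [blockSum]
  rw [add_comm, Finset.sum_sdiff hIJ]

/-- The inner products of a block sum over a fixed set with those over growing sets are uniformly
small relative to the size of the growing sets. -/
lemma measure_cross_uniform (h : NoiseRow e P K) {A : Finset ℤ} {I : ℕ → Finset ℤ}
    (hI : Monotone I) (hcard : ∀ m, (I m).card = m) {n : ℕ} (hA : A.card ≤ n) {l : ℝ} (hl : 0 < l)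
    (hmean : 8 * K * Fintype.card ι ≤ l) :
    P {ω | ∃ m, 1 ≤ m ∧ l * m < |∑ k, blockSum e A k ω * blockSum e (I m) k ω|} ≤
      ENNReal.ofReal (K ^ 2 * Fintype.card ι * n / l ^ 2 * crossConst) := by
  set c : ℝ := K ^ 2 * Fintype.card ι * n / l ^ 2 with hc
  have hc0 : 0 ≤ c := by positivity
  have hk := h.nonneg
  have hA' : (A.card : ℝ) ≤ n := by exact_mod_cast hA
  -- With j = `Nat.sqrt m`, the block `I m` splits into `I (j ^ 2)` and a rest of at most 2 j
  -- points, and each part is allowed half of the threshold l j² ≤ l m.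
  set E₁ : ℕ → Set Ω := fun j =>
    {ω | l * j ^ 2 / 2 < |∑ k, blockSum e A k ω * blockSum e (I (j ^ 2)) k ω|}
  set E₂ : ℕ → Set Ω := fun m => {ω | l * (Nat.sqrt m) ^ 2 / 2 <
    |∑ k, blockSum e A k ω * blockSum e (I m \ I (Nat.sqrt m ^ 2)) k ω|}
  have b₁ : P {ω | ∃ j, 1 ≤ j ∧ ω ∈ E₁ j} ≤
      ENNReal.ofReal (16 * c * ∑' j : ℕ, 1 / (j : ℝ) ^ 2) := by
    refine measure_exists_le_tsum (by positivity) (fun _ => by positivity)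
      summable_one_div_sq fun j hj => ?_
    have hj' : (1 : ℝ) ≤ j := by exact_mod_cast hj
    refine (h.measure_cross_gt A (I (j ^ 2)) (by positivity) ?_).trans
      (ENNReal.ofReal_le_ofReal ?_)
    · rw [hcard]
      push_cast
      nlinarith [mul_le_mul_of_nonneg_right hmean (sq_nonneg (j : ℝ)),
        show 0 ≤ K * Fintype.card ι * (j : ℝ) ^ 2 by positivity]
    · rw [hcard, hc]
      push_cast
      calc 4 * K ^ 2 * Fintype.card ι * A.card * (j : ℝ) ^ 2 / (l * j ^ 2 / 2) ^ 2
          ≤ 4 * K ^ 2 * Fintype.card ι * n * (j : ℝ) ^ 2 / (l * j ^ 2 / 2) ^ 2 := by gcongr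
        _ = _ := by field_simp; ring
  -- The rest has variance of order p n j against a threshold of order l j², so each `m` costs a
  -- multiple of 1/j³. Applying Chebyshev directly to `I m` would cost 1/m, whose sum diverges.
  have b₂ : P {ω | ∃ m, 1 ≤ m ∧ ω ∈ E₂ m} ≤
      ENNReal.ofReal (32 * c * ∑' m : ℕ, 1 / (Nat.sqrt m : ℝ) ^ 3) := by
    refine measure_exists_le_tsum (by positivity) (fun _ => by positivity)
      summable_one_div_sqrt_pow_three fun m hm => ?_
    set j := Nat.sqrt m with hj
    have hj1 : 1 ≤ j := Nat.sqrt_pos.2 hm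
    have hj' : (1 : ℝ) ≤ j := by exact_mod_cast hj1
    have hjm : j ^ 2 ≤ m := Nat.sqrt_le' m
    have hcd : ((I m \ I (j ^ 2)).card : ℝ) ≤ 2 * j := by
      rw [Finset.card_sdiff_of_subset (hI hjm), hcard, hcard]
      have := Nat.lt_succ_sqrt' m
      have h3 : m - j ^ 2 ≤ 2 * j := by
        rw [← hj] at this
        have : m < j ^ 2 + 2 * j + 1 := by nlinarith
        omega
      exact_mod_cast h3
    refine (h.measure_cross_gt A (I m \ I (j ^ 2)) (by positivity) ?_).trans
      (ENNReal.ofReal_le_ofReal ?_)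
    · calc 2 * (Fintype.card ι * (K * ((I m \ I (j ^ 2)).card : ℝ)))
          ≤ 2 * (Fintype.card ι * (K * (2 * j))) := by gcongr
        _ = 8 * K * Fintype.card ι * j / 2 := by ring
        _ ≤ l * j ^ 2 / 2 := by
          have : (j : ℝ) ≤ j ^ 2 := by nlinarith
          gcongr
    · rw [hc]
      calc 4 * K ^ 2 * Fintype.card ι * A.card * ((I m \ I (j ^ 2)).card : ℝ) /
            (l * j ^ 2 / 2) ^ 2
          ≤ 4 * K ^ 2 * Fintype.card ι * n * (2 * j) / (l * j ^ 2 / 2) ^ 2 := by gcongr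
        _ = _ := by field_simp; ring
  have hsub : {ω | ∃ m, 1 ≤ m ∧ l * m < |∑ k, blockSum e A k ω * blockSum e (I m) k ω|} ⊆
      {ω | ∃ j, 1 ≤ j ∧ ω ∈ E₁ j} ∪ {ω | ∃ m, 1 ≤ m ∧ ω ∈ E₂ m} := by
    rintro ω ⟨m, hm, hω⟩
    by_contra hcon
    simp only [Set.mem_union, Set.mem_ofPred_eq, not_or, not_exists, not_and] at hcon
    have hjm : Nat.sqrt m ^ 2 ≤ m := Nat.sqrt_le' m
    have h1 := hcon.1 (Nat.sqrt m) (Nat.sqrt_pos.2 hm)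
    have h2 := hcon.2 m hm
    simp only [E₁, E₂, Set.mem_ofPred_eq, not_lt] at h1 h2
    have hsum : ∑ k, blockSum e A k ω * blockSum e (I m) k ω =
        ∑ k, blockSum e A k ω * blockSum e (I (Nat.sqrt m ^ 2)) k ω +
        ∑ k, blockSum e A k ω * blockSum e (I m \ I (Nat.sqrt m ^ 2)) k ω := by
      rw [← Finset.sum_add_distrib]
      refine Finset.sum_congr rfl fun k _ => ?_
      rw [blockSum_of_subset (hI hjm)]
      ring
    rw [hsum] at hω
    have h3 := abs_add_le (∑ k, blockSum e A k ω * blockSum e (I (Nat.sqrt m ^ 2)) k ω)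
      (∑ k, blockSum e A k ω * blockSum e (I m \ I (Nat.sqrt m ^ 2)) k ω)
    have h4 : ((Nat.sqrt m : ℝ)) ^ 2 ≤ m := by exact_mod_cast hjm
    nlinarith
  refine (measure_mono hsub).trans ((measure_union_le _ _).trans ((add_le_add b₁ b₂).trans_eq ?_))
  rw [← ENNReal.ofReal_add]
  · congr 1
    rw [crossConst]
    ring
  · exact mul_nonneg (by positivity) (tsum_nonneg fun _ => by positivity)
  · exact mul_nonneg (by positivity) (tsum_nonneg fun _ => by positivity)

/-- The linear term is uniformly small relative to the drift at distance at least `H`. -/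
lemma measure_linear_uniform (h : NoiseRow e P K) (d : ι → ℝ) {I : ℕ → Finset ℤ}
    (hcard : ∀ m, (I m).card = m) {H : ℕ} (hH : 1 ≤ H) {θ : ℝ} (hθ : 0 < θ)
    (hd : 0 < ∑ k, d k ^ 2) :
    P {ω | ∃ m, H ≤ m ∧ θ * m * ∑ k, d k ^ 2 < |∑ k, d k * blockSum e (I m) k ω|} ≤
      ENNReal.ofReal (3 * K ^ 2 / (θ ^ 4 * (∑ k, d k ^ 2) ^ 2) * sqTail H) := by
  -- Fourth moments give the decay 1/m²; second moments would give only 1/m, which is not summable.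
  have key : ∀ i : ℕ, P {ω | θ * (i + H : ℕ) * ∑ k, d k ^ 2 <
      |∑ k, d k * blockSum e (I (i + H)) k ω|} ≤
      ENNReal.ofReal (3 * K ^ 2 / (θ ^ 4 * (∑ k, d k ^ 2) ^ 2) * (1 / ((i + H : ℕ) : ℝ) ^ 2)) := by
    intro i
    have hpos : (0 : ℝ) < (i + H : ℕ) := by
      have : 0 < i + H := by omega
      exact_mod_cast this
    refine (h.measure_linear_gt_four d (I (i + H)) (by positivity)).trans
      (ENNReal.ofReal_le_ofReal (le_of_eq ?_))
    rw [hcard]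
    generalize ((i + H : ℕ) : ℝ) = x at *
    generalize ∑ k, d k ^ 2 = D at *
    field_simp
  refine (measure_mono ?_).trans (measure_exists_le_tsum (q := fun _ => True)
    (by positivity) (fun _ => by positivity)
    ((summable_nat_add_iff H).2 summable_one_div_sq) fun i _ => key i)
  rintro ω ⟨m, hm, hω⟩
  obtain ⟨i, rfl⟩ := Nat.exists_eq_add_of_le' hm
  exact ⟨i, trivial, hω⟩

end NoiseRow

/-- All quadratic noise terms are small: `A` and `B` are the times on the two sides of the
change point and `I m` is the block of `m` times adjacent to it. -/
structure NoiseSmall (e : ι → ℤ → Ω → ℝ) (d : ι → ℝ) (A B : Finset ℤ) (I : ℕ → Finset ℤ)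
    (n : ℕ) (l : ℝ) (ω : Ω) : Prop where
  lin : |∑ k, d k * blockSum e A k ω| ≤ l
  sqA : |∑ k, blockSum e A k ω * blockSum e A k ω| ≤ l * n
  sqB : |∑ k, blockSum e B k ω * blockSum e B k ω| ≤ l * n
  sqI : ∀ m, 1 ≤ m → m ≤ n → |∑ k, blockSum e (I m) k ω * blockSum e (I m) k ω| ≤ l * m
  crossA : ∀ m, 1 ≤ m → |∑ k, blockSum e A k ω * blockSum e (I m) k ω| ≤ l * m
  crossB : ∀ m, 1 ≤ m → |∑ k, blockSum e B k ω * blockSum e (I m) k ω| ≤ l * m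

/-- A union bound over the six families of terms. The squares of the growing blocks cost p/l² for
each of at most n lengths, so a crude union bound gives p n/l², the same order as the chained cross
terms. For l = θ n D the total is of order 1/(n D) + p/(n D²). -/
lemma NoiseRow.measure_not_noiseSmall {e : ι → ℤ → Ω → ℝ} {K : ℝ} (h : NoiseRow e P K)
    (d : ι → ℝ) {A B : Finset ℤ} {I : ℕ → Finset ℤ}
    (hI : Monotone I) (hcard : ∀ m, (I m).card = m) {n : ℕ} (hn : 1 ≤ n)
    (hA : A.card ≤ n) (hB : B.card ≤ n) {l : ℝ} (hl : 0 < l)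
    (hmean : 8 * K * Fintype.card ι ≤ l) :
    P {ω | ¬ NoiseSmall e d A B I n l ω} ≤
      ENNReal.ofReal (K * n * ∑ k, d k ^ 2 / l ^ 2 +
        K ^ 2 * Fintype.card ι * n / l ^ 2 * (12 + 2 * crossConst)) := by
  have hn' : (1 : ℝ) ≤ n := by exact_mod_cast hn
  have hk := h.nonneg
  set c : ℝ := K ^ 2 * Fintype.card ι * n / l ^ 2 with hc
  have hc0 : 0 ≤ c := by positivity
  have hA' : (A.card : ℝ) ≤ n := by exact_mod_cast hA
  have hB' : (B.card : ℝ) ≤ n := by exact_mod_cast hB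
  have b₁ : P {ω | l < |∑ k, d k * blockSum e A k ω|} ≤
      ENNReal.ofReal (K * n * ∑ k, d k ^ 2 / l ^ 2) := by
    refine (h.measure_linear_gt_sq d A hl).trans (ENNReal.ofReal_le_ofReal ?_)
    have : 0 ≤ ∑ k, d k ^ 2 / l ^ 2 := Finset.sum_nonneg fun _ _ => by positivity
    gcongr
  have bsq : ∀ J : Finset ℤ, (J.card : ℝ) ≤ n →
      P {ω | l * n < |∑ k, blockSum e J k ω * blockSum e J k ω|} ≤ ENNReal.ofReal (4 * c) := by
    intro J hJ
    refine (h.measure_cross_gt J J (by positivity) ?_).trans (ENNReal.ofReal_le_ofReal ?_)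
    · have : 2 * (Fintype.card ι * (K * (J.card : ℝ))) ≤ 2 * (Fintype.card ι * (K * n)) := by gcongr
      nlinarith [show 0 ≤ K * Fintype.card ι * (n : ℝ) by positivity]
    · calc 4 * K ^ 2 * Fintype.card ι * (J.card : ℝ) * J.card / (l * n) ^ 2
          ≤ 4 * K ^ 2 * Fintype.card ι * n * n / (l * n) ^ 2 := by gcongr
        _ = 4 * (K ^ 2 * Fintype.card ι * 1 / l ^ 2) := by field_simp
        _ ≤ 4 * c := by rw [hc]; gcongr
  have b₄ : P {ω | ∃ m, (1 ≤ m ∧ m ≤ n) ∧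
      ω ∈ {ω | l * m < |∑ k, blockSum e (I m) k ω * blockSum e (I m) k ω|}} ≤
      ENNReal.ofReal (n * (4 * (K ^ 2 * Fintype.card ι / l ^ 2))) := by
    refine measure_exists_le_card fun m hm1 _ => ?_
    have hm' : (1 : ℝ) ≤ m := by exact_mod_cast hm1
    refine (h.measure_cross_gt (I m) (I m) (by positivity) ?_).trans
      (ENNReal.ofReal_le_ofReal (le_of_eq ?_))
    · rw [hcard]
      nlinarith [show 0 ≤ K * Fintype.card ι * (m : ℝ) by positivity]
    · rw [hcard]
      field_simp
  have b₅ := h.measure_cross_uniform hI hcard hA hl hmean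
  have b₆ := h.measure_cross_uniform hI hcard hB hl hmean
  have hsub : {ω | ¬ NoiseSmall e d A B I n l ω} ⊆
      {ω | l < |∑ k, d k * blockSum e A k ω|} ∪
      ({ω | l * n < |∑ k, blockSum e A k ω * blockSum e A k ω|} ∪
      ({ω | l * n < |∑ k, blockSum e B k ω * blockSum e B k ω|} ∪
      ({ω | ∃ m, (1 ≤ m ∧ m ≤ n) ∧
        ω ∈ {ω | l * m < |∑ k, blockSum e (I m) k ω * blockSum e (I m) k ω|}} ∪
      ({ω | ∃ m, 1 ≤ m ∧ l * m < |∑ k, blockSum e A k ω * blockSum e (I m) k ω|} ∪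
      {ω | ∃ m, 1 ≤ m ∧ l * m < |∑ k, blockSum e B k ω * blockSum e (I m) k ω|})))) := by
    intro ω hω
    by_contra hcon
    simp only [Set.mem_union, Set.mem_ofPred_eq, not_or, not_exists, not_and, not_lt] at hcon hω
    obtain ⟨h1, h2, h3, h4, h5, h6⟩ := hcon
    exact hω ⟨h1, h2, h3, fun m hm hmn => h4 m ⟨hm, hmn⟩, h5, h6⟩
  refine (measure_mono hsub).trans ?_
  refine (measure_union_le _ _).trans ((add_le_add b₁ ((measure_union_le _ _).trans (add_le_add
    (bsq A hA') ((measure_union_le _ _).trans (add_le_add (bsq B hB') ((measure_union_le _ _).trans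
    (add_le_add b₄ ((measure_union_le _ _).trans (add_le_add b₅ b₆))))))))).trans_eq ?_)
  have hcc := crossConst_nonneg
  have hS : 0 ≤ ∑ k, d k ^ 2 / l ^ 2 := Finset.sum_nonneg fun _ _ => by positivity
  rw [← ENNReal.ofReal_add (by positivity) (by positivity),
    ← ENNReal.ofReal_add (by positivity) (by positivity),
    ← ENNReal.ofReal_add (by positivity) (by positivity),
    ← ENNReal.ofReal_add (by positivity) (by positivity),
    ← ENNReal.ofReal_add (by positivity) (by positivity)]
  congr 1
  rw [hc]
  ring

end Uniform

/-! ### The least squares criterion near the change point -/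

section Criterion

lemma sum_sub_mean_sq {ι : Type*} (s : Finset ι) (x : ι → ℝ) {c : ℝ} (hc : c = s.card) :
    ∑ t ∈ s, (x t - (∑ u ∈ s, x u) / c) ^ 2 = ∑ t ∈ s, x t ^ 2 - (∑ t ∈ s, x t) ^ 2 / c := by
  subst hc
  rcases s.eq_empty_or_nonempty with rfl | hs
  · simp
  have hc : (s.card : ℝ) ≠ 0 := by exact_mod_cast hs.card_pos.ne'
  set S := ∑ u ∈ s, x u
  have : ∀ t, (x t - S / s.card) ^ 2 = x t ^ 2 - 2 * (S / s.card) * x t + (S / s.card) ^ 2 :=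
    fun t => by ring
  simp_rw [this]
  rw [Finset.sum_add_distrib, Finset.sum_sub_distrib, ← Finset.mul_sum, Finset.sum_const,
    nsmul_eq_mul]
  field_simp
  ring

lemma sum_Icc_natCast (a b : ℕ) (f : ℤ → ℝ) :
    ∑ t ∈ Finset.Icc (a + 1) b, f t = ∑ t ∈ Finset.Ioc (a : ℤ) b, f t := by
  have : Finset.Ioc (a : ℤ) b = (Finset.Icc (a + 1) b).map Nat.castEmbedding := by
    ext t
    simp only [Finset.mem_Ioc, Finset.mem_map, Finset.mem_Icc, Nat.castEmbedding_apply]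
    refine ⟨fun ⟨h1, h2⟩ => ⟨t.toNat, ?_, ?_⟩, ?_⟩
    · omega
    · omega
    · rintro ⟨u, hu, rfl⟩
      omega
  rw [this, Finset.sum_map]
  rfl

lemma blockSum_Ioc_add {Ω ι : Type*} (e : ι → ℤ → Ω → ℝ) {a b c : ℤ} (hab : a ≤ b) (hbc : b ≤ c)
    (k : ι) (ω : Ω) :
    blockSum e (Finset.Ioc a c) k ω =
      blockSum e (Finset.Ioc a b) k ω + blockSum e (Finset.Ioc b c) k ω := by
  simp only [blockSum]
  rw [← Finset.sum_union (Finset.disjoint_left.2 fun t h1 h2 => by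
    rw [Finset.mem_Ioc] at h1 h2; omega)]
  congr 1
  ext t
  simp only [Finset.mem_union, Finset.mem_Ioc]
  omega

/-- Change of the between-group sum of squares when `h` observations with mean `y` and total
error `w` are moved to the group of `α` observations with mean `x`. -/
lemma between_sq_sub {α β h x y a b w : ℝ} (hα : 0 < α) (hh : 0 ≤ h) (hβ : h < β) :
    (α * x + a) ^ 2 / α + (β * y + b) ^ 2 / β -
      ((α * x + h * y + (a + w)) ^ 2 / (α + h) + ((β - h) * y + (b - w)) ^ 2 / (β - h)) =
    α / (α + h) * (h * (x - y) ^ 2 - 2 * ((x - y) * w)) +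
      (2 * h / (α + h) * ((x - y) * a) + h / (α * (α + h)) * (a * a) - 2 / (α + h) * (a * w) -
        1 / (α + h) * (w * w) - h / ((β - h) * β) * (b * b) + 2 / (β - h) * (b * w) -
        1 / (β - h) * (w * w)) := by
  have h1 : 0 < α + h := by linarith
  have h2 : 0 < β - h := by linarith
  have h3 : 0 < β := by linarith
  -- Each enlarged or reduced group is expanded separately; the terms h y² + 2 y w that leave one
  -- group enter the other and cancel.
  have e1 : (α * x + h * y + (a + w)) ^ 2 / (α + h) = (α * x + a) ^ 2 / α -
      α / (α + h) * (h * (x - y) ^ 2 - 2 * ((x - y) * w)) + h * y ^ 2 + 2 * y * w -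
      (2 * h / (α + h) * ((x - y) * a) + h / (α * (α + h)) * (a * a) - 2 / (α + h) * (a * w) -
        1 / (α + h) * (w * w)) := by
    field_simp
    ring
  have e2 : ((β - h) * y + (b - w)) ^ 2 / (β - h) = (β * y + b) ^ 2 / β - h * y ^ 2 - 2 * y * w +
      h / ((β - h) * β) * (b * b) - 2 / (β - h) * (b * w) + 1 / (β - h) * (w * w) := by
    field_simp
    ring
  rw [e1, e2]
  ring

lemma abs_div_mul_le {u s q B : ℝ} (hq : 0 < q) (hqs : q ≤ s) (hu : |u| ≤ B) :
    |1 / s * u| ≤ B / q := by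
  have hs : 0 < s := hq.trans_le hqs
  rw [abs_mul, abs_of_pos (by positivity), one_div_mul_eq_div]
  exact div_le_div₀ ((abs_nonneg _).trans hu) hu hq hqs

/-- Summed over the panels, the remainder in `between_sq_sub` is at most of order `l h / n`. -/
lemma abs_sum_between_sub_le {ι : Type*} [Fintype ι] {a b w x y : ι → ℝ} {α β h κ n l : ℝ}
    (hκ : 0 < κ) (hκ1 : κ ≤ 1) (hn : 0 < n) (hα : κ * n ≤ α) (hh : 0 ≤ h) (hβ : κ * n ≤ β - h)
    (hda : |∑ k, (x k - y k) * a k| ≤ l) (haa : |∑ k, a k * a k| ≤ l * n)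
    (hbb : |∑ k, b k * b k| ≤ l * n) (hww : |∑ k, w k * w k| ≤ l * h)
    (haw : |∑ k, a k * w k| ≤ l * h) (hbw : |∑ k, b k * w k| ≤ l * h) :
    |∑ k, ((α * x k + a k) ^ 2 / α + (β * y k + b k) ^ 2 / β -
      ((α * x k + h * y k + (a k + w k)) ^ 2 / (α + h) +
        ((β - h) * y k + (b k - w k)) ^ 2 / (β - h))) -
      α / (α + h) * (h * ∑ k, (x k - y k) ^ 2 - 2 * ∑ k, (x k - y k) * w k)| ≤
      10 / κ ^ 2 * (l / n) * h := by
  have hq : 0 < κ * n := by positivity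
  have hα0 : 0 < α := hq.trans_le hα
  have hβh : 0 < β - h := hq.trans_le hβ
  have hβ0 : 0 < β := by linarith
  have hl : 0 ≤ l := (abs_nonneg _).trans hda
  simp_rw [between_sq_sub hα0 hh (show h < β by linarith)]
  have e : ∀ c₁ c₂ c₃ c₄ c₅ c₆ c₇ c₈ : ℝ, ∑ k, (c₁ * (h * (x k - y k) ^ 2 - 2 * ((x k - y k) * w k)) +
      (c₂ * ((x k - y k) * a k) + c₃ * (a k * a k) - c₄ * (a k * w k) - c₅ * (w k * w k) -
        c₆ * (b k * b k) + c₇ * (b k * w k) - c₈ * (w k * w k))) -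
      c₁ * (h * ∑ k, (x k - y k) ^ 2 - 2 * ∑ k, (x k - y k) * w k) =
      c₂ * ∑ k, (x k - y k) * a k + c₃ * ∑ k, a k * a k - c₄ * ∑ k, a k * w k -
        c₅ * ∑ k, w k * w k - c₆ * ∑ k, b k * b k + c₇ * ∑ k, b k * w k - c₈ * ∑ k, w k * w k := by
    intros
    simp only [Finset.sum_add_distrib, Finset.sum_sub_distrib, ← Finset.mul_sum]
    ring
  rw [e]
  have hαh : κ * n ≤ α + h := by linarith
  have hq2 : κ * n * (κ * n) ≤ α * (α + h) := mul_le_mul hα hαh hq.le hα0.le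
  have hq3 : κ * n * (κ * n) ≤ (β - h) * β := mul_le_mul hβ (by linarith) hq.le hβh.le
  have r₁ := abs_div_mul_le hq hαh hda
  have r₂ := abs_div_mul_le (by positivity) hq2 haa
  have r₃ := abs_div_mul_le hq hαh haw
  have r₄ := abs_div_mul_le hq hαh hww
  have r₅ := abs_div_mul_le (by positivity) hq3 hbb
  have r₆ := abs_div_mul_le hq hβ hbw
  have r₇ := abs_div_mul_le hq hβ hww
  set t := l / n * h with ht
  have ht0 : 0 ≤ t := by positivity
  have s₁ : |2 * h / (α + h) * ∑ k, (x k - y k) * a k| ≤ 2 * (t / κ) := by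
    have : 2 * h / (α + h) * ∑ k, (x k - y k) * a k =
        2 * h * (1 / (α + h) * ∑ k, (x k - y k) * a k) := by ring
    rw [this, abs_mul, abs_of_nonneg (by positivity)]
    calc 2 * h * |1 / (α + h) * ∑ k, (x k - y k) * a k| ≤ 2 * h * (l / (κ * n)) := by gcongr
      _ = _ := by rw [ht]; field_simp
  have s₂ : |h / (α * (α + h)) * ∑ k, a k * a k| ≤ t / κ ^ 2 := by
    have : h / (α * (α + h)) * ∑ k, a k * a k = h * (1 / (α * (α + h)) * ∑ k, a k * a k) := by ring
    rw [this, abs_mul, abs_of_nonneg hh]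
    calc h * |1 / (α * (α + h)) * ∑ k, a k * a k| ≤ h * (l * n / (κ * n * (κ * n))) := by gcongr
      _ = _ := by rw [ht]; field_simp
  have s₃ : |2 / (α + h) * ∑ k, a k * w k| ≤ 2 * (t / κ) := by
    have : 2 / (α + h) * ∑ k, a k * w k = 2 * (1 / (α + h) * ∑ k, a k * w k) := by ring
    rw [this, abs_mul, abs_two]
    calc 2 * |1 / (α + h) * ∑ k, a k * w k| ≤ 2 * (l * h / (κ * n)) := by gcongr
      _ = _ := by rw [ht]; field_simp
  have s₄ : |1 / (α + h) * ∑ k, w k * w k| ≤ t / κ :=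
    r₄.trans_eq (by rw [ht]; field_simp)
  have s₅ : |h / ((β - h) * β) * ∑ k, b k * b k| ≤ t / κ ^ 2 := by
    have : h / ((β - h) * β) * ∑ k, b k * b k = h * (1 / ((β - h) * β) * ∑ k, b k * b k) := by ring
    rw [this, abs_mul, abs_of_nonneg hh]
    calc h * |1 / ((β - h) * β) * ∑ k, b k * b k| ≤ h * (l * n / (κ * n * (κ * n))) := by gcongr
      _ = _ := by rw [ht]; field_simp
  have s₆ : |2 / (β - h) * ∑ k, b k * w k| ≤ 2 * (t / κ) := by
    have : 2 / (β - h) * ∑ k, b k * w k = 2 * (1 / (β - h) * ∑ k, b k * w k) := by ring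
    rw [this, abs_mul, abs_two]
    calc 2 * |1 / (β - h) * ∑ k, b k * w k| ≤ 2 * (l * h / (κ * n)) := by gcongr
      _ = _ := by rw [ht]; field_simp
  have s₇ : |1 / (β - h) * ∑ k, w k * w k| ≤ t / κ :=
    r₇.trans_eq (by rw [ht]; field_simp)
  -- As κ ≤ 1, every term is at most a multiple of t/κ²; the seven multiples 2 + 1 + 2 + 1 + 1 + 2 +
  -- 1 add up to the constant 10.
  have hk : t / κ ≤ t / κ ^ 2 := by
    gcongr
    nlinarith
  have e3 : 10 / κ ^ 2 * (l / n) * h = 10 * (t / κ ^ 2) := by rw [ht]; ring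
  rw [e3, abs_le]
  rw [abs_le] at s₁ s₂ s₃ s₄ s₅ s₆ s₇
  constructor <;> linarith [s₁.1, s₁.2, s₂.1, s₂.2, s₃.1, s₃.2, s₄.1, s₄.2, s₅.1, s₅.2, s₆.1, s₆.2,
    s₇.1, s₇.2]

end Criterion

/-! ### The criterion of the panel model as a between-group sum of squares -/

namespace PanelModel

variable {Ω : Type*} [MeasurableSpace Ω] {P : Measure Ω} (M : PanelModel P)

/-- The observations, at integer times. -/
def XZ (n : ℕ) (k : Fin (M.p n)) (t : ℤ) (ω : Ω) : ℝ :=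
  (if t ≤ ⌊(n : ℝ) * M.τ n⌋₊ then M.μ₁ n k else M.μ₂ n k) + M.ε n k t ω

lemma X_eq_XZ (n : ℕ) (k : Fin (M.p n)) (t : ℕ) (ω : Ω) : M.X n k t ω = M.XZ n k t ω := by
  simp [X, XZ]

/-- Within-group variation is total minus between-group variation, and the total over (0, n] does
not depend on `m`; it cancels in differences of the criterion. -/
lemma natCast_mul_L {n m : ℕ} (hn : 0 < n) (hm : m ≤ n) (ω : Ω) :
    n * M.L n m ω = ∑ k, (∑ t ∈ Finset.Ioc (0 : ℤ) n, M.XZ n k t ω ^ 2 -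
      ((∑ t ∈ Finset.Ioc (0 : ℤ) m, M.XZ n k t ω) ^ 2 / m +
        (∑ t ∈ Finset.Ioc (m : ℤ) n, M.XZ n k t ω) ^ 2 / (n - m))) := by
  have hn' : (n : ℝ) ≠ 0 := by exact_mod_cast hn.ne'
  rw [L, ← mul_assoc, mul_one_div_cancel hn', one_mul]
  refine Finset.sum_congr rfl fun k _ => ?_
  have h1 := sum_sub_mean_sq (Finset.Icc (0 + 1) m) (fun t : ℕ => M.XZ n k t ω) (c := m) (by simp)
  have h2 := sum_sub_mean_sq (Finset.Icc (m + 1) n) (fun t : ℕ => M.XZ n k t ω) (c := n - m)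
    (by rw [Nat.card_Icc, Nat.add_sub_add_right, Nat.cast_sub hm])
  simp only [meanBefore, meanAfter, X_eq_XZ]
  rw [zero_add] at h1
  rw [h1, h2, ← zero_add 1, sum_Icc_natCast 0 m (fun t => M.XZ n k t ω),
    sum_Icc_natCast 0 m (fun t => M.XZ n k t ω ^ 2), zero_add,
    sum_Icc_natCast m n (fun t => M.XZ n k t ω),
    sum_Icc_natCast m n (fun t => M.XZ n k t ω ^ 2)]
  have hs : ∑ t ∈ Finset.Ioc (0 : ℤ) n, M.XZ n k t ω ^ 2 =
      ∑ t ∈ Finset.Ioc (0 : ℤ) m, M.XZ n k t ω ^ 2 +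
        ∑ t ∈ Finset.Ioc (m : ℤ) n, M.XZ n k t ω ^ 2 :=
    blockSum_Ioc_add (fun k t ω => M.XZ n k t ω ^ 2) (by omega) (by omega) k ω
  rw [hs, Nat.cast_zero]
  ring

lemma sum_XZ_before {n : ℕ} {m₀ : ℕ} (h₀ : (n : ℝ) * M.τ n = m₀) {a b : ℤ} (hab : a ≤ b)
    (hb : b ≤ m₀) (k : Fin (M.p n)) (ω : Ω) :
    ∑ t ∈ Finset.Ioc a b, M.XZ n k t ω =
      (b - a) * M.μ₁ n k + blockSum (M.ε n) (Finset.Ioc a b) k ω := by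
  have : ∀ t ∈ Finset.Ioc a b, M.XZ n k t ω = M.μ₁ n k + M.ε n k t ω := fun t ht => by
    rw [XZ, h₀, Nat.floor_natCast, if_pos ((Finset.mem_Ioc.1 ht).2.trans hb)]
  rw [Finset.sum_congr rfl this, Finset.sum_add_distrib, Finset.sum_const, Int.card_Ioc,
    nsmul_eq_mul, blockSum]
  congr 2
  have : ((b - a).toNat : ℤ) = b - a := Int.toNat_of_nonneg (by omega)
  exact_mod_cast congrArg (Int.cast (R := ℝ)) this

lemma sum_XZ_after {n : ℕ} {m₀ : ℕ} (h₀ : (n : ℝ) * M.τ n = m₀) {a b : ℤ} (hab : a ≤ b)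
    (ha : m₀ ≤ a) (k : Fin (M.p n)) (ω : Ω) :
    ∑ t ∈ Finset.Ioc a b, M.XZ n k t ω =
      (b - a) * M.μ₂ n k + blockSum (M.ε n) (Finset.Ioc a b) k ω := by
  have : ∀ t ∈ Finset.Ioc a b, M.XZ n k t ω = M.μ₂ n k + M.ε n k t ω := fun t ht => by
    rw [XZ, h₀, Nat.floor_natCast,
      if_neg (not_le.2 ((show (m₀ : ℤ) ≤ a from ha).trans_lt (Finset.mem_Ioc.1 ht).1))]
  rw [Finset.sum_congr rfl this, Finset.sum_add_distrib, Finset.sum_const, Int.card_Ioc,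
    nsmul_eq_mul, blockSum]
  congr 2
  have : ((b - a).toNat : ℤ) = b - a := Int.toNat_of_nonneg (by omega)
  exact_mod_cast congrArg (Int.cast (R := ℝ)) this

end PanelModel

/-- The `h` times after `m`. -/
def rightBlock (m : ℕ) (h : ℕ) : Finset ℤ := Finset.Ioc (m : ℤ) (m + h)

/-- The `h` times up to `m`. -/
def leftBlock (m : ℕ) (h : ℕ) : Finset ℤ := Finset.Ioc (m - h : ℤ) m

lemma monotone_rightBlock (m : ℕ) : Monotone (rightBlock m) := fun a b hab =>
  Finset.Ioc_subset_Ioc le_rfl (by omega)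

lemma monotone_leftBlock (m : ℕ) : Monotone (leftBlock m) := fun a b hab =>
  Finset.Ioc_subset_Ioc (by omega) le_rfl

lemma card_rightBlock (m h : ℕ) : (rightBlock m h).card = h := by simp [rightBlock]

lemma card_leftBlock (m h : ℕ) : (leftBlock m h).card = h := by simp [leftBlock]

namespace PanelModel

variable {Ω : Type*} [MeasurableSpace Ω] {P : Measure Ω} (M : PanelModel P)

/-- Expansion of the criterion to the right of the change point. -/
lemma L_sub_right {n m₀ h : ℕ} (h₀ : (n : ℝ) * M.τ n = m₀) (hn : 0 < n) {l : ℝ} {ω : Ω}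
    {d : Fin (M.p n) → ℝ} (hd : d = fun k => M.δ n k)
    (hsm : NoiseSmall (M.ε n) d (Finset.Ioc 0 (m₀ : ℤ))
      (Finset.Ioc (m₀ : ℤ) n) (rightBlock m₀) n l ω)
    (hm₀ : M.cstar * n ≤ m₀) (hh : 1 ≤ h) (hm : (m₀ + h : ℕ) ≤ (1 - M.cstar) * n) :
    |n * (M.L n (m₀ + h) ω - M.L n m₀ ω) - (m₀ : ℝ) / (m₀ + h) *
      (h * ∑ k, d k ^ 2 - 2 * ∑ k, d k * blockSum (M.ε n) (rightBlock m₀ h) k ω)| ≤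
      10 / M.cstar ^ 2 * (l / n) * h := by
  subst hd
  have hκ := M.cstar_pos
  have hκ1 := M.cstar_lt
  have hn' : (0 : ℝ) < n := by exact_mod_cast hn
  push_cast at hm
  have hmn : m₀ + h ≤ n := by
    have : ((m₀ + h : ℕ) : ℝ) ≤ n := by push_cast; nlinarith
    exact_mod_cast this
  have hδ : ∀ k, M.μ₁ n k - M.μ₂ n k = M.δ n k := fun k => by simp [δ]
  have key := abs_sum_between_sub_le (a := fun k => blockSum (M.ε n) (Finset.Ioc 0 (m₀ : ℤ)) k ω)
    (b := fun k => blockSum (M.ε n) (Finset.Ioc (m₀ : ℤ) n) k ω)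
    (w := fun k => blockSum (M.ε n) (rightBlock m₀ h) k ω) (x := fun k => M.μ₁ n k)
    (y := fun k => M.μ₂ n k) (α := m₀) (β := n - m₀) (h := h) hκ (by linarith) hn' hm₀
    (by positivity) (by linarith) (by simp_rw [hδ]; exact hsm.lin) hsm.sqA hsm.sqB (hsm.sqI h hh (by omega))
    (hsm.crossA h hh) (hsm.crossB h hh)
  simp_rw [hδ] at key
  convert key using 3
  rw [mul_sub, M.natCast_mul_L hn hmn, M.natCast_mul_L hn (show m₀ ≤ n by omega),
    ← Finset.sum_sub_distrib]
  refine Finset.sum_congr rfl fun k _ => ?_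
  have s1 := M.sum_XZ_before h₀ (a := 0) (b := m₀) (by omega) le_rfl k ω
  have s2 := M.sum_XZ_after h₀ (a := m₀) (b := m₀ + h) (by omega) le_rfl k ω
  have s3 := M.sum_XZ_after h₀ (a := m₀ + h) (b := n) (by omega) (by omega) k ω
  have s4 := M.sum_XZ_after h₀ (a := m₀) (b := n) (by omega) le_rfl k ω
  have s5 : ∑ t ∈ Finset.Ioc (0 : ℤ) (m₀ + h), M.XZ n k t ω = _ :=
    blockSum_Ioc_add (fun k t ω => M.XZ n k t ω) (b := m₀) (by omega) (by omega) k ω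
  have s6 := blockSum_Ioc_add (M.ε n) (a := m₀) (b := m₀ + h) (c := n) (by omega) (by omega) k ω
  simp only [blockSum] at s5
  rw [s1, s2] at s5
  push_cast at *
  rw [s5, s3, s1, s4, rightBlock, s6]
  ring_nf

/-- Expansion of the criterion to the left of the change point. -/
lemma L_sub_left {n m₀ h : ℕ} (h₀ : (n : ℝ) * M.τ n = m₀) (hn : 0 < n) {l : ℝ} {ω : Ω}
    {d : Fin (M.p n) → ℝ} (hd : d = fun k => -M.δ n k)
    (hsm : NoiseSmall (M.ε n) d (Finset.Ioc (m₀ : ℤ) n)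
      (Finset.Ioc 0 (m₀ : ℤ)) (leftBlock m₀) n l ω)
    (hm₀ : m₀ ≤ (1 - M.cstar) * n) (hh : 1 ≤ h) (hhm : h ≤ m₀)
    (hm : M.cstar * n ≤ (m₀ - h : ℕ)) :
    |n * (M.L n (m₀ - h) ω - M.L n m₀ ω) - ((n : ℝ) - m₀) / (n - m₀ + h) *
      (h * ∑ k, d k ^ 2 - 2 * ∑ k, d k * blockSum (M.ε n) (leftBlock m₀ h) k ω)| ≤
      10 / M.cstar ^ 2 * (l / n) * h := by
  subst hd
  have hκ := M.cstar_pos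
  have hκ1 := M.cstar_lt
  have hn' : (0 : ℝ) < n := by exact_mod_cast hn
  rw [Nat.cast_sub hhm] at hm
  have hmn : m₀ ≤ n := by
    have : (m₀ : ℝ) ≤ n := by nlinarith
    exact_mod_cast this
  have hδ : ∀ k, M.μ₂ n k - M.μ₁ n k = -M.δ n k := fun k => by simp [δ]
  -- The mirror image of the right-hand case: the group after the change now grows, so the two sides
  -- and the two means exchange roles and the jump changes sign.
  have key := abs_sum_between_sub_le (a := fun k => blockSum (M.ε n) (Finset.Ioc (m₀ : ℤ) n) k ω)
    (b := fun k => blockSum (M.ε n) (Finset.Ioc 0 (m₀ : ℤ)) k ω)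
    (w := fun k => blockSum (M.ε n) (leftBlock m₀ h) k ω) (x := fun k => M.μ₂ n k)
    (y := fun k => M.μ₁ n k) (α := n - m₀) (β := m₀) (h := h) (l := l) hκ (by linarith) hn'
    (by linarith)
    (by positivity) hm (by simp_rw [hδ]; exact hsm.lin) hsm.sqA hsm.sqB (hsm.sqI h hh (by omega))
    (hsm.crossA h hh) (hsm.crossB h hh)
  simp_rw [hδ] at key
  convert key using 3
  rw [mul_sub, M.natCast_mul_L hn (show m₀ - h ≤ n by omega), M.natCast_mul_L hn hmn,
    ← Finset.sum_sub_distrib]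
  refine Finset.sum_congr rfl fun k _ => ?_
  have s1 := M.sum_XZ_after h₀ (a := m₀) (b := n) (by omega) le_rfl k ω
  have s2 := M.sum_XZ_before h₀ (a := m₀ - h) (b := m₀) (by omega) le_rfl k ω
  have s3 := M.sum_XZ_before h₀ (a := 0) (b := m₀ - h) (by omega) (by omega) k ω
  have s4 := M.sum_XZ_before h₀ (a := 0) (b := m₀) (by omega) le_rfl k ω
  have s5 : ∑ t ∈ Finset.Ioc (m₀ - h : ℤ) n, M.XZ n k t ω = _ :=
    blockSum_Ioc_add (fun k t ω => M.XZ n k t ω) (b := m₀) (by omega) (by omega) k ω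
  have s6 := blockSum_Ioc_add (M.ε n) (a := 0) (b := m₀ - h) (c := m₀) (by omega) (by omega) k ω
  simp only [blockSum] at s5
  rw [s1, s2] at s5
  rw [Nat.cast_sub hhm, Nat.cast_sub hhm]
  push_cast at *
  rw [s5, s3, s1, s4, leftBlock, s6]
  ring_nf

end PanelModel

/-! ### Two-sided sums and the linear noise term -/

/-- The two-sided partial sums `∑_{0 < t ≤ h} x_t` for `h ≥ 0` and `-∑_{h < t ≤ 0} x_t`
for `h ≤ 0`. -/
def twoSidedSum (x : ℤ → ℝ) (h : ℤ) : ℝ := ∑ t ∈ Finset.Ioc 0 h, x t - ∑ t ∈ Finset.Ioc h 0, x t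

lemma twoSidedSum_natCast (x : ℤ → ℝ) (h : ℕ) :
    twoSidedSum x h = ∑ t ∈ Finset.Ioc (0 : ℤ) h, x t := by
  rw [twoSidedSum, Finset.Ioc_eq_empty (a := (h : ℤ)) (by omega)]
  simp

lemma twoSidedSum_neg_natCast (x : ℤ → ℝ) (h : ℕ) :
    twoSidedSum x (-h) = -∑ t ∈ Finset.Ioc (-h : ℤ) 0, x t := by
  rw [twoSidedSum, Finset.Ioc_eq_empty (b := (-h : ℤ)) (by omega)]
  simp

lemma sum_Ioc_add_left (f : ℤ → ℝ) (c a b : ℤ) :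
    ∑ t ∈ Finset.Ioc a b, f (c + t) = ∑ t ∈ Finset.Ioc (c + a) (c + b), f t := by
  rw [← Finset.image_add_left_Ioc, Finset.sum_image fun x _ y _ hxy => by simpa using hxy]

namespace PanelModel

variable {Ω : Type*} [MeasurableSpace Ω] {P : Measure Ω} [IsProbabilityMeasure P]
  (M : PanelModel P)

lemma ε_eq_linearFilter (hM : M.IsDiagonal) (n : ℕ) (k : Fin (M.p n)) (t : ℤ) (ω : Ω) :
    M.ε n k t ω = linearFilter (fun j => M.a n j k) (fun s => M.η k s ω) t := by
  refine tsum_congr fun j => ?_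
  rw [Matrix.mulVec, dotProduct, Finset.sum_eq_single k]
  · rfl
  · intro i _ hi
    rw [hM n j hi.symm, zero_mul]
  · simp

lemma integral_η_pow (k : ℕ) (t : ℤ) (q : ℕ) :
    ∫ ω, M.η k t ω ^ q ∂P = ∫ ω, M.η 0 0 ω ^ q ∂P :=
  ((M.η_ident k t).comp (u := fun x => x ^ q) (by fun_prop)).integral_eq

lemma isWhiteNoise (k : ℕ) : IsWhiteNoise (M.η k) P √(∫ ω, M.η 0 0 ω ^ 4 ∂P) where
  nonneg := Real.sqrt_nonneg _
  measurable := M.η_measurable k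
  indep := M.η_indep.precomp (g := fun t : ℤ => (k, t)) fun _ _ h => (Prod.mk.inj h).2
  memLp t := (M.η_ident k t).memLp_iff.2 M.η_fourth
  mean t := by simpa [M.η_mean] using M.integral_η_pow k t 1
  var t := (M.integral_η_pow k t 2).trans M.η_var
  fourth t := by
    rw [Real.sq_sqrt (integral_nonneg fun ω => by positivity), M.integral_η_pow]

/-- The constant must serve all rows at once. The fourth moments need 2 κ C² and the covariances
need C², hence (2 κ + 1) C². -/
lemma exists_noiseRow (hM : M.IsDiagonal) (hC : M.BoundedCoeff) :
    ∃ K, ∀ n, NoiseRow (M.ε n) P K := by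
  obtain ⟨C, hC⟩ := hC
  set κ := √(∫ ω, M.η 0 0 ω ^ 4 ∂P)
  have hκ : 0 ≤ κ := Real.sqrt_nonneg _
  have hε : ∀ n (k : Fin (M.p n)) t, M.ε n k t =
      fun ω => linearFilter (fun j => M.a n j k) (fun s => M.η k s ω) t :=
    fun n k t => funext fun ω => M.ε_eq_linearFilter hM n k t ω
  refine ⟨(2 * κ + 1) * |C| ^ 2, fun n => ?_⟩
  have hs := fun k => (hC n k).1
  have hA := fun k => (hC n k).2.trans (le_abs_self C)
  refine ⟨by positivity, ?_, ?_, ?_, ?_, ?_, ?_⟩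
  · intro k t
    rw [hε]
    exact (measurable_linearFilter _ t).comp (measurable_pi_lambda _ fun s => M.η_measurable k s)
  · have h1 : iIndepFun (fun (i : ℕ) ω (j : ℤ) => M.η i j ω) P :=
      iIndepFun.rows M.η_measurable M.η_indep
    have h2 := (h1.precomp (g := fun k : Fin (M.p n) => (k : ℕ)) Fin.val_injective).comp
      (fun k x t => linearFilter (fun j => M.a n j k) x t)
      fun k => measurable_pi_lambda _ fun t => measurable_linearFilter _ t
    convert h2 using 4 with k ω t
    exact M.ε_eq_linearFilter hM n k t ω
  · intro k t
    rw [hε]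
    exact (M.isWhiteNoise k).memLp_filter (hs k) t
  · intro k t
    rw [hε]
    exact (M.isWhiteNoise k).integral_filter (hs k) t
  · intro k I
    simp only [hε]
    refine ((M.isWhiteNoise k).fourth_filter (hs k) (hA k) I).trans ?_
    gcongr ?_ ^ 2
    have : 0 ≤ |C| ^ 2 * (I.card : ℝ) := by positivity
    change 2 * κ * |C| ^ 2 * (I.card : ℝ) ≤ _
    nlinarith
  · intro k I t
    simp only [hε]
    refine ((M.isWhiteNoise k).abs_integral_filter_mul_le (hs k) (hA k) I t).trans ?_
    nlinarith [sq_nonneg |C|]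

lemma norm_δ_sq (n : ℕ) : ‖M.δ n‖ ^ 2 = ∑ k, M.δ n k ^ 2 := by
  simp [EuclideanSpace.norm_sq_eq]

/-- All quadratic noise terms of row `n` are small, on both sides of the change point `m₀`. -/
def GoodRow (n m₀ : ℕ) (θ : ℝ) (ω : Ω) : Prop :=
  NoiseSmall (M.ε n) (fun k => M.δ n k) (Finset.Ioc 0 (m₀ : ℤ)) (Finset.Ioc (m₀ : ℤ) n)
    (rightBlock m₀) n (θ * n * ‖M.δ n‖ ^ 2) ω ∧
  NoiseSmall (M.ε n) (fun k => -M.δ n k) (Finset.Ioc (m₀ : ℤ) n) (Finset.Ioc 0 (m₀ : ℤ))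
    (leftBlock m₀) n (θ * n * ‖M.δ n‖ ^ 2) ω

/-- The linear noise term at distance `h` from the change point `m₀`. -/
def walk (n m₀ : ℕ) (h : ℤ) (ω : Ω) : ℝ :=
  twoSidedSum (fun t => ∑ k, M.δ n k * M.ε n k (m₀ + t) ω) h

lemma walk_natCast (n m₀ h : ℕ) (ω : Ω) :
    M.walk n m₀ h ω = ∑ k, M.δ n k * blockSum (M.ε n) (rightBlock m₀ h) k ω := by
  rw [walk, twoSidedSum_natCast, sum_Ioc_add_left fun t => ∑ k, M.δ n k * M.ε n k t ω,
    Finset.sum_comm]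
  simp [blockSum, rightBlock, Finset.mul_sum]

lemma walk_neg_natCast (n m₀ h : ℕ) (ω : Ω) :
    M.walk n m₀ (-h) ω = -∑ k, M.δ n k * blockSum (M.ε n) (leftBlock m₀ h) k ω := by
  rw [walk, twoSidedSum_neg_natCast, sum_Ioc_add_left fun t => ∑ k, M.δ n k * M.ε n k t ω,
    Finset.sum_comm]
  simp [blockSum, leftBlock, Finset.mul_sum, sub_eq_add_neg]

/-- The lower bound κ keeps the drift of order h at all distances; the bound 1 − h/(κ n) makes the
factor tend to one at bounded distances, as the limit law requires. -/
lemma ratio_bounds {α h κ n : ℝ} (hκ : 0 < κ) (hn : 0 < n) (hα : κ * n ≤ α) (hh : 0 ≤ h)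
    (hαh : α + h ≤ n) : κ ≤ α / (α + h) ∧ α / (α + h) ≤ 1 ∧ 1 - h / (κ * n) ≤ α / (α + h) := by
  have hα0 : 0 < α := (by positivity : 0 < κ * n).trans_le hα
  have h1 : 0 < α + h := by linarith
  refine ⟨?_, ?_, ?_⟩
  · rw [le_div_iff₀ h1]
    nlinarith
  · rw [div_le_one h1]
    linarith
  · have : α / (α + h) = 1 - h / (α + h) := by field_simp; ring
    rw [this]
    gcongr
    linarith

/-- Expansion of the criterion around the change point. -/
lemma L_expansion {n m₀ m : ℕ} {θ : ℝ} {ω : Ω} (h₀ : (n : ℝ) * M.τ n = m₀) (hn : 0 < n)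
    (hτ : M.τ n ∈ Set.Ioo M.cstar (1 - M.cstar)) (hg : M.GoodRow n m₀ θ ω)
    (hm : (m : ℝ) / n ∈ Set.Ioo M.cstar (1 - M.cstar)) {h : ℤ} (hmh : (m : ℤ) = m₀ + h) :
    ∃ r : ℝ, M.cstar ≤ r ∧ r ≤ 1 ∧ 1 - |(h : ℝ)| / (M.cstar * n) ≤ r ∧
      |n * (M.L n m ω - M.L n m₀ ω) - r * (|(h : ℝ)| * ‖M.δ n‖ ^ 2 - 2 * M.walk n m₀ h ω)| ≤
        10 / M.cstar ^ 2 * θ * ‖M.δ n‖ ^ 2 * |(h : ℝ)| := by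
  have hκ := M.cstar_pos
  have hκ1 := M.cstar_lt
  have hn' : (0 : ℝ) < n := by exact_mod_cast hn
  have hm1 : M.cstar * n < m := (lt_div_iff₀ hn').1 hm.1
  have hm2 : m < (1 - M.cstar) * n := (div_lt_iff₀ hn').1 hm.2
  have hm₀1 : M.cstar * n < m₀ := by
    rw [← h₀, mul_comm]
    exact mul_lt_mul_of_pos_left hτ.1 hn'
  have hm₀2 : m₀ < (1 - M.cstar) * n := by
    rw [← h₀, mul_comm]
    exact mul_lt_mul_of_pos_right hτ.2 hn'
  have el : ∀ D, θ * n * D / n = θ * D := fun D => by field_simp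
  obtain ⟨q, rfl | rfl⟩ := Int.eq_nat_or_neg h
  · rcases Nat.eq_zero_or_pos q with rfl | hq
    · obtain rfl : m = m₀ := by omega
      exact ⟨1, by linarith, le_rfl, by simp, by simp [walk, twoSidedSum]⟩
    obtain rfl : m = m₀ + q := by omega
    push_cast at hm1 hm2
    obtain ⟨r1, r2, r3⟩ := ratio_bounds (h := q) hκ hn' hm₀1.le (by positivity) (by nlinarith)
    have := M.L_sub_right h₀ hn rfl hg.1 hm₀1.le hq (by push_cast; exact hm2.le)
    rw [el, ← norm_δ_sq] at this
    refine ⟨(m₀ : ℝ) / (m₀ + q), r1, r2, by simpa using r3, ?_⟩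
    rw [walk_natCast]
    simpa only [Int.cast_natCast, Nat.abs_cast, mul_assoc] using this
  · rcases Nat.eq_zero_or_pos q with rfl | hq
    · obtain rfl : m = m₀ := by omega
      exact ⟨1, by linarith, le_rfl, by simp, by simp [walk, twoSidedSum]⟩
    have hqm : q ≤ m₀ := by omega
    obtain rfl : m = m₀ - q := by omega
    have hm1' := hm1
    rw [Nat.cast_sub hqm] at hm1' hm2
    obtain ⟨r1, r2, r3⟩ := ratio_bounds (α := n - m₀) (h := q) hκ hn' (by linarith) (by positivity)
      (by nlinarith)
    have := M.L_sub_left h₀ hn rfl hg.2 hm₀2.le hq hqm hm1.le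
    simp only [neg_sq, neg_mul, Finset.sum_neg_distrib] at this
    rw [el, ← norm_δ_sq] at this
    refine ⟨((n : ℝ) - m₀) / (n - m₀ + q), r1, r2, by simpa using r3, ?_⟩
    rw [walk_neg_natCast]
    simpa only [Int.cast_neg, Int.cast_natCast, abs_neg, Nat.abs_cast, mul_assoc] using this

/-! ### Probability bounds for the noise and exact recovery -/

/-- The linear noise term is dominated by the drift at distance at least `H`. -/
lemma measure_walk_gt {K : ℝ} {n m₀ H : ℕ} (hrow : NoiseRow (M.ε n) P K) (hH : 1 ≤ H) {θ : ℝ}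
    (hθ : 0 < θ) (hδ : 0 < ‖M.δ n‖ ^ 2) :
    P {ω | ∃ h : ℤ, (H : ℤ) ≤ |h| ∧ θ * |(h : ℝ)| * ‖M.δ n‖ ^ 2 < |M.walk n m₀ h ω|} ≤
      ENNReal.ofReal (2 * (3 * K ^ 2 / (θ ^ 4 * (‖M.δ n‖ ^ 2) ^ 2) * sqTail H)) := by
  rw [norm_δ_sq] at *
  have b₁ := hrow.measure_linear_uniform (fun k => M.δ n k) (card_rightBlock m₀) hH hθ hδ
  have b₂ := hrow.measure_linear_uniform (fun k => M.δ n k) (card_leftBlock m₀) hH hθ hδ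
  refine (measure_mono ?_).trans ((measure_union_le _ _).trans ((add_le_add b₁ b₂).trans_eq ?_))
  · rintro ω ⟨h, hh, hω⟩
    obtain ⟨q, rfl | rfl⟩ := Int.eq_nat_or_neg h
    · left
      rw [walk_natCast] at hω
      exact ⟨q, by simpa using hh, by simpa using hω⟩
    · right
      rw [walk_neg_natCast, abs_neg] at hω
      exact ⟨q, by simpa using hh, by simpa using hω⟩
  · have := sqTail_nonneg H
    rw [← ENNReal.ofReal_add (by positivity) (by positivity)]
    congr 1
    ring

/-- The quadratic noise terms are negligible with probability tending to one. -/
lemma tendsto_measure_not_goodRow {K : ℝ} (hrow : ∀ n, NoiseRow (M.ε n) P K)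
    (hsnr : SNRStar M.p M.δ) {D₀ : ℝ} (hD₀ : 0 < D₀) (hD : ∀ᶠ n in atTop, D₀ ≤ ‖M.δ n‖ ^ 2)
    {θ : ℝ} (hθ : 0 < θ) :
    Tendsto (fun n => P {ω | ¬ M.GoodRow n ⌊(n : ℝ) * M.τ n⌋₊ θ ω}) atTop (𝓝 0) := by
  have hK : 0 ≤ K := (hrow 0).nonneg
  set c := K ^ 2 / θ ^ 2 * (12 + 2 * crossConst) / D₀ with hc
  have hcc := crossConst_nonneg
  have hc0 : 0 ≤ c := by positivity
  have hinv : Tendsto (fun n : ℕ => ((n : ℝ) / M.p n * ‖M.δ n‖ ^ 2)⁻¹) atTop (𝓝 0) :=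
    tendsto_inv_atTop_zero.comp hsnr
  have hlim : Tendsto (fun n : ℕ => ENNReal.ofReal (2 * (K / (θ ^ 2 * D₀) * (1 / (n : ℝ)) +
      c * ((n : ℝ) / M.p n * ‖M.δ n‖ ^ 2)⁻¹))) atTop (𝓝 0) := by
    have := ((tendsto_one_div_atTop_nhds_zero_nat (𝕜 := ℝ)).const_mul
      (K / (θ ^ 2 * D₀))).add (hinv.const_mul c) |>.const_mul 2
    simpa using ENNReal.tendsto_ofReal this
  refine tendsto_of_tendsto_of_tendsto_of_le_of_le' tendsto_const_nhds hlim
    (Eventually.of_forall fun _ => zero_le) ?_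
  filter_upwards [hD, hsnr.eventually_ge_atTop (8 * K / θ), M.p_tendsto.eventually_ge_atTop 1,
    eventually_ge_atTop 1, M.τ_mem] with n hDn hsn hp hn hτ
  have hp' : (1 : ℝ) ≤ M.p n := by exact_mod_cast hp
  have hn' : (1 : ℝ) ≤ n := by exact_mod_cast hn
  have hκ := M.cstar_pos
  have hDpos : 0 < ‖M.δ n‖ ^ 2 := hD₀.trans_le hDn
  set D := ‖M.δ n‖ ^ 2 with hDdef
  set m₀ := ⌊(n : ℝ) * M.τ n⌋₊
  have hm₀n : m₀ ≤ n := by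
    have : (n : ℝ) * M.τ n ≤ n := by nlinarith [hτ.2]
    exact_mod_cast (Nat.floor_le (mul_nonneg (by positivity) (hκ.trans hτ.1).le)).trans this
  -- This is where (SNR*) enters: the mean of a quadratic noise term, of order p per unit of
  -- distance, stays below the threshold θ n D.
  have hmean : 8 * K * Fintype.card (Fin (M.p n)) ≤ θ * n * D := by
    rw [Fintype.card_fin]
    rw [div_le_iff₀ hθ, div_mul_eq_mul_div, div_mul_eq_mul_div, le_div_iff₀ (by positivity)] at hsn
    linarith
  have hl : 0 < θ * n * D := by positivity
  have hcA : (Finset.Ioc 0 (m₀ : ℤ)).card ≤ n := by simpa using hm₀n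
  have hcB : (Finset.Ioc (m₀ : ℤ) n).card ≤ n := by simp
  have b₁ := (hrow n).measure_not_noiseSmall (fun k => M.δ n k) (monotone_rightBlock m₀)
    (card_rightBlock m₀) hn hcA hcB hl hmean
  have b₂ := (hrow n).measure_not_noiseSmall (fun k => -M.δ n k) (monotone_leftBlock m₀)
    (card_leftBlock m₀) hn hcB hcA hl hmean
  have hbound : K * n * ∑ k, M.δ n k ^ 2 / (θ * n * D) ^ 2 + K ^ 2 * Fintype.card (Fin (M.p n)) *
      n / (θ * n * D) ^ 2 * (12 + 2 * crossConst) ≤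
      K / (θ ^ 2 * D₀) * (1 / (n : ℝ)) + c * ((n : ℝ) / M.p n * D)⁻¹ := by
    rw [← Finset.sum_div, ← norm_δ_sq, ← hDdef, Fintype.card_fin]
    refine add_le_add ?_ ?_
    · calc K * n * (D / (θ * n * D) ^ 2) = K / (θ ^ 2 * D) * (1 / (n : ℝ)) := by field_simp
        _ ≤ _ := by gcongr
    · calc K ^ 2 * M.p n * n / (θ * n * D) ^ 2 * (12 + 2 * crossConst)
          = K ^ 2 / θ ^ 2 * (12 + 2 * crossConst) / D * ((n : ℝ) / M.p n * D)⁻¹ := by field_simp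
        _ ≤ _ := by rw [hc]; gcongr
  have hsub : {ω | ¬ M.GoodRow n m₀ θ ω} ⊆
      {ω | ¬ NoiseSmall (M.ε n) (fun k => M.δ n k) (Finset.Ioc 0 (m₀ : ℤ))
        (Finset.Ioc (m₀ : ℤ) n) (rightBlock m₀) n (θ * n * D) ω} ∪
      {ω | ¬ NoiseSmall (M.ε n) (fun k => -M.δ n k) (Finset.Ioc (m₀ : ℤ) n)
        (Finset.Ioc 0 (m₀ : ℤ)) (leftBlock m₀) n (θ * n * D) ω} := fun ω hω => by
    by_contra hcon
    simp only [Set.mem_union, Set.mem_ofPred_eq, not_or, not_not] at hcon hω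
    exact hω hcon
  simp only [neg_sq] at b₂
  refine (measure_mono hsub).trans ((measure_union_le _ _).trans ?_)
  rw [two_mul, ENNReal.ofReal_add (by positivity) (by positivity)]
  exact add_le_add (b₁.trans (ENNReal.ofReal_le_ofReal hbound))
    (b₂.trans (ENNReal.ofReal_le_ofReal hbound))

/-- On a good row with a dominated linear noise term, points at distance at least `H` from the
change point do not minimise the criterion. -/
lemma not_isMinimiser_of_far {n m₀ m H : ℕ} {ω : Ω} (h₀ : (n : ℝ) * M.τ n = m₀) (hn : 0 < n)
    (hτ : M.τ n ∈ Set.Ioo M.cstar (1 - M.cstar)) (hD : 0 < ‖M.δ n‖ ^ 2) {θ : ℝ}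
    (hθ : 10 / M.cstar ^ 2 * θ < M.cstar / 2) (hg : M.GoodRow n m₀ θ ω) (hH : 1 ≤ H)
    (hw : ∀ h : ℤ, (H : ℤ) ≤ |h| → |M.walk n m₀ h ω| ≤ 1 / 4 * |(h : ℝ)| * ‖M.δ n‖ ^ 2)
    (hm : (m : ℝ) / n ∈ Set.Ioo M.cstar (1 - M.cstar)) {h : ℤ} (hmh : (m : ℤ) = m₀ + h)
    (hh : (H : ℤ) ≤ |h|) : M.L n m₀ ω < M.L n m ω := by
  obtain ⟨r, r1, -, -, hr⟩ := M.L_expansion h₀ hn hτ hg hm hmh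
  have hn' : (0 : ℝ) < n := by exact_mod_cast hn
  have hh1 : (1 : ℝ) ≤ |(h : ℝ)| := by
    have : (1 : ℤ) ≤ |h| := by omega
    exact_mod_cast this
  have hκ := M.cstar_pos
  have hw' := hw h hh
  set D := ‖M.δ n‖ ^ 2
  set x := |(h : ℝ)|
  have hxD : 0 < x * D := by positivity
  -- The level 1/4 for the walk leaves half of the drift, of which the factor r retains at least
  -- c*/2; `hθ` makes the remainder smaller than that.
  have h1 : x * D / 2 ≤ x * D - 2 * M.walk n m₀ h ω := by
    have := (abs_le.1 hw').2
    nlinarith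
  have h2 : M.cstar * (x * D / 2) ≤ r * (x * D - 2 * M.walk n m₀ h ω) :=
    mul_le_mul r1 h1 (by positivity) (hκ.le.trans r1)
  have h3 : 10 / M.cstar ^ 2 * θ * D * x < M.cstar / 2 * (x * D) := by nlinarith
  have h4 := (abs_le.1 hr).1
  have h5 : 0 < n * (M.L n m ω - M.L n m₀ ω) := by linarith
  have := (mul_pos_iff_of_pos_left hn').1 h5
  linarith

lemma exists_small_θ : ∃ θ : ℝ, 0 < θ ∧ 10 / M.cstar ^ 2 * θ < M.cstar / 2 := by
  have hκ := M.cstar_pos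
  refine ⟨M.cstar ^ 3 / 40, by positivity, ?_⟩
  have : 10 / M.cstar ^ 2 * (M.cstar ^ 3 / 40) = M.cstar / 4 := by field_simp; norm_num
  rw [this]
  linarith

/-- Exact recovery of the change point. -/
theorem tendsto_measure_eq_τ {τhat : ℕ → Ω → ℝ} (hM : M.IsDiagonal) (hC : M.BoundedCoeff)
    (hsnr : SNRStar M.p M.δ) (hδ : Tendsto (fun n => ‖M.δ n‖) atTop atTop) (hτ : M.IsLSE τhat) :
    Tendsto (fun n => P {ω | τhat n ω = M.τ n}) atTop (𝓝 1) := by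
  obtain ⟨K, hrow⟩ := M.exists_noiseRow hM hC
  obtain ⟨θ, hθ0, hθ⟩ := M.exists_small_θ
  have hδ2 : Tendsto (fun n => ‖M.δ n‖ ^ 2) atTop atTop :=
    (tendsto_pow_atTop two_ne_zero).comp hδ
  have hgood := M.tendsto_measure_not_goodRow hrow hsnr one_pos (hδ2.eventually_ge_atTop 1) hθ0
  -- For H = 1 the bound is a constant times D⁻², which vanishes because the jump diverges; so every
  -- h ≠ 0 is excluded.
  have hlin : Tendsto (fun n => ENNReal.ofReal (2 * (3 * K ^ 2 / ((1 / 4) ^ 4 *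
      (‖M.δ n‖ ^ 2) ^ 2) * sqTail 1))) atTop (𝓝 0) := by
    have h4 : Tendsto (fun n => (1 / 4 : ℝ) ^ 4 * (‖M.δ n‖ ^ 2) ^ 2) atTop atTop :=
      ((tendsto_pow_atTop two_ne_zero).comp hδ2).const_mul_atTop (by norm_num)
    have := ((h4.const_div_atTop (3 * K ^ 2)).mul_const (sqTail 1)).const_mul 2
    simpa using ENNReal.tendsto_ofReal this
  have hcompl : Tendsto (fun n => P {ω | τhat n ω = M.τ n}ᶜ) atTop (𝓝 0) := by
    have hsum := hgood.add hlin
    rw [add_zero] at hsum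
    refine tendsto_of_tendsto_of_tendsto_of_le_of_le' tendsto_const_nhds hsum
      (Eventually.of_forall fun _ => zero_le) ?_
    filter_upwards [hδ2.eventually_ge_atTop 1, eventually_ge_atTop 1, M.τ_mem, M.τ_grid, hτ.2]
      with n hD hn hτn ⟨m₀, h₀⟩ hmin
    have hn' : (0 : ℝ) < n := by exact_mod_cast hn
    have hDpos : 0 < ‖M.δ n‖ ^ 2 := by linarith
    have hfl : ⌊(n : ℝ) * M.τ n⌋₊ = m₀ := by rw [h₀, Nat.floor_natCast]
    rw [hfl]
    refine le_trans (measure_mono_ae ?_) ((measure_union_le _ _).trans (add_le_add le_rfl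
      (M.measure_walk_gt (m₀ := m₀) (hrow n) le_rfl (by norm_num : (0 : ℝ) < 1 / 4) hDpos)))
    filter_upwards [hmin] with ω hω hne
    by_contra hcon
    replace hcon : ω ∉ {ω | ¬ M.GoodRow n m₀ θ ω} ∪ {ω | ∃ h : ℤ, ((1 : ℕ) : ℤ) ≤ |h| ∧
      1 / 4 * |(h : ℝ)| * ‖M.δ n‖ ^ 2 < |M.walk n m₀ h ω|} := hcon
    simp only [Set.mem_union, Set.mem_ofPred_eq, not_or, not_not, not_exists, not_and,
      not_lt] at hcon
    obtain ⟨m, hm, hmem, hle⟩ := hω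
    have hτeq : M.τ n = m₀ / n := by rw [← h₀]; field_simp
    have hmne : m ≠ m₀ := fun h => hne (show τhat n ω = M.τ n by rw [hm, h, hτeq])
    rw [hm] at hmem
    have hlt := M.not_isMinimiser_of_far h₀ hn hτn hDpos hθ hcon.1 le_rfl hcon.2 hmem
      (h := m - m₀) (by ring) (by
        have : (m : ℤ) - m₀ ≠ 0 := by omega
        exact_mod_cast Int.one_le_abs this)
    exact absurd (hle m₀ (hτeq ▸ hτn)) (not_le.2 hlt)
  have hmeas : ∀ n, MeasurableSet {ω | τhat n ω = M.τ n} := fun n =>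
    hτ.1 n (measurableSet_singleton (M.τ n))
  have h1 : ∀ n, P {ω | τhat n ω = M.τ n} = 1 - P {ω | τhat n ω = M.τ n}ᶜ := fun n => by
    rw [← prob_compl_eq_one_sub (hmeas n).compl, compl_compl]
  simp_rw [h1]
  simpa using ENNReal.Tendsto.sub tendsto_const_nhds hcompl (Or.inl ENNReal.one_ne_top)

end PanelModel

/-! ### Comparison of the assumptions -/

/-- The weight j is at least one except at j = 0, where (1) says nothing; that single coefficient is
covered by the bound on the leading one. -/
lemma PanelModel.BoundedLead.boundedCoeff {Ω : Type*} [MeasurableSpace Ω] {P : Measure Ω}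
    {M : PanelModel P} (h₀ : M.BoundedLead) (h₁ : M.Bai1) : M.BoundedCoeff := by
  obtain ⟨C₀, h₀⟩ := h₀
  obtain ⟨C₁, h₁⟩ := h₁
  refine ⟨C₀ + C₁, fun n k => ?_⟩
  obtain ⟨hs, hle⟩ := h₁ n k
  have hs' : Summable fun j : ℕ => ((j + 1 : ℕ) : ℝ) * |M.a n (j + 1) k| :=
    (summable_nat_add_iff 1).2 hs
  have hb : ∀ j : ℕ, |M.a n (j + 1) k| ≤ ((j + 1 : ℕ) : ℝ) * |M.a n (j + 1) k| := fun j => by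
    have : (1 : ℝ) ≤ ((j + 1 : ℕ) : ℝ) := by
      push_cast
      linarith [(Nat.cast_nonneg j : (0 : ℝ) ≤ j)]
    nlinarith [abs_nonneg (M.a n (j + 1) k)]
  have hs1 : Summable fun j : ℕ => |M.a n (j + 1) k| :=
    Summable.of_nonneg_of_le (fun j => abs_nonneg _) hb hs'
  have hsum : Summable fun j : ℕ => |M.a n j k| :=
    (summable_nat_add_iff (f := fun j : ℕ => |M.a n j k|) 1).1 hs1
  refine ⟨hsum, ?_⟩
  rw [hsum.tsum_eq_zero_add]
  refine add_le_add (h₀ n k) ((hs1.tsum_le_tsum hb hs').trans ?_)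
  rw [hs.tsum_eq_zero_add] at hle
  simpa using hle

lemma LogLogGrowth.sublinearGrowth {p : ℕ → ℕ} (h : LogLogGrowth p) : SublinearGrowth p := by
  refine squeeze_zero' (Eventually.of_forall fun n => by positivity) ?_ h
  have hll : Tendsto (fun n : ℕ => Real.log (Real.log n)) atTop atTop :=
    Real.tendsto_log_atTop.comp (Real.tendsto_log_atTop.comp tendsto_natCast_atTop_atTop)
  filter_upwards [hll.eventually_ge_atTop 1] with n hn
  gcongr
  exact le_mul_of_one_le_right (by positivity) hn

/-- The ratio n/p diverges and D is bounded below. A nonzero jump rules out p = 0, so the quotient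
really is positive. -/
lemma snrStar_of_sublinearGrowth {p : ℕ → ℕ} {δ : ∀ n, EuclideanSpace ℝ (Fin (p n))}
    (hp : SublinearGrowth p) {D₀ : ℝ} (hD₀ : 0 < D₀) (hδ : ∀ᶠ n in atTop, D₀ ≤ ‖δ n‖ ^ 2) :
    SNRStar p δ := by
  have hpos : ∀ᶠ n : ℕ in atTop, 0 < (p n : ℝ) / n := by
    filter_upwards [hδ, eventually_ge_atTop 1] with n hn hn1
    have : p n ≠ 0 := fun h0 => by
      have : IsEmpty (Fin (p n)) := by rw [h0]; infer_instance
      rw [EuclideanSpace.norm_sq_eq, Finset.univ_eq_empty, Finset.sum_empty] at hn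
      linarith
    have h1 : (0 : ℝ) < p n := by exact_mod_cast Nat.pos_of_ne_zero this
    have h2 : (0 : ℝ) < n := by exact_mod_cast hn1
    positivity
  have hinv : Tendsto (fun n : ℕ => ((p n : ℝ) / n)⁻¹) atTop atTop :=
    tendsto_inv_nhdsGT_zero.comp (tendsto_nhdsWithin_iff.2 ⟨hp, hpos⟩)
  refine tendsto_atTop_mono' _ ?_ (hinv.atTop_mul_const hD₀)
  filter_upwards [hδ] with n hn
  rw [inv_div]
  gcongr

lemma Bai3.snrStar {p : ℕ → ℕ} {δ : ∀ n, EuclideanSpace ℝ (Fin (p n))} (h : Bai3 p δ) :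
    SNRStar p δ :=
  snrStar_of_sublinearGrowth h.2.sublinearGrowth one_pos
    (((tendsto_pow_atTop two_ne_zero).comp h.1).eventually_ge_atTop 1)

/-- A vector in `ℝ^(q+1)` with squared norm `s`. -/
def vectorOfSq (q : ℕ) (s : ℝ) : EuclideanSpace ℝ (Fin (q + 1)) := EuclideanSpace.single 0 √s

lemma norm_vectorOfSq (q : ℕ) {s : ℝ} (hs : 0 ≤ s) : ‖vectorOfSq q s‖ ^ 2 = s := by
  rw [vectorOfSq, PiLp.norm_single, Real.norm_eq_abs, sq_abs, Real.sq_sqrt hs]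

lemma sum_vectorOfSq (q : ℕ) {s : ℝ} (hs : 0 ≤ s) : ∑ k, vectorOfSq q s k ^ 2 = s := by
  simpa [EuclideanSpace.norm_sq_eq] using norm_vectorOfSq q hs

lemma tendsto_succ_atTop : Tendsto (fun n : ℕ => n + 1) atTop atTop := tendsto_add_atTop_nat 1

/-- With p = n + 1 and D = n + 1 the signal-to-noise ratio is n, while p/n does not tend to 0. -/
lemma exists_snrStar_not_bai3 : ∃ (p : ℕ → ℕ) (δ : ∀ n, EuclideanSpace ℝ (Fin (p n))),
    Tendsto p atTop atTop ∧ SNRStar p δ ∧ ¬ Bai3 p δ := by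
  refine ⟨fun n => n + 1, fun n => vectorOfSq n (n + 1), tendsto_succ_atTop, ?_, fun h => ?_⟩
  · refine tendsto_natCast_atTop_atTop.congr fun n => ?_
    rw [norm_vectorOfSq _ (by positivity)]
    push_cast
    field_simp
  · have h2 : Tendsto (fun n : ℕ => ((n + 1 : ℕ) : ℝ) / n) atTop (𝓝 0) := h.2.sublinearGrowth
    have : ∀ᶠ n : ℕ in atTop, ((n + 1 : ℕ) : ℝ) / n < 1 := h2.eventually (gt_mem_nhds one_pos)
    obtain ⟨n, hn, hn1⟩ := (this.and (eventually_ge_atTop 1)).exists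
    have h3 : (0 : ℝ) < n := by exact_mod_cast hn1
    rw [div_lt_one h3] at hn
    push_cast at hn
    linarith

/-- With p = n + 1 and D = √p the ratio in (2) is identically 1, whereas (n/p) D is of order √n. -/
lemma exists_snrStar_not_bai2 : ∃ (p : ℕ → ℕ) (δ : ∀ n, EuclideanSpace ℝ (Fin (p n))),
    Tendsto p atTop atTop ∧ SNRStar p δ ∧ ¬ Bai2 p δ := by
  refine ⟨fun n => n + 1, fun n => vectorOfSq n √(n + 1), tendsto_succ_atTop, ?_, fun h => ?_⟩
  · have h1 : Tendsto (fun n : ℕ => √(n : ℝ) / 2) atTop atTop :=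
      (Real.tendsto_sqrt_atTop.comp tendsto_natCast_atTop_atTop).atTop_div_const two_pos
    refine tendsto_atTop_mono' _ ?_ h1
    filter_upwards [eventually_ge_atTop 1] with n hn
    have hn' : (1 : ℝ) ≤ n := by exact_mod_cast hn
    rw [norm_vectorOfSq _ (Real.sqrt_nonneg _)]
    push_cast
    have h2 : (1 : ℝ) / 2 ≤ n / (n + 1) := by
      rw [div_le_div_iff₀ two_pos (by positivity)]
      linarith
    have h3 : √(n : ℝ) ≤ √(n + 1) := Real.sqrt_le_sqrt (by linarith)
    nlinarith [Real.sqrt_nonneg (n : ℝ)]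
  · obtain ⟨n, hn⟩ := (h.eventually_ge_atTop 2).exists
    rw [sum_vectorOfSq _ (Real.sqrt_nonneg _)] at hn
    push_cast at hn
    rw [div_self (by positivity)] at hn
    norm_num at hn

/-- With p = n⁴ + 1 and D = n³ the ratio in (2) is of order n, while (n/p) D stays below 1. -/
lemma exists_bai2_not_snrStar : ∃ (p : ℕ → ℕ) (δ : ∀ n, EuclideanSpace ℝ (Fin (p n))),
    Tendsto p atTop atTop ∧ Bai2 p δ ∧ ¬ SNRStar p δ := by
  refine ⟨fun n => n ^ 4 + 1, fun n => vectorOfSq (n ^ 4) (n ^ 3),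
    tendsto_succ_atTop.comp (tendsto_pow_atTop four_ne_zero), ?_, fun h => ?_⟩
  · have h1 : Tendsto (fun n : ℕ => (n : ℝ) / 2) atTop atTop :=
      tendsto_natCast_atTop_atTop.atTop_div_const two_pos
    refine tendsto_atTop_mono' _ ?_ h1
    filter_upwards [eventually_ge_atTop 1] with n hn
    have hn' : (1 : ℝ) ≤ n := by exact_mod_cast hn
    rw [sum_vectorOfSq _ (by positivity)]
    push_cast
    have h2 : √((n : ℝ) ^ 4 + 1) ≤ 2 * n ^ 2 := by
      rw [Real.sqrt_le_left (by positivity)]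
      nlinarith [one_le_pow₀ (n := 4) hn']
    rw [div_le_div_iff₀ two_pos (by positivity)]
    nlinarith
  · obtain ⟨n, hn⟩ := (h.eventually_ge_atTop 1).exists
    rw [norm_vectorOfSq _ (by positivity)] at hn
    push_cast at hn
    rw [div_mul_eq_mul_div, le_div_iff₀ (by positivity)] at hn
    nlinarith

/-! ### Two-sided Brownian motion at integer times -/

lemma twoSidedSum_zero (x : ℤ → ℝ) : twoSidedSum x 0 = 0 := by simp [twoSidedSum]

lemma twoSidedSum_sub (x : ℤ → ℝ) {s t : ℤ} (hst : s ≤ t) :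
    twoSidedSum x t - twoSidedSum x s = ∑ u ∈ Finset.Ioc s t, x u := by
  have key : ∀ a b c : ℤ, a ≤ b → b ≤ c → ∑ u ∈ Finset.Ioc a c, x u =
      ∑ u ∈ Finset.Ioc a b, x u + ∑ u ∈ Finset.Ioc b c, x u := fun a b c hab hbc =>
    blockSum_Ioc_add (Ω := Unit) (ι := Unit) (fun _ t _ => x t) hab hbc () ()
  simp only [twoSidedSum]
  rcases le_total 0 s with h0 | h0
  · rw [Finset.Ioc_eq_empty (a := s) (b := 0) (by omega),
      Finset.Ioc_eq_empty (a := t) (b := 0) (by omega), key 0 s t h0 hst]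
    simp
  · rcases le_total 0 t with h1 | h1
    · rw [Finset.Ioc_eq_empty (b := s) (a := 0) (by omega),
        Finset.Ioc_eq_empty (a := t) (b := 0) (by omega), key s 0 t h0 h1]
      simp [add_comm]
    · rw [Finset.Ioc_eq_empty (b := s) (a := 0) (by omega),
        Finset.Ioc_eq_empty (a := 0) (b := t) (by omega), key s t 0 hst h1]
      simp

lemma twoSidedSum_sub_sub (f : ℤ → ℝ) (h : ℤ) :
    twoSidedSum (fun t => f t - f (t - 1)) h = f h - f 0 := by
  induction h using Int.induction_on with
  | zero => simp [twoSidedSum_zero]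
  | succ i ih =>
    have := twoSidedSum_sub (fun t => f t - f (t - 1)) (s := i) (t := i + 1) (by omega)
    have e : Finset.Ioc (i : ℤ) (i + 1) = {(i : ℤ) + 1} := by
      ext t
      simp only [Finset.mem_Ioc, Finset.mem_singleton]
      omega
    rw [e, Finset.sum_singleton, add_sub_cancel_right] at this
    linarith
  | pred i ih =>
    have := twoSidedSum_sub (fun t => f t - f (t - 1)) (s := -i - 1) (t := -i) (by omega)
    have e : Finset.Ioc (-(i : ℤ) - 1) (-i) = {-(i : ℤ)} := by
      ext t
      simp only [Finset.mem_Ioc, Finset.mem_singleton]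
      omega
    rw [e, Finset.sum_singleton] at this
    linarith

/-- Reversing time exchanges the step into time t with the step into time 1 − t and flips its sign.
With symmetric steps this gives the symmetry of the limit law. -/
lemma twoSidedSum_reflect (x : ℤ → ℝ) (h : ℤ) :
    twoSidedSum (fun t => -x (1 - t)) h = twoSidedSum x (-h) := by
  have key : ∀ a b : ℤ, ∑ t ∈ Finset.Ioc a b, x (1 - t) = ∑ t ∈ Finset.Ioc (-b) (-a), x t := by
    intro a b
    refine Finset.sum_bij' (fun t _ => 1 - t) (fun t _ => 1 - t) ?_ ?_ ?_ ?_ ?_ <;>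
      simp only [Finset.mem_Ioc, implies_true] <;> intros <;> omega
  simp only [twoSidedSum, Finset.sum_neg_distrib, key, neg_zero]
  ring

lemma measurable_twoSidedSum (h : ℤ) : Measurable fun x : ℤ → ℝ => twoSidedSum x h :=
  (Finset.measurable_fun_sum _ fun t _ => measurable_pi_apply t).sub
    (Finset.measurable_fun_sum _ fun t _ => measurable_pi_apply t)

/-- Sums over disjoint blocks of independent variables are independent. -/
lemma iIndepFun.sum_disjoint {Ω ι τ : Type*} [MeasurableSpace Ω] {P : Measure Ω}
    {x : τ → Ω → ℝ} (hm : ∀ t, Measurable (x t)) (hx : iIndepFun x P) {S : ι → Finset τ}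
    (hS : Pairwise fun i j => Disjoint (S i) (S j)) :
    iIndepFun (fun i ω => ∑ t ∈ S i, x t ω) P := by
  have h1 : iIndepFun (fun q : (i : ι) × S i => x q.2) P := by
    refine hx.precomp (g := fun q : (i : ι) × S i => (q.2 : τ)) ?_
    rintro ⟨i, a, ha⟩ ⟨j, b, hb⟩ hab
    obtain rfl : a = b := hab
    obtain rfl : i = j := by
      by_contra hij
      exact Finset.disjoint_left.1 (hS hij) ha hb
    rfl
  have h2 := (iIndepFun.rows_sigma (η := fun i (j : S i) => x j) (fun i j => hm j) h1).comp
    (fun i y => ∑ j, y j) fun i => Finset.measurable_fun_sum _ fun t _ => measurable_pi_apply t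
  convert h2 using 3 with i ω
  exact (Finset.sum_coe_sort (S i) fun t => x t ω).symm

lemma hasLaw_sum_gaussian {Ω τ : Type*} [MeasurableSpace Ω] {P : Measure Ω} [IsProbabilityMeasure P]
    {x : τ → Ω → ℝ} (hm : ∀ t, Measurable (x t)) (hx : iIndepFun x P)
    (hlaw : ∀ t, P.map (x t) = gaussianReal 0 1) (s : Finset τ) :
    P.map (fun ω => ∑ t ∈ s, x t ω) = gaussianReal 0 s.card := by
  classical
  induction s using Finset.induction_on with
  | empty => simp [gaussianReal_zero_var, Measure.map_const]
  | insert j s hj ih =>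
    have hind : IndepFun (x j) (fun ω => ∑ t ∈ s, x t ω) P := by
      have := (hx.indepFun_finsetSum_of_notMem hm hj).symm
      convert this using 2
      simp
    have := gaussianReal_add_gaussianReal_of_indepFun hind (hlaw j) ih
    simp_rw [Finset.sum_insert hj, Finset.card_insert_of_notMem hj]
    rw [show (fun ω => x j ω + ∑ t ∈ s, x t ω) = x j + fun ω => ∑ t ∈ s, x t ω from rfl, this]
    congr 1
    · simp
    · push_cast
      ring

lemma hasIndepIncrements_twoSidedSum {Ω : Type*} [MeasurableSpace Ω] {P : Measure Ω}
    {x : ℤ → Ω → ℝ} (hm : ∀ t, Measurable (x t)) (hx : iIndepFun x P) :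
    HasIndepIncrements (fun h ω => twoSidedSum (fun t => x t ω) h) P := by
  intro n t ht
  have hdisj : ∀ i j : Fin n, i < j →
      Disjoint (Finset.Ioc (t i.castSucc) (t i.succ)) (Finset.Ioc (t j.castSucc) (t j.succ)) := by
    intro i j hij
    have h2 : t i.succ ≤ t j.castSucc := ht (Fin.succ_le_castSucc_iff.2 hij)
    refine Finset.disjoint_left.2 fun u h3 h4 => ?_
    rw [Finset.mem_Ioc] at h3 h4
    omega
  have key : iIndepFun (fun (i : Fin n) ω => ∑ u ∈ Finset.Ioc (t i.castSucc) (t i.succ), x u ω)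
      P := by
    refine iIndepFun.sum_disjoint hm hx ?_
    intro i j hij
    rcases lt_or_gt_of_ne hij with h | h
    · exact hdisj i j h
    · exact (hdisj j i h).symm
  have e : (fun (i : Fin n) ω => twoSidedSum (fun t => x t ω) (t i.succ) -
      twoSidedSum (fun t => x t ω) (t i.castSucc)) =
      fun (i : Fin n) ω => ∑ u ∈ Finset.Ioc (t i.castSucc) (t i.succ), x u ω := by
    funext i ω
    exact twoSidedSum_sub (fun t => x t ω) (ht (Fin.castSucc_lt_succ).le)
  exact e ▸ key

lemma hasLaw_twoSidedSum_sub {Ω : Type*} [MeasurableSpace Ω] {P : Measure Ω}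
    [IsProbabilityMeasure P] {x : ℤ → Ω → ℝ} (hm : ∀ t, Measurable (x t)) (hx : iIndepFun x P)
    (hlaw : ∀ t, P.map (x t) = gaussianReal 0 1) {s t : ℤ} (hst : s ≤ t) :
    HasLaw (fun ω => twoSidedSum (fun u => x u ω) t - twoSidedSum (fun u => x u ω) s)
      (gaussianReal 0 (Real.toNNReal ((t : ℝ) - s))) P := by
  have e : (fun ω => twoSidedSum (fun u => x u ω) t - twoSidedSum (fun u => x u ω) s) =
      fun ω => ∑ u ∈ Finset.Ioc s t, x u ω :=
    funext fun ω => twoSidedSum_sub (fun u => x u ω) hst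
  rw [e]
  refine ⟨(Finset.measurable_fun_sum _ fun t _ => hm t).aemeasurable, ?_⟩
  rw [hasLaw_sum_gaussian hm hx hlaw, Int.card_Ioc]
  congr 1
  have h1 : ((t - s).toNat : ℤ) = t - s := Int.toNat_of_nonneg (by omega)
  have h2 : ((t - s).toNat : ℝ) = (t : ℝ) - s := by
    exact_mod_cast congrArg (Int.cast (R := ℝ)) h1
  rw [← h2, Real.toNNReal_natCast]

/-- The two-sided random walk with standard normal steps is a Brownian motion at integer times. -/
lemma isBrownianAtIntegers_twoSidedSum {Ω : Type*} [MeasurableSpace Ω] {P : Measure Ω}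
    [IsProbabilityMeasure P] {x : ℤ → Ω → ℝ} (hm : ∀ t, Measurable (x t)) (hx : iIndepFun x P)
    (hlaw : ∀ t, P.map (x t) = gaussianReal 0 1) :
    IsBrownianAtIntegers (fun h ω => twoSidedSum (fun t => x t ω) h) P :=
  ⟨ae_of_all _ fun _ => twoSidedSum_zero _, hasIndepIncrements_twoSidedSum hm hx,
    fun _ _ hst => hasLaw_twoSidedSum_sub hm hx hlaw hst⟩

namespace IsBrownianAtIntegers

variable {Ω : Type*} [MeasurableSpace Ω] {P : Measure Ω} [IsProbabilityMeasure P]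
  {B : ℤ → Ω → ℝ}

lemma increment_law (hB : IsBrownianAtIntegers B P) (t : ℤ) :
    HasLaw (fun ω => B t ω - B (t - 1) ω) (gaussianReal 0 1) P := by
  have := hB.law (t - 1) t (by omega)
  simpa using this

lemma increment_indep (hB : IsBrownianAtIntegers B P) :
    iIndepFun (fun (t : ℤ) ω => B t ω - B (t - 1) ω) P := by
  refine iIndepFun_iff_finset.2 fun s => ?_
  -- Independence of increments is available along sequences indexed by ℕ, so finitely many times
  -- are shifted to the grid i − N. The step into t is then the grid increment with index t + N − 1.
  obtain ⟨N, hN⟩ : ∃ N : ℕ, ∀ t ∈ s, -(N : ℤ) < t := by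
    refine ⟨s.sup (fun t => t.natAbs + 1), fun t ht => ?_⟩
    have := Finset.le_sup (f := fun t : ℤ => t.natAbs + 1) ht
    omega
  have h := hB.indep.nat (t := fun i : ℕ => (i : ℤ) - N) fun a b hab => by
    simp only
    omega
  have h2 := h.precomp (g := fun t : s => ((t : ℤ) + N - 1).toNat) fun a b hab => by
    have ha := hN a a.2
    have hb := hN b b.2
    simp only at hab
    exact Subtype.ext (by omega)
  convert h2 using 3 with t ω
  have ht := hN t t.2
  have e1 : ((((t : ℤ) + N - 1).toNat + 1 : ℕ) : ℤ) - N = t := by omega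
  have e2 : ((((t : ℤ) + N - 1).toNat : ℕ) : ℤ) - N = t - 1 := by omega
  simp only [Finset.restrict, e1, e2]

/-- The definition fixes the law of the steps completely, so almost sure statements and
probabilities for any `B` reduce to the canonical space `stepLaw`. -/
lemma increments_law (hB : IsBrownianAtIntegers B P) :
    HasLaw (fun ω (t : ℤ) => B t ω - B (t - 1) ω)
      (Measure.infinitePi fun _ : ℤ => gaussianReal 0 1) P :=
  hB.increment_indep.hasLaw_infinitePi hB.increment_law
    (aemeasurable_pi_iff.2 fun t => (hB.increment_law t).aemeasurable)

lemma ae_eq_twoSidedSum (hB : IsBrownianAtIntegers B P) :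
    ∀ᵐ ω ∂P, ∀ h, B h ω = twoSidedSum (fun t => B t ω - B (t - 1) ω) h := by
  filter_upwards [hB.zero] with ω hω h
  rw [twoSidedSum_sub_sub (fun t => B t ω), hω, sub_zero]

end IsBrownianAtIntegers

/-! ### The canonical walk with drift and its maximiser -/

/-- The law of independent standard normal steps on `ℤ`. -/
abbrev stepLaw : Measure (ℤ → ℝ) := Measure.infinitePi fun _ : ℤ => gaussianReal 0 1

lemma stepLaw_indep : iIndepFun (fun (t : ℤ) (x : ℤ → ℝ) => x t) stepLaw :=
  iIndepFun_infinitePi (X := fun _ x => x) fun _ => measurable_id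

lemma stepLaw_map_eval (t : ℤ) : stepLaw.map (fun x => x t) = gaussianReal 0 1 :=
  Measure.infinitePi_map_eval _ t

lemma stepLaw_reflect : HasLaw (fun (x : ℤ → ℝ) t => -x (1 - t)) stepLaw stepLaw := by
  have h1 := (stepLaw_indep.precomp (g := fun t : ℤ => 1 - t) fun a b h => by simpa using h).comp
    (fun _ x => -x) fun _ => measurable_neg
  refine iIndepFun.hasLaw_infinitePi (X := fun (t : ℤ) (x : ℤ → ℝ) => -x (1 - t)) (fun t => ?_) h1
    (measurable_pi_lambda _ fun t => (measurable_pi_apply _).neg).aemeasurable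
  have : HasLaw (fun x : ℤ → ℝ => x (1 - t)) (gaussianReal 0 1) stepLaw :=
    ⟨(measurable_pi_apply _).aemeasurable, stepLaw_map_eval _⟩
  have := gaussianReal_neg this
  rw [neg_zero] at this
  exact this

/-- The walk with drift built from the steps `x`. -/
def stepDrift (c σ : ℝ) (x : ℤ → ℝ) (h : ℤ) : ℝ := -(1 / 2) * c * |(h : ℝ)| + σ * twoSidedSum x h

lemma measurable_stepDrift (c σ : ℝ) (h : ℤ) : Measurable fun x => stepDrift c σ x h :=
  ((measurable_twoSidedSum h).const_mul σ).const_add _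

lemma ae_tendsto_mean_of_steps {g : ℕ → ℤ} (hg : Function.Injective g) :
    ∀ᵐ x : ℤ → ℝ ∂stepLaw, Tendsto (fun n : ℕ => (∑ i ∈ Finset.range n, x (g i)) / (n : ℝ)) atTop (𝓝 0) := by
  have hid : ∀ i, IdentDistrib (fun x : ℤ → ℝ => x (g i)) (fun x => x (g 0)) stepLaw stepLaw :=
    fun i => ⟨(measurable_pi_apply _).aemeasurable, (measurable_pi_apply _).aemeasurable, by rw [stepLaw_map_eval, stepLaw_map_eval]⟩
  have hint : Integrable (fun x : ℤ → ℝ => x (g 0)) stepLaw := by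
    have h1 : Integrable (fun y : ℝ => y) (stepLaw.map fun x => x (g 0)) := by
      rw [stepLaw_map_eval]
      exact (memLp_id_gaussianReal 1).integrable le_rfl
    exact h1.comp_measurable (measurable_pi_apply _)
  have h0 : ∫ x : ℤ → ℝ, x (g 0) ∂stepLaw = 0 := by
    have h1 : ∫ y, y ∂(stepLaw.map fun x => x (g 0)) = ∫ x : ℤ → ℝ, x (g 0) ∂stepLaw :=
      integral_map (measurable_pi_apply _).aemeasurable aestronglyMeasurable_id
    rw [← h1, stepLaw_map_eval, integral_id_gaussianReal]
  have := strong_law_ae_real (fun i (x : ℤ → ℝ) => x (g i)) hint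
    (fun i j hij => stepLaw_indep.indepFun (hg.ne hij)) hid
  rwa [h0] at this

lemma sum_Ioc_zero_natCast (x : ℤ → ℝ) (n : ℕ) :
    ∑ t ∈ Finset.Ioc (0 : ℤ) n, x t = ∑ i ∈ Finset.range n, x (i + 1) := by
  induction n with
  | zero => simp
  | succ n ih =>
    have e : Finset.Ioc (0 : ℤ) (n + 1 : ℕ) = insert ((n : ℤ) + 1) (Finset.Ioc (0 : ℤ) n) := by
      ext t
      simp only [Finset.mem_Ioc, Finset.mem_insert]
      omega
    rw [e, Finset.sum_insert (by simp), ih, Finset.sum_range_succ, add_comm]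

lemma sum_Ioc_neg_natCast (x : ℤ → ℝ) (n : ℕ) :
    ∑ t ∈ Finset.Ioc (-n : ℤ) 0, x t = ∑ i ∈ Finset.range n, x (-i) := by
  induction n with
  | zero => simp
  | succ n ih =>
    have e : Finset.Ioc (-(n + 1 : ℕ) : ℤ) 0 = insert (-(n : ℤ)) (Finset.Ioc (-n : ℤ) 0) := by
      ext t
      simp only [Finset.mem_Ioc, Finset.mem_insert]
      omega
    rw [e, Finset.sum_insert (by simp), ih, Finset.sum_range_succ, add_comm]

/-- Almost surely, the walk with negative drift is negative outside a finite set. -/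
lemma ae_finite_stepDrift_nonneg {c σ : ℝ} (hc : 0 < c) :
    ∀ᵐ x ∂stepLaw, {h : ℤ | 0 ≤ stepDrift c σ x h}.Finite := by
  filter_upwards [ae_tendsto_mean_of_steps (g := fun i => (i : ℤ) + 1) fun a b h => by simpa using h,
    ae_tendsto_mean_of_steps (g := fun i => -(i : ℤ)) fun a b h => by simpa using h] with x h1 h2
  have key : ∀ u : ℕ → ℝ, Tendsto (fun n : ℕ => u n / n) atTop (𝓝 0) →
      ∀ᶠ n : ℕ in atTop, -(1 / 2) * c * n + |σ * u n| < 0 := fun u hu => by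
    have h3 := (hu.const_mul σ).abs
    rw [mul_zero, abs_zero] at h3
    filter_upwards [h3.eventually (gt_mem_nhds (show (0 : ℝ) < c / 2 by positivity)),
      eventually_gt_atTop 0] with n hn hn0
    have hn0' : (0 : ℝ) < n := by exact_mod_cast hn0
    rw [← mul_div_assoc, abs_div, Nat.abs_cast, div_lt_iff₀ hn0'] at hn
    linarith
  obtain ⟨N, hN⟩ := eventually_atTop.1 ((key _ h1).and (key _ h2))
  refine (Set.finite_Icc (-(N : ℤ)) N).subset fun h (hh : 0 ≤ stepDrift c σ x h) => ?_
  by_contra hcon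
  obtain ⟨q, rfl | rfl⟩ := Int.eq_nat_or_neg h
  · have hq : N ≤ q := by
      rw [Set.mem_Icc] at hcon
      omega
    have := (hN q hq).1
    rw [stepDrift, twoSidedSum_natCast, sum_Ioc_zero_natCast, Int.cast_natCast, Nat.abs_cast] at hh
    linarith [le_abs_self (σ * ∑ i ∈ Finset.range q, x (i + 1))]
  · have hq : N ≤ q := by
      rw [Set.mem_Icc] at hcon
      omega
    have := (hN q hq).2
    rw [stepDrift, twoSidedSum_neg_natCast, sum_Ioc_neg_natCast, Int.cast_neg, abs_neg,
      Int.cast_natCast, Nat.abs_cast] at hh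
    linarith [neg_abs_le (σ * ∑ i ∈ Finset.range q, x (-i))]

/-- A tie would force the sum of the steps between h and h', a nondegenerate normal variable, to hit
one prescribed value. -/
lemma stepDrift_ne {c σ : ℝ} (hσ : 0 < σ) {h h' : ℤ} (hh : h < h') :
    ∀ᵐ x ∂stepLaw, stepDrift c σ x h ≠ stepDrift c σ x h' := by
  have hlaw := hasLaw_sum_gaussian (P := stepLaw) (x := fun (t : ℤ) x => x t)
    (fun t => measurable_pi_apply t) stepLaw_indep stepLaw_map_eval (Finset.Ioc h h')
  have hcard : ((Finset.Ioc h h').card : NNReal) ≠ 0 := by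
    rw [Int.card_Ioc]
    have : (h' - h).toNat ≠ 0 := by omega
    exact_mod_cast this
  have := nullSingletonClass_gaussianReal (μ := 0) hcard
  set v := (1 / 2 * c * |(h' : ℝ)| - 1 / 2 * c * |(h : ℝ)|) / σ
  have h0 : stepLaw ((fun x : ℤ → ℝ => ∑ t ∈ Finset.Ioc h h', x t) ⁻¹' {v}) = 0 := by
    rw [← Measure.map_apply (Finset.measurable_fun_sum _ fun t _ => measurable_pi_apply t)
      (measurableSet_singleton v), hlaw]
    exact measure_singleton v
  refine measure_mono_null (fun x hx => ?_) h0
  simp only [Set.mem_compl_iff, Set.mem_ofPred_eq, not_not, stepDrift] at hx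
  have hs := twoSidedSum_sub x hh.le
  show ∑ t ∈ Finset.Ioc h h', x t = v
  rw [eq_div_iff hσ.ne', ← hs]
  linarith

/-- By the law of large numbers only finitely many values are nonnegative, and 0 is one of them, so
a maximum exists; the absence of ties makes it unique. For σ = 0 the maximiser is 0. -/
lemma ae_existsUnique_stepDrift {c σ : ℝ} (hc : 0 < c) (hσ : 0 ≤ σ) :
    ∀ᵐ x ∂stepLaw, ∃! h : ℤ, ∀ h', stepDrift c σ x h' ≤ stepDrift c σ x h := by
  rcases hσ.eq_or_lt with rfl | hσ
  · refine ae_of_all _ fun x => ⟨0, fun h' => ?_, fun y hy => ?_⟩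
    · simp only [stepDrift, Int.cast_zero, abs_zero]
      nlinarith [abs_nonneg (h' : ℝ)]
    · have := hy 0
      simp only [stepDrift, Int.cast_zero, abs_zero] at this
      have h1 : |(y : ℝ)| ≤ 0 := by nlinarith [abs_nonneg (y : ℝ)]
      exact_mod_cast abs_nonpos_iff.1 h1
  · have hne : ∀ᵐ x ∂stepLaw, ∀ h h' : ℤ, h < h' → stepDrift c σ x h ≠ stepDrift c σ x h' := by
      refine ae_all_iff.2 fun h => ae_all_iff.2 fun h' => ?_
      by_cases hh : h < h'
      · filter_upwards [stepDrift_ne (c := c) hσ hh] with x hx _ using hx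
      · exact ae_of_all _ fun x h1 => absurd h1 hh
    filter_upwards [hne, ae_finite_stepDrift_nonneg (σ := σ) hc] with x hx hfin
    have h0 : stepDrift c σ x 0 = 0 := by simp [stepDrift, twoSidedSum_zero]
    obtain ⟨h, hh, hmax⟩ := hfin.toFinset.exists_max_image (stepDrift c σ x) ⟨0, by simp [h0]⟩
    rw [Set.Finite.mem_toFinset, Set.mem_ofPred_eq] at hh
    have hmax' : ∀ h', stepDrift c σ x h' ≤ stepDrift c σ x h := fun h' => by
      by_cases hh' : 0 ≤ stepDrift c σ x h'
      · exact hmax h' (by simpa using hh')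
      · linarith
    refine ⟨h, hmax', fun y hy => ?_⟩
    by_contra hyh
    have heq := le_antisymm (hmax' y) (hy h)
    rcases lt_or_gt_of_ne hyh with hlt | hlt
    · exact hx y h hlt heq
    · exact hx h y hlt heq.symm

lemma measurableSet_stepDrift_argmax (c σ : ℝ) (h : ℤ) :
    MeasurableSet {x | ∀ h', stepDrift c σ x h' ≤ stepDrift c σ x h} := by
  have : {x | ∀ h', stepDrift c σ x h' ≤ stepDrift c σ x h} =
      ⋂ h', {x | stepDrift c σ x h' ≤ stepDrift c σ x h} := by ext; simp
  rw [this]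
  exact MeasurableSet.iInter fun h' =>
    measurableSet_le (measurable_stepDrift c σ h') (measurable_stepDrift c σ h)

lemma exists_isBrownianArgmax {c σ : ℝ} (hc : 0 < c) (hσ : 0 ≤ σ) :
    ∃ H : (ℤ → ℝ) → ℤ, IsBrownianArgmax stepLaw c σ H := by
  classical
  obtain ⟨f, hf⟩ := exists_surjective_nat ℤ
  -- The first maximiser in an enumeration of ℤ is a measurable choice. The second alternative lets
  -- the search stop also on the null set without a maximiser.
  let q : (ℤ → ℝ) → ℕ → Prop := fun x i =>
    (∀ h', stepDrift c σ x h' ≤ stepDrift c σ x (f i)) ∨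
      ∀ h, ¬ ∀ h', stepDrift c σ x h' ≤ stepDrift c σ x h
  have hq : ∀ x, ∃ i, q x i := fun x => by
    by_cases hx : ∃ h, ∀ h', stepDrift c σ x h' ≤ stepDrift c σ x h
    · obtain ⟨h, hh⟩ := hx
      obtain ⟨i, rfl⟩ := hf h
      exact ⟨i, Or.inl hh⟩
    · exact ⟨0, Or.inr (not_exists.1 hx)⟩
  have hqm : ∀ i, MeasurableSet {x | q x i} := fun i => by
    have h2 : MeasurableSet {x | ∀ h, ¬ ∀ h', stepDrift c σ x h' ≤ stepDrift c σ x h} := by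
      have : {x | ∀ h, ¬ ∀ h', stepDrift c σ x h' ≤ stepDrift c σ x h} =
          ⋂ h, {x | ∀ h', stepDrift c σ x h' ≤ stepDrift c σ x h}ᶜ := by ext; simp
      rw [this]
      exact MeasurableSet.iInter fun h => (measurableSet_stepDrift_argmax c σ h).compl
    exact (measurableSet_stepDrift_argmax c σ _).union h2
  refine ⟨fun x => f (Nat.find (hq x)), fun h x => twoSidedSum x h,
    isBrownianAtIntegers_twoSidedSum (fun t => measurable_pi_apply t) stepLaw_indep
      stepLaw_map_eval, (measurable_of_countable f).comp (measurable_find hq hqm), ?_⟩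
  filter_upwards [ae_existsUnique_stepDrift hc hσ] with x hx
  obtain ⟨h, hh, -⟩ := hx
  rcases Nat.find_spec (hq x) with h1 | h1
  · exact h1
  · exact absurd hh (h1 h)

namespace IsBrownianAtIntegers

variable {Ω : Type*} [MeasurableSpace Ω] {P : Measure Ω} [IsProbabilityMeasure P]
  {B : ℤ → Ω → ℝ} {c σ : ℝ}

lemma ae_driftProcess_eq (hB : IsBrownianAtIntegers B P) (c σ : ℝ) :
    ∀ᵐ ω ∂P, ∀ h, driftProcess c σ B h ω = stepDrift c σ (fun t => B t ω - B (t - 1) ω) h := by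
  filter_upwards [hB.ae_eq_twoSidedSum] with ω hω h
  rw [driftProcess, stepDrift, hω h]

lemma ae_of_stepLaw (hB : IsBrownianAtIntegers B P) {q : (ℤ → ℝ) → Prop}
    (hq : ∀ᵐ x ∂stepLaw, q x) : ∀ᵐ ω ∂P, q fun t => B t ω - B (t - 1) ω :=
  ae_of_ae_map hB.increments_law.aemeasurable (hB.increments_law.map_eq ▸ hq)

lemma ae_existsUnique (hB : IsBrownianAtIntegers B P) (hc : 0 < c) (hσ : 0 ≤ σ) :
    ∀ᵐ ω ∂P, ∃! h : ℤ, ∀ h' : ℤ, driftProcess c σ B h' ω ≤ driftProcess c σ B h ω := by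
  filter_upwards [hB.ae_driftProcess_eq c σ, hB.ae_of_stepLaw (ae_existsUnique_stepDrift hc hσ)]
    with ω h1 h2
  simpa only [h1] using h2

end IsBrownianAtIntegers

/-- The probability that `H = h` is the probability that the walk with drift is maximal at `h`. -/
lemma IsBrownianArgmax.measure_eq {Ω : Type*} [MeasurableSpace Ω] {P : Measure Ω}
    [IsProbabilityMeasure P] {c σ : ℝ} {H : Ω → ℤ} (hH : IsBrownianArgmax P c σ H) (hc : 0 < c)
    (hσ : 0 ≤ σ) (h : ℤ) :
    P {ω | H ω = h} = stepLaw {x | ∀ h', stepDrift c σ x h' ≤ stepDrift c σ x h} := by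
  obtain ⟨B, hB, -, hmax⟩ := hH
  rw [← hB.increments_law.measure_eq (measurableSet_stepDrift_argmax c σ h)]
  refine measure_congr ?_
  filter_upwards [hmax, hB.ae_driftProcess_eq c σ, hB.ae_existsUnique hc hσ] with ω h1 h2 h3
  refine propext ⟨fun (h4 : H ω = h) => ?_, fun h4 => ?_⟩
  · subst h4
    intro h'
    rw [← h2, ← h2]
    exact h1 h'
  · refine h3.unique h1 fun h' => ?_
    rw [h2, h2]
    exact h4 h'

/-- The limit variable has a symmetric law. -/
lemma IsBrownianArgmax.measure_neg {Ω : Type*} [MeasurableSpace Ω] {P : Measure Ω}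
    [IsProbabilityMeasure P] {c σ : ℝ} {H : Ω → ℤ} (hH : IsBrownianArgmax P c σ H) (hc : 0 < c)
    (hσ : 0 ≤ σ) (h : ℤ) : P {ω | H ω = -h} = P {ω | H ω = h} := by
  rw [hH.measure_eq hc hσ, hH.measure_eq hc hσ,
    ← stepLaw_reflect.measure_eq (measurableSet_stepDrift_argmax c σ h)]
  congr 1
  ext x
  have e : ∀ h, stepDrift c σ (fun t => -x (1 - t)) h = stepDrift c σ x (-h) := fun h => by
    simp [stepDrift, twoSidedSum_reflect]
  simp only [Set.mem_ofPred_eq, e]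
  exact ⟨fun h1 h' => h1 (-h'), fun h1 h' => by simpa using h1 (-h')⟩

/-! ### A central limit theorem for weighted sums -/

/-- Replacing the factors one at a time, all others being bounded by one, telescopes the difference.
-/
lemma norm_prod_sub_prod_le {ι : Type*} (s : Finset ι) {a b : ι → ℂ} (ha : ∀ i ∈ s, ‖a i‖ ≤ 1)
    (hb : ∀ i ∈ s, ‖b i‖ ≤ 1) : ‖∏ i ∈ s, a i - ∏ i ∈ s, b i‖ ≤ ∑ i ∈ s, ‖a i - b i‖ := by
  classical
  induction s using Finset.induction_on with
  | empty => simp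
  | insert j s hj ih =>
    rw [Finset.prod_insert hj, Finset.prod_insert hj, Finset.sum_insert hj]
    have hB : ‖∏ i ∈ s, b i‖ ≤ 1 := by
      rw [norm_prod]
      exact Finset.prod_le_one (fun i _ => norm_nonneg _) fun i hi =>
        hb i (Finset.mem_insert_of_mem hi)
    have ih' := ih (fun i hi => ha i (Finset.mem_insert_of_mem hi)) fun i hi =>
      hb i (Finset.mem_insert_of_mem hi)
    have e : a j * ∏ i ∈ s, a i - b j * ∏ i ∈ s, b i =
        (a j - b j) * ∏ i ∈ s, b i + a j * (∏ i ∈ s, a i - ∏ i ∈ s, b i) := by ring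
    rw [e]
    refine (norm_add_le _ _).trans (add_le_add ?_ ?_)
    · rw [norm_mul]
      exact mul_le_of_le_one_right (norm_nonneg _) hB
    · rw [norm_mul]
      exact (mul_le_of_le_one_left (norm_nonneg _) (ha j (Finset.mem_insert_self _ _))).trans ih'

/-- Products of two characteristic functions with the same second order expansion, at small
arguments with bounded sum of squares, are asymptotically equal. -/
lemma tendsto_prod_sub_prod {φ ψ : ℝ → ℂ} (hφ : ∀ x, ‖φ x‖ ≤ 1) (hψ : ∀ x, ‖ψ x‖ ≤ 1)
    (h : (fun x => φ x - ψ x) =o[𝓝 0] fun x : ℝ => x ^ 2) {p : ℕ → ℕ}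
    {w : ∀ n, Fin (p n) → ℝ} {s : ℝ} (hs : Tendsto (fun n => ∑ k, w n k ^ 2) atTop (𝓝 s))
    (hw : ∀ ρ > 0, ∀ᶠ n in atTop, ∀ k, |w n k| ≤ ρ) :
    Tendsto (fun n => ∏ k, φ (w n k) - ∏ k, ψ (w n k)) atTop (𝓝 0) := by
  rw [Metric.tendsto_nhds]
  intro e he
  set b := |s| + 1
  have hb : 0 < b := by positivity
  have hlt : s < b := (le_abs_self s).trans_lt (lt_add_one _)
  have h1 := h.def (show 0 < e / (2 * b) by positivity)
  obtain ⟨ρ, hρ, hball⟩ := Metric.eventually_nhds_iff.1 h1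
  filter_upwards [hw (ρ / 2) (by positivity), hs.eventually (gt_mem_nhds hlt)] with n hn hsn
  rw [dist_zero_right]
  have h2 : ∀ k, ‖φ (w n k) - ψ (w n k)‖ ≤ e / (2 * b) * w n k ^ 2 := fun k => by
    have := hball (y := w n k) (by
      rw [Real.dist_eq, sub_zero]
      linarith [hn k])
    rwa [norm_pow, Real.norm_eq_abs, sq_abs] at this
  calc ‖∏ k, φ (w n k) - ∏ k, ψ (w n k)‖ ≤ ∑ k, ‖φ (w n k) - ψ (w n k)‖ :=
        norm_prod_sub_prod_le _ (fun k _ => hφ _) fun k _ => hψ _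
    _ ≤ ∑ k, e / (2 * b) * w n k ^ 2 := Finset.sum_le_sum fun k _ => h2 k
    _ = e / (2 * b) * ∑ k, w n k ^ 2 := (Finset.mul_sum _ _ _).symm
    _ ≤ e / (2 * b) * b := by gcongr
    _ = e / 2 := by field_simp
    _ < e := by linarith

/-- A triangular central limit theorem for weighted sums of a standardised i.i.d. sequence. -/
lemma tendsto_charFun_weighted_sum {Ω : Type*} [MeasurableSpace Ω] {P : Measure Ω}
    [IsProbabilityMeasure P] {X : Ω → ℝ} (hX : AEMeasurable X P) (h0 : ∫ ω, X ω ∂P = 0)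
    (h1 : ∫ ω, X ω ^ 2 ∂P = 1) {p : ℕ → ℕ} {w : ∀ n, Fin (p n) → ℝ} {σ : ℝ}
    (hs : Tendsto (fun n => ∑ k, w n k ^ 2) atTop (𝓝 (σ ^ 2)))
    (hw : ∀ ρ > 0, ∀ᶠ n in atTop, ∀ k, |w n k| ≤ ρ) (t : ℝ) :
    Tendsto (fun n => ∏ k, charFun (P.map X) (w n k * t)) atTop
      (𝓝 (charFun (gaussianReal 0 1) (σ * t))) := by
  have := Measure.isProbabilityMeasure_map hX
  have e1 := taylor_charFun_two hX h0 h1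
  have e2 := taylor_charFun_two (P := gaussianReal 0 1) (X := id) aemeasurable_id
    (by simp) (by
      have := variance_id_gaussianReal (μ := 0) (v := 1)
      rw [variance_of_integral_eq_zero aemeasurable_id (by simp)] at this
      simpa using this)
  rw [Measure.map_id] at e2
  -- Both laws have mean zero and variance one, so their second order expansions coincide and the
  -- difference is o(x²). Comparison with the Gaussian product then replaces taking logarithms.
  have e3 : (fun x : ℝ => charFun (P.map X) x - charFun (gaussianReal 0 1) x) =o[𝓝 0]
      fun x : ℝ => x ^ 2 := by
    refine (e1.sub e2).congr_left fun x => ?_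
    ring
  have hs' : Tendsto (fun n => ∑ k, (w n k * t) ^ 2) atTop (𝓝 (σ ^ 2 * t ^ 2)) := by
    simp_rw [mul_pow, ← Finset.sum_mul]
    exact hs.mul_const _
  have hw' : ∀ ρ > 0, ∀ᶠ n in atTop, ∀ k, |w n k * t| ≤ ρ := fun ρ hρ => by
    filter_upwards [hw (ρ / (|t| + 1)) (by positivity)] with n hn k
    rw [abs_mul]
    calc |w n k| * |t| ≤ ρ / (|t| + 1) * (|t| + 1) := by
          gcongr
          · exact hn k
          · linarith
      _ = ρ := by field_simp
  have h3 := tendsto_prod_sub_prod (fun x => norm_charFun_le_one x)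
    (fun x => norm_charFun_le_one x) e3 hs' hw'
  have h4 : Tendsto (fun n => ∏ k, charFun (gaussianReal 0 1) (w n k * t)) atTop
      (𝓝 (charFun (gaussianReal 0 1) (σ * t))) := by
    have h5 : ∀ n, ∏ k, charFun (gaussianReal 0 1) (w n k * t) =
        Complex.exp (((-(∑ k, (w n k * t) ^ 2) / 2 : ℝ)) : ℂ) := fun n => by
      simp_rw [charFun_gaussianReal]
      rw [← Complex.exp_sum]
      congr 1
      push_cast
      rw [← Finset.sum_neg_distrib, Finset.sum_div]
      refine Finset.sum_congr rfl fun k _ => ?_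
      simp
      ring
    simp_rw [h5]
    rw [charFun_gaussianReal]
    have h6 : (((σ * t : ℝ) : ℂ) * ((0 : ℝ) : ℂ) * Complex.I -
        ((1 : NNReal) : ℂ) * ((σ * t : ℝ) : ℂ) ^ 2 / 2) = ((-(σ ^ 2 * t ^ 2) / 2 : ℝ) : ℂ) := by
      push_cast
      ring
    rw [h6]
    exact (Complex.continuous_exp.tendsto _).comp
      ((Complex.continuous_ofReal.tendsto _).comp (hs'.neg.div_const 2))
  simpa using h3.add h4

/-! ### Windows of a random process -/

/-- A vector indexed by a finite set of integers, extended by zero. -/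
def extendZero (W : Finset ℤ) (u : W → ℝ) (t : ℤ) : ℝ := if ht : t ∈ W then u ⟨t, ht⟩ else 0

lemma continuous_extendZero (W : Finset ℤ) (t : ℤ) : Continuous fun u => extendZero W u t := by
  unfold extendZero
  split_ifs with h
  · exact continuous_apply _
  · exact continuous_const

lemma continuous_twoSidedSum_extendZero (W : Finset ℤ) (h : ℤ) :
    Continuous fun u => twoSidedSum (extendZero W u) h :=
  (continuous_finsetSum _ fun t _ => continuous_extendZero W t).sub
    (continuous_finsetSum _ fun t _ => continuous_extendZero W t)

lemma twoSidedSum_extendZero (x : ℤ → ℝ) {N : ℕ} {h : ℤ} (hh : |h| ≤ N) :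
    twoSidedSum (extendZero (Finset.Icc (-N : ℤ) N) fun t => x t) h = twoSidedSum x h := by
  rw [abs_le] at hh
  have key : ∀ a b : ℤ, -(N : ℤ) ≤ a → b ≤ N → ∑ t ∈ Finset.Ioc a b,
      extendZero (Finset.Icc (-N : ℤ) N) (fun t => x t) t = ∑ t ∈ Finset.Ioc a b, x t :=
    fun a b ha hb => Finset.sum_congr rfl fun t ht => by
      rw [Finset.mem_Ioc] at ht
      rw [extendZero, dif_pos (Finset.mem_Icc.2 ⟨by omega, by omega⟩)]
  rw [twoSidedSum, twoSidedSum, key 0 h (by omega) hh.2, key h 0 hh.1 (by omega)]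

/-- Convergence in law of the coordinates of processes with independent coordinates entails
convergence in law of finite windows. -/
lemma le_liminf_window {Ω : Type*} [MeasurableSpace Ω] {P : Measure Ω} [IsProbabilityMeasure P]
    {x : ℕ → ℤ → Ω → ℝ} (hm : ∀ n t, Measurable (x n t)) (hx : ∀ n, iIndepFun (x n) P)
    {Ω' : Type*} [MeasurableSpace Ω'] {P' : Measure Ω'} [IsProbabilityMeasure P']
    {y : ℤ → Ω' → ℝ} (hm' : ∀ t, Measurable (y t)) (hy : iIndepFun y P')
    (hconv : ∀ t s, Tendsto (fun n => charFun (P.map (x n t)) s) atTop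
      (𝓝 (charFun (P'.map (y t)) s))) (W : Finset ℤ) {U : Set (W → ℝ)} (hU : IsOpen U) :
    P' {ω | (fun t : W => y t ω) ∈ U} ≤
      liminf (fun n => P {ω | (fun t : W => x n t ω) ∈ U}) atTop := by
  let μ : ℕ → W → ProbabilityMeasure ℝ := fun n t =>
    ⟨P.map (x n t), Measure.isProbabilityMeasure_map (hm n t).aemeasurable⟩
  let ν : W → ProbabilityMeasure ℝ := fun t =>
    ⟨P'.map (y t), Measure.isProbabilityMeasure_map (hm' t).aemeasurable⟩
  have h1 : Tendsto (fun n => ProbabilityMeasure.pi (μ n)) atTop (𝓝 (ProbabilityMeasure.pi ν)) :=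
    (ProbabilityMeasure.continuous_pi.tendsto ν).comp (tendsto_pi_nhds.2 fun t =>
      ProbabilityMeasure.tendsto_iff_tendsto_charFun.2 (hconv t))
  have h2 := ProbabilityMeasure.le_liminf_measure_open_of_tendsto h1 hU
  have e1 : ∀ n, (ProbabilityMeasure.pi (μ n) : Measure (W → ℝ)) U =
      P {ω | (fun t : W => x n t ω) ∈ U} := fun n => by
    have := iIndepFun.map_fun_eq_pi_map (f := fun (t : W) => x n t)
      (fun t => (hm n t).aemeasurable)
      ((hx n).precomp (g := fun t : W => (t : ℤ)) Subtype.val_injective)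
    rw [ProbabilityMeasure.toMeasure_pi]
    change Measure.pi (fun t : W => P.map (x n t)) U = _
    rw [← this, Measure.map_apply (measurable_pi_lambda (fun ω (t : W) => x n t ω) fun t => hm n t)
      hU.measurableSet]
    rfl
  have e2 : (ProbabilityMeasure.pi ν : Measure (W → ℝ)) U =
      P' {ω | (fun t : W => y t ω) ∈ U} := by
    have := iIndepFun.map_fun_eq_pi_map (f := fun (t : W) => y t)
      (fun t => (hm' t).aemeasurable)
      (hy.precomp (g := fun t : W => (t : ℤ)) Subtype.val_injective)
    rw [ProbabilityMeasure.toMeasure_pi]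
    change Measure.pi (fun t : W => P'.map (y t)) U = _
    rw [← this, Measure.map_apply (measurable_pi_lambda (fun ω (t : W) => y t ω) fun t => hm' t)
      hU.measurableSet]
    rfl
  simp_rw [e1] at h2
  rwa [e2] at h2

/-- Integer-valued variables converge in distribution if the point masses do. -/
lemma tendstoInDistribution_of_le_liminf {Ω Ω' : Type*} [MeasurableSpace Ω] [MeasurableSpace Ω']
    {P : Measure Ω} [IsProbabilityMeasure P] {P' : Measure Ω'} [IsProbabilityMeasure P']
    {Z : ℕ → Ω → ℝ} (hZ : ∀ n, Measurable (Z n)) {H : Ω' → ℤ} (hH : Measurable H)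
    (h : ∀ i : ℤ, P' {ω | H ω = i} ≤ liminf (fun n => P {ω | Z n ω = i}) atTop) :
    TendstoInDistribution Z atTop (fun ω => (H ω : ℝ)) (fun _ => P) P' where
  forall_aemeasurable n := (hZ n).aemeasurable
  aemeasurable_limit := (measurable_of_countable (fun i : ℤ => (i : ℝ))).comp hH |>.aemeasurable
  tendsto := by
    -- An open set may be tested from below by its integer points alone: H charges only these.
    -- Fatou's lemma for counting measure then sums the lower bounds.
    refine tendsto_of_forall_isOpen_le_liminf' fun G hG => ?_
    classical
    have e0 : MeasurableSet G := hG.measurableSet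
    have hH' : Measurable fun ω => (H ω : ℝ) :=
      (measurable_of_countable (fun i : ℤ => (i : ℝ))).comp hH
    let I : ℤ → ENNReal := fun i => if (i : ℝ) ∈ G then 1 else 0
    have e1 : P'.map (fun ω => (H ω : ℝ)) G = ∑' i : ℤ, I i * P' {ω | H ω = i} := by
      have e2 : (fun ω => (H ω : ℝ)) ⁻¹' G = ⋃ i : ℤ, {ω | (i : ℝ) ∈ G ∧ H ω = i} := by
        ext ω
        simp
      rw [Measure.map_apply hH' e0, e2, measure_iUnion]
      · refine tsum_congr fun i => ?_
        by_cases hi : (i : ℝ) ∈ G <;> simp [I, hi]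
      · intro i j hij
        refine Set.disjoint_left.2 fun ω h1 h2 => hij (h1.2.symm.trans h2.2)
      · intro i
        by_cases hi : (i : ℝ) ∈ G
        · simp only [hi, true_and]
          exact hH (measurableSet_singleton i)
        · simp [hi]
    have e3 : ∀ n, ∑' i : ℤ, I i * P {ω | Z n ω = i} ≤ P.map (Z n) G := fun n => by
      rw [Measure.map_apply (hZ n) e0]
      have e4 : ∑' i : ℤ, I i * P {ω | Z n ω = i} =
          P (⋃ i : ℤ, {ω | (i : ℝ) ∈ G ∧ Z n ω = i}) := by
        rw [measure_iUnion]
        · refine tsum_congr fun i => ?_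
          by_cases hi : (i : ℝ) ∈ G <;> simp [I, hi]
        · intro i j hij
          refine Set.disjoint_left.2 fun ω h1 h2 => hij ?_
          exact_mod_cast h1.2.symm.trans h2.2
        · intro i
          by_cases hi : (i : ℝ) ∈ G
          · simp only [hi, true_and]
            exact hZ n (measurableSet_singleton (i : ℝ))
          · simp [hi]
      rw [e4]
      refine measure_mono fun ω hω => ?_
      obtain ⟨i, hi, hZi⟩ := Set.mem_iUnion.1 hω
      rw [Set.mem_preimage, hZi]
      exact hi
    change P'.map (fun ω => (H ω : ℝ)) G ≤ liminf (fun n => P.map (Z n) G) atTop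
    rw [e1]
    calc ∑' i : ℤ, I i * P' {ω | H ω = i}
        ≤ ∑' i : ℤ, liminf (fun n => I i * P {ω | Z n ω = i}) atTop := by
          refine ENNReal.tsum_le_tsum fun i => ?_
          by_cases hi : (i : ℝ) ∈ G
          · simpa [I, hi] using h i
          · simp [I, hi]
      _ = ∫⁻ i : ℤ, liminf (fun n => I i * P {ω | Z n ω = i}) atTop ∂Measure.count :=
          (lintegral_count _).symm
      _ ≤ liminf (fun n => ∫⁻ i : ℤ, I i * P {ω | Z n ω = i} ∂Measure.count) atTop :=
          lintegral_liminf_le fun n => measurable_of_countable _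
      _ = liminf (fun n => ∑' i : ℤ, I i * P {ω | Z n ω = i}) atTop := by
          simp_rw [lintegral_count]
      _ ≤ liminf (fun n => P.map (Z n) G) atTop := liminf_le_liminf (Eventually.of_forall e3)

/-! ### Separation of the maximum -/

/-- The walks with steps `x` that are bounded by `R` on `[-N, N]` and exceed at `h` all other
values of the walk with drift on `[-N, N]` by more than `1 / R`. -/
def sepSet (c : ℝ) (N : ℕ) (R : ℝ) (h : ℤ) : Set (ℤ → ℝ) :=
  {x | ∀ i ∈ Finset.Icc (-N : ℤ) N, |twoSidedSum x i| < R ∧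
    (i ≠ h → stepDrift c 1 x i + 1 / R < stepDrift c 1 x h)}

lemma extendZero_mem_sepSet (c : ℝ) {N : ℕ} (R : ℝ) {h : ℤ} (hh : |h| ≤ N) (x : ℤ → ℝ) :
    extendZero (Finset.Icc (-N : ℤ) N) (fun t => x t) ∈ sepSet c N R h ↔ x ∈ sepSet c N R h := by
  refine forall₂_congr fun i hi => ?_
  have hi' : |i| ≤ N := abs_le.2 (Finset.mem_Icc.1 hi)
  simp only [stepDrift, twoSidedSum_extendZero x hi', twoSidedSum_extendZero x hh]

/-- Only finitely many strict inequalities between continuous functions of the window are involved.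
Openness is what weak convergence needs for a lower bound. -/
lemma isOpen_extendZero_sepSet (c : ℝ) (N : ℕ) (R : ℝ) (h : ℤ) (W : Finset ℤ) :
    IsOpen {u | extendZero W u ∈ sepSet c N R h} := by
  have e : {u | extendZero W u ∈ sepSet c N R h} = ⋂ i ∈ Finset.Icc (-N : ℤ) N,
      {u | |twoSidedSum (extendZero W u) i| < R ∧
        (i ≠ h → stepDrift c 1 (extendZero W u) i + 1 / R <
          stepDrift c 1 (extendZero W u) h)} := by
    ext u
    simp [sepSet]
  have hc : ∀ i, Continuous fun u => stepDrift c 1 (extendZero W u) i := fun i =>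
    continuous_const.add (continuous_const.mul (continuous_twoSidedSum_extendZero W i))
  rw [e]
  refine isOpen_biInter_finset fun i _ => ?_
  refine (isOpen_lt (continuous_twoSidedSum_extendZero W i).abs continuous_const).and ?_
  by_cases hi : i = h
  · simp [hi]
  · simpa [hi] using isOpen_lt ((hc i).add continuous_const) (hc h)

lemma sepSet_mono (c : ℝ) (N : ℕ) (h : ℤ) : Monotone fun R : ℕ => sepSet c N (R + 1) h := by
  intro R R' hR x hx i hi
  have hR' : (R : ℝ) ≤ R' := by exact_mod_cast hR
  refine ⟨(hx i hi).1.trans_le (by linarith), fun hne => lt_of_le_of_lt ?_ ((hx i hi).2 hne)⟩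
  gcongr

lemma twoSidedSum_const_mul (σ : ℝ) (x : ℤ → ℝ) (h : ℤ) :
    twoSidedSum (fun t => σ * x t) h = σ * twoSidedSum x h := by
  simp only [twoSidedSum, ← Finset.mul_sum]
  ring

/-- Absorbing σ into the steps lets one separation event serve both the noise walk and its limit,
including σ = 0. -/
lemma stepDrift_const_mul (c σ : ℝ) (x : ℤ → ℝ) (h : ℤ) :
    stepDrift c 1 (fun t => σ * x t) h = stepDrift c σ x h := by
  rw [stepDrift, stepDrift, twoSidedSum_const_mul, one_mul]

/-- The event that the walk with drift is maximal at `h` is exhausted by separation events. -/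
lemma stepLaw_argmax_le {c σ : ℝ} (hc : 0 < c) (hσ : 0 ≤ σ) (N : ℕ) (h : ℤ) {b : ENNReal}
    (hb : ∀ R : ℕ, stepLaw {x | (fun t => σ * x t) ∈ sepSet c N (R + 1) h} ≤ b) :
    stepLaw {x | ∀ h', stepDrift c σ x h' ≤ stepDrift c σ x h} ≤ b := by
  have hmono : Monotone fun R : ℕ =>
      {x : ℤ → ℝ | (fun t => σ * x t) ∈ sepSet c N (R + 1) h} := fun R R' hR x hx =>
    sepSet_mono c N h hR hx
  have hle : stepLaw {x | ∀ h', stepDrift c σ x h' ≤ stepDrift c σ x h} ≤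
      stepLaw (⋃ R : ℕ, {x : ℤ → ℝ | (fun t => σ * x t) ∈ sepSet c N (R + 1) h}) := by
    refine measure_mono_ae ?_
    filter_upwards [ae_existsUnique_stepDrift hc hσ] with x hx hmax
    have key : ∀ i ∈ Finset.Icc (-N : ℤ) N, ∀ᶠ R : ℕ in atTop,
        |twoSidedSum (fun t => σ * x t) i| < (R : ℝ) + 1 ∧
          (i ≠ h → stepDrift c 1 (fun t => σ * x t) i + 1 / ((R : ℝ) + 1) <
            stepDrift c 1 (fun t => σ * x t) h) := fun i _ => by
      have h1 : Tendsto (fun R : ℕ => (R : ℝ) + 1) atTop atTop :=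
        tendsto_atTop_add_const_right _ _ tendsto_natCast_atTop_atTop
      refine (h1.eventually_gt_atTop _).and ?_
      by_cases hi : i = h
      · simp [hi]
      · have hlt : stepDrift c σ x i < stepDrift c σ x h := by
          refine lt_of_le_of_ne (hmax i) fun heq => hi (hx.unique (fun h' => ?_) hmax)
          rw [heq]
          exact hmax h'
        have h2 := (tendsto_const_nhds (x := stepDrift c σ x i)).add
          (tendsto_one_div_add_atTop_nhds_zero_nat (𝕜 := ℝ))
        rw [add_zero] at h2
        filter_upwards [h2.eventually (gt_mem_nhds hlt)] with R hR _
        rwa [stepDrift_const_mul, stepDrift_const_mul]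
    obtain ⟨R, hR⟩ := ((Finset.eventually_all _).2 key).exists
    exact Set.mem_iUnion.2 ⟨R, hR⟩
  refine hle.trans ?_
  rw [hmono.measure_iUnion]
  exact iSup_le hb

namespace PanelModel

variable {Ω : Type*} [MeasurableSpace Ω] {P : Measure Ω} [IsProbabilityMeasure P]
  (M : PanelModel P)

/-! ### Steps of the linear noise term without correlation over time -/

lemma ε_eq_of_uncorrelated (hM : M.IsDiagonal) (hU : M.Uncorrelated) (n : ℕ) (k : Fin (M.p n))
    (t : ℤ) (ω : Ω) : M.ε n k t ω = M.a n 0 k * M.η k t ω := by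
  rw [M.ε_eq_linearFilter hM, linearFilter, tsum_eq_single 0 fun j hj => ?_]
  · simp [a]
  · rw [hU n j k hj, zero_mul]

/-- The increment of the linear noise term at distance `t` from `m₀`. -/
def step (n m₀ : ℕ) (t : ℤ) (ω : Ω) : ℝ := ∑ k, M.δ n k * M.ε n k (m₀ + t) ω

lemma step_eq (hM : M.IsDiagonal) (hU : M.Uncorrelated) (n m₀ : ℕ) (t : ℤ) :
    M.step n m₀ t = fun ω => ∑ k, M.δ n k * M.a n 0 k * M.η k (m₀ + t) ω := by
  funext ω
  simp only [step, M.ε_eq_of_uncorrelated hM hU, mul_assoc]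

lemma measurable_step (hM : M.IsDiagonal) (hU : M.Uncorrelated) (n m₀ : ℕ) (t : ℤ) :
    Measurable (M.step n m₀ t) := by
  rw [M.step_eq hM hU]
  exact Finset.measurable_fun_sum _ fun k _ => (M.η_measurable _ _).const_mul _

lemma iIndepFun_step (hM : M.IsDiagonal) (hU : M.Uncorrelated) (n m₀ : ℕ) :
    iIndepFun (M.step n m₀) P := by
  have h1 : iIndepFun (fun q : (_ : ℤ) × Fin (M.p n) => M.η q.2 (m₀ + q.1)) P := by
    refine M.η_indep.precomp (g := fun q : (_ : ℤ) × Fin (M.p n) => ((q.2 : ℕ), (m₀ + q.1 : ℤ)))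
      ?_
    rintro ⟨s, k⟩ ⟨t, l⟩ hst
    simp only [Prod.mk.injEq, add_right_inj] at hst
    obtain ⟨hkl, rfl⟩ := hst
    rw [Fin.ext hkl]
  have h2 := (iIndepFun.rows_sigma (η := fun t (k : Fin (M.p n)) => M.η k (m₀ + t))
    (fun _ _ => M.η_measurable _ _) h1).comp (fun _ y => ∑ k, M.δ n k * M.a n 0 k * y k)
    fun _ => Finset.measurable_fun_sum _ fun k _ => (measurable_pi_apply k).const_mul _
  convert h2 using 1
  funext t
  exact M.step_eq hM hU n m₀ t

lemma charFun_step (hM : M.IsDiagonal) (hU : M.Uncorrelated) (n m₀ : ℕ) (t : ℤ) (s : ℝ) :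
    charFun (P.map (M.step n m₀ t)) s =
      ∏ k, charFun (P.map (M.η 0 0)) (M.δ n k * M.a n 0 k * s) := by
  have h1 : iIndepFun (fun (k : Fin (M.p n)) => M.η k (m₀ + t)) P :=
    M.η_indep.precomp (g := fun k : Fin (M.p n) => ((k : ℕ), (m₀ + t : ℤ))) fun k l hkl => by
      simpa [Fin.ext_iff] using hkl
  have h2 : iIndepFun (fun (k : Fin (M.p n)) ω => M.δ n k * M.a n 0 k * M.η k (m₀ + t) ω) P :=
    h1.comp (fun k y => M.δ n k * M.a n 0 k * y) fun k => measurable_id.const_mul _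
  rw [M.step_eq hM hU, h2.charFun_map_fun_sum_eq_prod fun k =>
    ((M.η_measurable _ _).const_mul _).aemeasurable, Finset.prod_apply]
  refine Finset.prod_congr rfl fun k _ => ?_
  rw [charFun_map_mul_comp (M.η_measurable _ _).aemeasurable, (M.η_ident k _).map_eq]

lemma Kn_eq_univ {n : ℕ} (h : M.K0 n = ∅) : M.Kn n = Finset.univ := by
  rwa [K0, Finset.compl_eq_empty_iff] at h

/-- Since no panel has a persistent jump, the vanishing supremum runs over all panels, and bounded
coefficients preserve smallness. This is the negligibility needed for the central limit theorem. -/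
lemma eventually_weight_le (hC : M.BoundedCoeff) (hN : M.NegligibleJumps) (h0 : ∀ n, M.K0 n = ∅)
    {ρ : ℝ} (hρ : 0 < ρ) : ∀ᶠ n in atTop, ∀ k, |M.δ n k * M.a n 0 k| ≤ ρ := by
  obtain ⟨C, hC⟩ := hC
  have h1 : (0 : ℝ) < ρ / (|C| + 1) := by positivity
  filter_upwards [hN.eventually (gt_mem_nhds h1)] with n hn k
  have h2 : |M.δ n k| ≤ ρ / (|C| + 1) :=
    (le_ciSup (f := fun k : M.Kn n => |M.δ n k|) (Set.finite_range _).bddAbove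
      ⟨k, by rw [M.Kn_eq_univ (h0 n)]; exact Finset.mem_univ k⟩).trans hn.le
  have h3 : |M.a n 0 k| ≤ |C| + 1 := by
    have := ((hC n k).1.le_tsum 0 fun j _ => abs_nonneg _).trans (hC n k).2
    linarith [le_abs_self C]
  rw [abs_mul]
  calc |M.δ n k| * |M.a n 0 k| ≤ ρ / (|C| + 1) * (|C| + 1) := by gcongr
    _ = ρ := by field_simp

lemma stepLaw_sepSet_le_liminf {c σ : ℝ} (hM : ModerateJump M c σ) (hN : M.NegligibleJumps)
    (h0 : ∀ n, M.K0 n = ∅) (m₀ : ℕ → ℕ) (N : ℕ) (R : ℝ) {h : ℤ} (hh : |h| ≤ N) :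
    stepLaw {x | (fun t => σ * x t) ∈ sepSet c N R h} ≤
      liminf (fun n => P {ω | (fun t => M.step n (m₀ n) t ω) ∈ sepSet c N R h}) atTop := by
  have hs := hM.sigma.2
  simp_rw [fun n => M.Kn_eq_univ (h0 n), ← mul_pow] at hs
  have hη2 : ∫ ω, M.η 0 0 ω ^ 2 ∂P = 1 := M.η_var
  have hconv : ∀ t s, Tendsto (fun n => charFun (P.map (M.step n (m₀ n) t)) s) atTop
      (𝓝 (charFun (stepLaw.map fun x => σ * x t) s)) := fun t s => by
    simp_rw [M.charFun_step hM.diagonal hM.uncorrelated]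
    rw [charFun_map_mul_comp (measurable_pi_apply t).aemeasurable, stepLaw_map_eval]
    exact tendsto_charFun_weighted_sum (M.η_measurable 0 0).aemeasurable M.η_mean hη2 hs
      (fun ρ hρ => M.eventually_weight_le hM.bounded hN h0 hρ) s
  have key := le_liminf_window (x := fun n => M.step n (m₀ n)) (y := fun t (x : ℤ → ℝ) => σ * x t)
    (fun n t => M.measurable_step hM.diagonal hM.uncorrelated n (m₀ n) t)
    (fun n => M.iIndepFun_step hM.diagonal hM.uncorrelated n (m₀ n))
    (fun t => (measurable_pi_apply (X := fun _ : ℤ => ℝ) t).const_mul σ)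
    (stepLaw_indep.comp (fun _ y => σ * y) fun _ => measurable_id.const_mul _) hconv
    (Finset.Icc (-N : ℤ) N) (isOpen_extendZero_sepSet c N R h _)
  have e1 : ∀ x : ℤ → ℝ, (fun t : Finset.Icc (-N : ℤ) N => σ * x t) ∈
      {u | extendZero (Finset.Icc (-N : ℤ) N) u ∈ sepSet c N R h} ↔
      (fun t => σ * x t) ∈ sepSet c N R h := fun x =>
    extendZero_mem_sepSet c R hh fun t => σ * x t
  have e2 : ∀ n ω, (fun t : Finset.Icc (-N : ℤ) N => M.step n (m₀ n) t ω) ∈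
      {u | extendZero (Finset.Icc (-N : ℤ) N) u ∈ sepSet c N R h} ↔
      (fun t => M.step n (m₀ n) t ω) ∈ sepSet c N R h := fun n ω =>
    extendZero_mem_sepSet c R hh fun t => M.step n (m₀ n) t ω
  simpa only [e1, e2] using key

/-! ### The limit law of the estimator -/

/-- Near the change point, the criterion is close to a walk with drift. -/
lemma exists_eventually_L_close {c : ℝ} (hc : 0 < c)
    (hD : Tendsto (fun n => ‖M.δ n‖ ^ 2) atTop (𝓝 c)) (N : ℕ) {R κ : ℝ} (hR : 0 < R)
    (hκ : 0 < κ) :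
    ∃ θ : ℝ, 0 < θ ∧ 10 / M.cstar ^ 2 * θ < M.cstar / 2 ∧ ∀ᶠ n : ℕ in atTop, ∀ m₀ : ℕ, ∀ ω,
      (n : ℝ) * M.τ n = m₀ → M.GoodRow n m₀ θ ω → ∀ (m : ℕ) (i : ℤ), (m : ℤ) = m₀ + i →
      (m : ℝ) / n ∈ Set.Ioo M.cstar (1 - M.cstar) → |i| ≤ N → |M.walk n m₀ i ω| ≤ R →
      |n * (M.L n m ω - M.L n m₀ ω) - (c * |(i : ℝ)| - 2 * M.walk n m₀ i ω)| ≤ κ := by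
  obtain ⟨θ₀, hθ₀, hθ₀'⟩ := M.exists_small_θ
  have hcs := M.cstar_pos
  set C := 10 / M.cstar ^ 2
  have hC : 0 < C := by positivity
  -- The tolerance is split into three: the quadratic remainder is made small by θ, the factor r
  -- differs from 1 by O(N/n), and ‖δ‖² differs from c by o(1).
  set b := C * ((c + 1) * (N + 1))
  have hb : 0 < b := by positivity
  refine ⟨min θ₀ (κ / 3 / b), lt_min hθ₀ (by positivity), lt_of_le_of_lt ?_ hθ₀', ?_⟩
  · gcongr
    exact min_le_left _ _
  set θ := min θ₀ (κ / 3 / b)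
  have hθ : 0 < θ := lt_min hθ₀ (by positivity)
  have hθb : θ * b ≤ κ / 3 := (le_div_iff₀ hb).1 (min_le_right _ _)
  have hD1 : ∀ᶠ n in atTop, N * |‖M.δ n‖ ^ 2 - c| < κ / 3 := by
    have := ((hD.sub_const c).abs.const_mul (N : ℝ))
    rw [sub_self, abs_zero, mul_zero] at this
    exact this.eventually (gt_mem_nhds (by positivity))
  have hn1 : ∀ᶠ n : ℕ in atTop, N / M.cstar * (N * (c + 1) + 2 * R) / n < κ / 3 :=
    (tendsto_const_div_atTop_nhds_zero_nat _).eventually (gt_mem_nhds (by positivity))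
  filter_upwards [hD1, hn1, hD.eventually (gt_mem_nhds (lt_add_one c)), eventually_ge_atTop 1,
    M.τ_mem] with n hDn hnn hDc hn1 hτ m₀ ω h₀ hg m i hmi hm hi hw
  obtain ⟨r, r1, r2, r3, hr⟩ := M.L_expansion h₀ hn1 hτ hg hm hmi
  have hn' : (0 : ℝ) < n := by exact_mod_cast hn1
  have hi' : |(i : ℝ)| ≤ N := by exact_mod_cast hi
  have hi0 := abs_nonneg (i : ℝ)
  set D := ‖M.δ n‖ ^ 2 with hDdef
  have hD0 : 0 ≤ D := by positivity
  set w := M.walk n m₀ i ω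
  set X := |(i : ℝ)| * D - 2 * w with hX
  have hX' : |X| ≤ N * (c + 1) + 2 * R := by
    have h1 : |(i : ℝ)| * D ≤ N * (c + 1) := by gcongr
    have h2 : 0 ≤ |(i : ℝ)| * D := by positivity
    rw [abs_le] at hw ⊢
    constructor <;> linarith
  have b1 : C * θ * D * |(i : ℝ)| ≤ κ / 3 := by
    calc C * θ * D * |(i : ℝ)| ≤ C * θ * (c + 1) * (N + 1) := by
          gcongr
          linarith
      _ = θ * b := by ring
      _ ≤ κ / 3 := hθb
  have b2 : |r * X - X| ≤ κ / 3 := by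
    rw [show r * X - X = -((1 - r) * X) by ring, abs_neg, abs_mul, abs_of_nonneg (by linarith)]
    calc (1 - r) * |X| ≤ (N / (M.cstar * n)) * (N * (c + 1) + 2 * R) := by
          gcongr
          have : |(i : ℝ)| / (M.cstar * n) ≤ N / (M.cstar * n) := by gcongr
          linarith
      _ = N / M.cstar * (N * (c + 1) + 2 * R) / n := by field_simp
      _ ≤ κ / 3 := hnn.le
  have b3 : |X - (c * |(i : ℝ)| - 2 * w)| ≤ κ / 3 := by
    rw [show X - (c * |(i : ℝ)| - 2 * w) = |(i : ℝ)| * (D - c) by rw [hX]; ring, abs_mul, abs_abs]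
    refine le_trans ?_ hDn.le
    gcongr
  have hr' := hr.trans b1
  rw [abs_le] at hr' b2 b3 ⊢
  constructor <;> linarith [hr'.1, hr'.2, b2.1, b2.2, b3.1, b3.2]

/-- The competitor m₀ + h must lie on the trimmed grid. Convergence of τ to an interior point
guarantees this; membership in the open interval alone would allow τ to drift to its end. -/
lemma eventually_shift_mem (hM : M.ChangePointConverges) (h : ℤ) :
    ∀ᶠ n : ℕ in atTop, ∀ m₀ : ℕ, (n : ℝ) * M.τ n = m₀ →
      ∃ m : ℕ, (m : ℤ) = m₀ + h ∧ (m : ℝ) / n ∈ Set.Ioo M.cstar (1 - M.cstar) := by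
  obtain ⟨τs, hτs, hlim⟩ := hM
  have h1 := hlim.add (tendsto_const_div_atTop_nhds_zero_nat (h : ℝ))
  rw [add_zero] at h1
  filter_upwards [h1.eventually (isOpen_Ioo.mem_nhds hτs), eventually_ge_atTop 1]
    with n hn hn1 m₀ h₀
  have hn' : (0 : ℝ) < n := by exact_mod_cast hn1
  have e : M.τ n + (h : ℝ) / n = ((m₀ + h : ℤ) : ℝ) / n := by
    push_cast
    rw [← h₀]
    field_simp
  rw [e] at hn
  have hpos : (0 : ℝ) < ((m₀ + h : ℤ) : ℝ) / n := M.cstar_pos.trans hn.1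
  have hpos' : 0 < (m₀ + h : ℤ) := by
    by_contra hcon
    have : ((m₀ + h : ℤ) : ℝ) ≤ 0 := by exact_mod_cast not_lt.1 hcon
    exact absurd hpos (not_lt.2 (div_nonpos_of_nonpos_of_nonneg this hn'.le))
  obtain ⟨m, hm⟩ := Int.eq_ofNat_of_zero_le hpos'.le
  refine ⟨m, hm.symm, ?_⟩
  rwa [hm, Int.cast_natCast] at hn

/-- With high probability the estimation error equals `h` if the maximum of the approximating walk
is separated at `h`. -/
lemma sepSet_le_liminf {c : ℝ} (hc : 0 < c) {K : ℝ} (hrow : ∀ n, NoiseRow (M.ε n) P K)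
    (hp : SublinearGrowth M.p) (hτc : M.ChangePointConverges)
    (hD : Tendsto (fun n => ‖M.δ n‖ ^ 2) atTop (𝓝 c)) {τhat : ℕ → Ω → ℝ} (hτ : M.IsLSE τhat)
    {N : ℕ} {h : ℤ} (hh : |h| < N) {R : ℝ} (hR : 0 < R) :
    liminf (fun n : ℕ => P {ω | (fun t => M.step n ⌊(n : ℝ) * M.τ n⌋₊ t ω) ∈ sepSet c N R h})
        atTop ≤
      liminf (fun n : ℕ => P {ω | (n : ℝ) * (τhat n ω - M.τ n) = h}) atTop +
        ENNReal.ofReal (2 * (3 * K ^ 2 / ((1 / 4) ^ 4 * (c / 2) ^ 2) * sqTail N)) := by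
  have hN1 : 1 ≤ N := by
    have := abs_nonneg h
    omega
  have hDhalf : ∀ᶠ n in atTop, c / 2 ≤ ‖M.δ n‖ ^ 2 :=
    (hD.eventually (lt_mem_nhds (half_lt_self hc))).mono fun _ h => h.le
  -- The criterion is −2 times the walk with drift, so a gap 1/R there is a gap 2/R here, and it
  -- beats two approximation errors of 1/R each.
  obtain ⟨θ, hθ0, hθ, hclose⟩ := M.exists_eventually_L_close hc hD N hR (κ := 1 / R) (by positivity)
  have hgood := M.tendsto_measure_not_goodRow hrow
    (snrStar_of_sublinearGrowth hp (half_pos hc) hDhalf) (half_pos hc) hDhalf hθ0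
  set T := ENNReal.ofReal (2 * (3 * K ^ 2 / ((1 / 4) ^ 4 * (c / 2) ^ 2) * sqTail N))
  refine ENNReal.le_of_forall_pos_le_add fun e he _ => ?_
  have hev : ∀ᶠ n : ℕ in atTop,
      P {ω | (fun t => M.step n ⌊(n : ℝ) * M.τ n⌋₊ t ω) ∈ sepSet c N R h} ≤
        P {ω | (n : ℝ) * (τhat n ω - M.τ n) = h} + (T + e) := by
    have he' : (0 : ENNReal) < e := by exact_mod_cast he
    filter_upwards [hclose, hgood.eventually (gt_mem_nhds he'), hDhalf, eventually_ge_atTop 1,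
      M.τ_mem, M.τ_grid, hτ.2, M.eventually_shift_mem hτc h]
      with n hcl hgn hDn hn hτn ⟨m₀, h₀⟩ hmin hshift
    have hn' : (0 : ℝ) < n := by exact_mod_cast hn
    have hDpos : 0 < ‖M.δ n‖ ^ 2 := lt_of_lt_of_le (by positivity) hDn
    have hfl : ⌊(n : ℝ) * M.τ n⌋₊ = m₀ := by rw [h₀, Nat.floor_natCast]
    rw [hfl] at hgn ⊢
    have hfar : P {ω | ∃ i : ℤ, (N : ℤ) ≤ |i| ∧
        1 / 4 * |(i : ℝ)| * ‖M.δ n‖ ^ 2 < |M.walk n m₀ i ω|} ≤ T := by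
      refine (M.measure_walk_gt (hrow n) hN1 (by norm_num) hDpos).trans
        (ENNReal.ofReal_le_ofReal ?_)
      have := sqTail_nonneg N
      gcongr
    refine le_trans (measure_mono_ae ?_) ((measure_union_le _ _).trans (add_le_add le_rfl
      ((measure_union_le _ _).trans (add_le_add hfar hgn.le))))
    filter_upwards [hmin] with ω hω hsep
    by_contra hcon
    replace hcon : ω ∉ {ω | (n : ℝ) * (τhat n ω - M.τ n) = h} ∪ ({ω | ∃ i : ℤ, (N : ℤ) ≤ |i| ∧
      1 / 4 * |(i : ℝ)| * ‖M.δ n‖ ^ 2 < |M.walk n m₀ i ω|} ∪ {ω | ¬ M.GoodRow n m₀ θ ω}) := hcon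
    replace hsep : (fun t => M.step n m₀ t ω) ∈ sepSet c N R h := hsep
    simp only [Set.mem_union, Set.mem_ofPred_eq, not_or, not_not, not_exists, not_and,
      not_lt] at hcon
    obtain ⟨hne, hnear, hg⟩ := hcon
    obtain ⟨m, hm, hmem, hle⟩ := hω
    have hτeq : M.τ n = m₀ / n := by rw [← h₀]; field_simp
    rw [hm] at hmem
    obtain ⟨i, hi⟩ : ∃ i : ℤ, (m : ℤ) = m₀ + i := ⟨m - m₀, by ring⟩
    have hih : i ≠ h := fun hih => hne (by
      rw [hm, hτeq]
      have : (m : ℝ) = m₀ + h := by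
        rw [← hih]
        exact_mod_cast hi
      rw [this]
      field_simp
      ring)
    have hiN : |i| < N := by
      by_contra hcon
      exact absurd (hle m₀ (hτeq ▸ hτn)) (not_le.2 (M.not_isMinimiser_of_far h₀ hn hτn hDpos hθ hg
        hN1 hnear hmem hi (not_lt.1 hcon)))
    obtain ⟨mh, hmh, hmhmem⟩ := hshift m₀ h₀
    have hw : ∀ j : ℤ, twoSidedSum (fun t => M.step n m₀ t ω) j = M.walk n m₀ j ω := fun _ => rfl
    have s1 := hsep i (Finset.mem_Icc.2 (abs_le.1 hiN.le))
    have s2 := hsep h (Finset.mem_Icc.2 (abs_le.1 hh.le))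
    have s3 := s1.2 hih
    rw [stepDrift, stepDrift] at s3
    rw [hw] at s1 s2
    rw [hw, hw] at s3
    have c1 := hcl m₀ ω h₀ hg m i hi hmem hiN.le s1.1.le
    have c2 := hcl m₀ ω h₀ hg mh h hmh hmhmem hh.le s2.1.le
    have c3 : (n : ℝ) * (M.L n m ω - M.L n m₀ ω) ≤ n * (M.L n mh ω - M.L n m₀ ω) := by
      gcongr
      exact hle mh hmhmem
    rw [abs_le] at c1 c2
    linarith [c1.1, c2.2]
  refine (liminf_le_liminf hev).trans ?_
  rw [liminf_add_const _ _ _ (by isBoundedDefault) (by isBoundedDefault), add_assoc]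

/-- Bai's limit law for jumps of moderate size. -/
theorem tendstoInDistribution_argmax {c σ : ℝ} (hM : ModerateJump M c σ)
    (hp : SublinearGrowth M.p) (hN : M.NegligibleJumps) (h0 : ∀ n, M.K0 n = ∅)
    {τhat : ℕ → Ω → ℝ} (hτ : M.IsLSE τhat) {Ω' : Type*} [MeasurableSpace Ω'] {P' : Measure Ω'}
    [IsProbabilityMeasure P'] {H : Ω' → ℤ} (hH : IsBrownianArgmax P' c σ H) :
    TendstoInDistribution (fun (n : ℕ) ω => (n : ℝ) * (τhat n ω - M.τ n)) atTop
      (fun ω' => (H ω' : ℝ)) (fun _ => P) P' := by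
  have hHm : Measurable H := by
    obtain ⟨B, -, h, -⟩ := hH
    exact h
  refine tendstoInDistribution_of_le_liminf (fun n => ((hτ.1 n).sub_const _).const_mul _) hHm
    fun h => ?_
  obtain ⟨K, hrow⟩ := M.exists_noiseRow hM.diagonal hM.bounded
  rw [hH.measure_eq hM.c_pos hM.sigma.1]
  set l := liminf (fun n : ℕ => P {ω | (n : ℝ) * (τhat n ω - M.τ n) = h}) atTop
  have hlim : Tendsto (fun N : ℕ => l + ENNReal.ofReal
      (2 * (3 * K ^ 2 / ((1 / 4) ^ 4 * (c / 2) ^ 2) * sqTail N))) atTop (𝓝 l) := by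
    have := ENNReal.tendsto_ofReal
      ((tendsto_sqTail.const_mul (3 * K ^ 2 / ((1 / 4) ^ 4 * (c / 2) ^ 2))).const_mul 2)
    rw [mul_zero, mul_zero, ENNReal.ofReal_zero] at this
    simpa using tendsto_const_nhds.add this
  -- For fixed N the separation level R goes to infinity first; only then does N grow and remove the
  -- probability that the walk escapes the window.
  refine ge_of_tendsto hlim ?_
  filter_upwards [eventually_gt_atTop h.natAbs] with N hNh
  have hh : |h| < N := by
    rw [Int.abs_eq_natAbs]
    exact_mod_cast hNh
  refine stepLaw_argmax_le hM.c_pos hM.sigma.1 N h fun R => ?_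
  exact (M.stepLaw_sepSet_le_liminf hM hN h0 _ N (R + 1) hh.le).trans
    (M.sepSet_le_liminf hM.c_pos hrow hp hM.changePoint hM.jump_size hτ hh (by positivity))

end PanelModel

/-! ### Existence of least squares estimators -/

namespace PanelModel

variable {Ω : Type*} [MeasurableSpace Ω] {P : Measure Ω} (M : PanelModel P)

lemma measurable_ε (n : ℕ) (k : Fin (M.p n)) (t : ℤ) : Measurable (M.ε n k t) :=
  Measurable.tsum fun j => Finset.measurable_fun_sum Finset.univ fun (i : Fin (M.p n)) _ =>
    (M.η_measurable i (t - j)).const_mul (M.A n j k i)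

lemma measurable_X (n : ℕ) (k : Fin (M.p n)) (t : ℕ) : Measurable (M.X n k t) :=
  (M.measurable_ε n k t).const_add _

lemma measurable_L (n m : ℕ) : Measurable (M.L n m) := by
  refine Measurable.const_mul (Finset.measurable_fun_sum _ fun k _ => ?_) _
  have h1 : Measurable (M.meanBefore n k m) :=
    (Finset.measurable_fun_sum _ fun t _ => M.measurable_X n k t).div_const _
  have h2 : Measurable (M.meanAfter n k m) :=
    (Finset.measurable_fun_sum _ fun t _ => M.measurable_X n k t).div_const _
  exact (Finset.measurable_fun_sum _ fun t _ => ((M.measurable_X n k t).sub h1).pow_const 2).add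
    (Finset.measurable_fun_sum _ fun t _ => ((M.measurable_X n k t).sub h2).pow_const 2)

lemma finite_grid (n : ℕ) : {m : ℕ | (m : ℝ) / n ∈ Set.Ioo M.cstar (1 - M.cstar)}.Finite := by
  refine (Set.finite_Iic n).subset fun m hm => ?_
  have h1 : (m : ℝ) / n ∈ Set.Ioo M.cstar (1 - M.cstar) := hm
  rcases Nat.eq_zero_or_pos n with rfl | hn
  · rw [Nat.cast_zero, div_zero] at h1
    exact absurd h1.1 (not_lt.2 M.cstar_pos.le)
  · have hn' : (0 : ℝ) < n := by exact_mod_cast hn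
    have h2 := (div_lt_iff₀ hn').1 (h1.2.trans (sub_lt_self 1 M.cstar_pos))
    rw [one_mul] at h2
    exact_mod_cast h2.le

lemma exists_isLSE : ∃ τhat : ℕ → Ω → ℝ, M.IsLSE τhat := by
  classical
  let g : ℕ → ℕ → Prop := fun n m => (m : ℝ) / n ∈ Set.Ioo M.cstar (1 - M.cstar)
  -- The smallest minimising grid point is measurable. If the grid is empty, every m qualifies and
  -- the search returns 0; this does not happen for large n.
  let q : ℕ → Ω → ℕ → Prop := fun n ω m =>
    (g n m ∧ ∀ m', g n m' → M.L n m ω ≤ M.L n m' ω) ∨ ∀ m', ¬ g n m'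
  have hq : ∀ n ω, ∃ m, q n ω m := fun n ω => by
    by_cases hg : ∃ m, g n m
    · obtain ⟨m₁, hm₁⟩ := hg
      obtain ⟨m, hm, hmin⟩ := (M.finite_grid n).toFinset.exists_min_image (fun m => M.L n m ω)
        ⟨m₁, (M.finite_grid n).mem_toFinset.2 hm₁⟩
      exact ⟨m, Or.inl ⟨(M.finite_grid n).mem_toFinset.1 hm, fun m' hm' =>
        hmin m' ((M.finite_grid n).mem_toFinset.2 hm')⟩⟩
    · exact ⟨0, Or.inr (not_exists.1 hg)⟩
  have hqm : ∀ n m, MeasurableSet {ω | q n ω m} := fun n m => by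
    refine MeasurableSet.union (MeasurableSet.inter (MeasurableSet.const _) ?_)
      (MeasurableSet.const _)
    have e : {ω | ∀ m', g n m' → M.L n m ω ≤ M.L n m' ω} =
        ⋂ m', {ω | g n m' → M.L n m ω ≤ M.L n m' ω} := by
      ext
      simp
    change MeasurableSet {ω | ∀ m', g n m' → M.L n m ω ≤ M.L n m' ω}
    rw [e]
    refine MeasurableSet.iInter fun m' => ?_
    by_cases hm' : g n m'
    · simpa [hm'] using measurableSet_le (M.measurable_L n m) (M.measurable_L n m')
    · simp [hm']
  refine ⟨fun n ω => (Nat.find (hq n ω) : ℝ) / n, fun n => ?_, ?_⟩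
  · have h1 : Measurable fun ω => Nat.find (hq n ω) := measurable_find (hq n) (hqm n)
    exact (measurable_of_countable fun m : ℕ => (m : ℝ) / n).comp h1
  · filter_upwards [M.τ_mem, M.τ_grid, eventually_ge_atTop 1] with n hτ ⟨m₀, h₀⟩ hn
    refine ae_of_all _ fun ω => ⟨Nat.find (hq n ω), rfl, ?_⟩
    have hn' : (0 : ℝ) < n := by exact_mod_cast hn
    have hm₀ : g n m₀ := by
      change (m₀ : ℝ) / n ∈ _
      rw [← h₀]
      convert hτ using 1
      field_simp
    rcases Nat.find_spec (hq n ω) with h1 | h1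
    · exact h1
    · exact absurd hm₀ (h1 m₀)

end PanelModel

/-! ### Skewed innovations -/

/-- A centred law with unit variance on the points `1/2` and `-2`. -/
def skewLaw : Measure ℝ :=
  ENNReal.ofReal (4 / 5) • Measure.dirac (1 / 2) + ENNReal.ofReal (1 / 5) • Measure.dirac (-2)

instance : IsProbabilityMeasure skewLaw := by
  refine ⟨?_⟩
  simp only [skewLaw, Measure.add_apply, Measure.smul_apply, measure_univ, smul_eq_mul, mul_one]
  rw [← ENNReal.ofReal_add (by norm_num) (by norm_num)]
  norm_num

lemma ae_skewLaw : ∀ᵐ x ∂skewLaw, x = 1 / 2 ∨ x = -2 := by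
  rw [skewLaw, ae_add_measure_iff]
  have hm : MeasurableSet {x : ℝ | x = 1 / 2 ∨ x = -2} :=
    (measurableSet_singleton _).union (measurableSet_singleton _)
  exact ⟨Measure.ae_smul_measure ((ae_dirac_iff hm).2 (Or.inl rfl)) _,
    Measure.ae_smul_measure ((ae_dirac_iff hm).2 (Or.inr rfl)) _⟩

lemma integral_skewLaw (f : ℝ → ℝ) :
    ∫ x, f x ∂skewLaw = 4 / 5 * f (1 / 2) + 1 / 5 * f (-2) := by
  have hi : ∀ a : ℝ, Integrable f (Measure.dirac a) := fun a =>
    integrable_dirac (by simp)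
  rw [skewLaw, integral_add_measure ((hi _).smul_measure ENNReal.ofReal_ne_top)
    ((hi _).smul_measure ENNReal.ofReal_ne_top), integral_smul_measure, integral_smul_measure,
    integral_dirac, integral_dirac, ENNReal.toReal_ofReal (by norm_num),
    ENNReal.toReal_ofReal (by norm_num), smul_eq_mul, smul_eq_mul]

lemma skewLaw_singleton : ENNReal.ofReal (1 / 5) ≤ skewLaw {-2} := by
  simp only [skewLaw, Measure.add_apply, Measure.smul_apply, smul_eq_mul,
    Measure.dirac_apply' _ (measurableSet_singleton (-2 : ℝ))]
  simp

/-- The law of an array of independent skewed innovations. -/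
abbrev skewArray : Measure (ℕ × ℤ → ℝ) := Measure.infinitePi fun _ : ℕ × ℤ => skewLaw

lemma skewArray_map_eval (q : ℕ × ℤ) : skewArray.map (fun ω => ω q) = skewLaw :=
  Measure.infinitePi_map_eval _ q

lemma integral_skewArray {f : ℝ → ℝ} (hf : Measurable f) (q : ℕ × ℤ) :
    ∫ ω : ℕ × ℤ → ℝ, f (ω q) ∂skewArray = 4 / 5 * f (1 / 2) + 1 / 5 * f (-2) := by
  rw [← integral_skewLaw f, ← skewArray_map_eval q,
    integral_map (measurable_pi_apply q).aemeasurable hf.aestronglyMeasurable]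

lemma ae_skewArray (q : ℕ × ℤ) : ∀ᵐ ω : ℕ × ℤ → ℝ ∂skewArray, ω q = 1 / 2 ∨ ω q = -2 :=
  ae_of_ae_map (measurable_pi_apply q).aemeasurable ((skewArray_map_eval q).symm ▸ ae_skewLaw)

lemma skewArray_singleton (q : ℕ × ℤ) :
    ENNReal.ofReal (1 / 5) ≤ skewArray {ω | ω q = -2} := by
  have h := skewLaw_singleton
  rwa [← skewArray_map_eval q,
    Measure.map_apply (measurable_pi_apply q) (measurableSet_singleton _)] at h

/-- A model with a jump of size one in the single panel `κ n`. -/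
def singleJumpModel (κ : ∀ n : ℕ, Fin (n.sqrt + 1)) : PanelModel skewArray where
  p n := n.sqrt + 1
  μ₁ n := EuclideanSpace.single (κ n) 1
  μ₂ _ := 0
  τ n := (n / 2 : ℕ) / (n : ℝ)
  cstar := 1 / 4
  -- Scaling by 1/2 makes the steps 1/4 or −1: an upward step is below the drift 1/2 per unit of
  -- time, and the reverse of a downward one exceeds it.
  A _ j := if j = 0 then (1 / 2 : ℝ) • 1 else 0
  η k t ω := ω (k, t)
  p_tendsto := tendsto_succ_atTop.comp (tendsto_atTop_atTop.2 fun b =>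
    ⟨b * b, fun n hn => Nat.le_sqrt.2 hn⟩)
  cstar_pos := by norm_num
  cstar_lt := by norm_num
  τ_mem := by
    filter_upwards [eventually_ge_atTop 3] with n hn
    have hn' : (3 : ℝ) ≤ n := by exact_mod_cast hn
    have h1 : (n : ℝ) ≤ 2 * (n / 2 : ℕ) + 1 := by
      exact_mod_cast (by omega : n ≤ 2 * (n / 2) + 1)
    have h2 : 2 * ((n / 2 : ℕ) : ℝ) ≤ n := by exact_mod_cast (by omega : 2 * (n / 2) ≤ n)
    constructor
    · rw [lt_div_iff₀ (by linarith)]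
      linarith
    · rw [div_lt_iff₀ (by linarith)]
      linarith
  τ_grid := by
    filter_upwards [eventually_ge_atTop 1] with n hn
    have hn' : (n : ℝ) ≠ 0 := by exact_mod_cast (by omega : n ≠ 0)
    exact ⟨n / 2, mul_div_cancel₀ _ hn'⟩
  η_measurable k t := measurable_pi_apply (k, t)
  η_indep := iIndepFun_infinitePi (X := fun _ x => x) fun _ => measurable_id
  η_ident k t := ⟨(measurable_pi_apply (k, t)).aemeasurable,
    (measurable_pi_apply (0, 0)).aemeasurable,
    (skewArray_map_eval (k, t)).trans (skewArray_map_eval (0, 0)).symm⟩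
  η_mean := (integral_skewArray measurable_id (0, 0)).trans (by norm_num)
  η_var := (integral_skewArray (measurable_id.pow_const 2) (0, 0)).trans (by norm_num)
  η_fourth := by
    refine MemLp.of_bound (measurable_pi_apply (0, 0)).aestronglyMeasurable 2 ?_
    filter_upwards [ae_skewArray (0, 0)] with ω hω
    rcases hω with h | h <;> rw [h] <;> norm_num

/-! ### The counterexamples: a jump concentrated in one panel -/

namespace singleJumpModel

variable (κ : ∀ n : ℕ, Fin (n.sqrt + 1))

lemma δ_apply (n : ℕ) (k : Fin (n.sqrt + 1)) :
    (singleJumpModel κ).δ n k = if k = κ n then 1 else 0 := by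
  change (EuclideanSpace.single (κ n) (1 : ℝ) - 0) k = _
  rw [sub_zero, PiLp.single_apply]

lemma norm_δ (n : ℕ) : ‖(singleJumpModel κ).δ n‖ ^ 2 = 1 := by
  change ‖EuclideanSpace.single (κ n) (1 : ℝ) - 0‖ ^ 2 = 1
  rw [sub_zero, PiLp.norm_single]
  norm_num

lemma isDiagonal : (singleJumpModel κ).IsDiagonal := by
  intro n j i k hik
  change (if j = 0 then (1 / 2 : ℝ) • (1 : Matrix _ _ ℝ) else 0) i k = 0
  split_ifs <;> simp [hik]

lemma a_apply (n j : ℕ) (k : Fin (n.sqrt + 1)) :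
    (singleJumpModel κ).a n j k = if j = 0 then 1 / 2 else 0 := by
  change (if j = 0 then (1 / 2 : ℝ) • (1 : Matrix _ _ ℝ) else 0) k k = _
  split_ifs <;> simp

lemma boundedCoeff : (singleJumpModel κ).BoundedCoeff := by
  refine ⟨1 / 2, fun n k => ?_⟩
  have h : ∀ j, j ≠ 0 → |(singleJumpModel κ).a n j k| = 0 := fun j hj => by
    rw [(a_apply κ n j k).trans (if_neg hj), abs_zero]
  have h2 : HasSum (fun j => |(singleJumpModel κ).a n j k|) |(singleJumpModel κ).a n 0 k| :=
    hasSum_single 0 h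
  refine ⟨h2.summable, ?_⟩
  rw [h2.tsum_eq, (a_apply κ n 0 k).trans (if_pos rfl)]
  norm_num

lemma uncorrelated : (singleJumpModel κ).Uncorrelated := fun n j k hj =>
  (a_apply κ n j k).trans (if_neg hj)

lemma tendsto_τ : Tendsto (singleJumpModel κ).τ atTop (𝓝 (1 / 2)) := by
  have h1 : Tendsto (fun n : ℕ => (1 / 2 : ℝ) - 1 / (n : ℝ)) atTop (𝓝 (1 / 2)) := by
    simpa using tendsto_const_nhds.sub (tendsto_const_div_atTop_nhds_zero_nat (1 : ℝ))
  refine tendsto_of_tendsto_of_tendsto_of_le_of_le' h1 tendsto_const_nhds ?_ ?_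
  · filter_upwards [eventually_ge_atTop 1] with n hn
    have hn' : (0 : ℝ) < n := by exact_mod_cast hn
    have h1 : (n : ℝ) ≤ 2 * (n / 2 : ℕ) + 1 := by
      exact_mod_cast (by omega : n ≤ 2 * (n / 2) + 1)
    change 1 / 2 - 1 / (n : ℝ) ≤ (n / 2 : ℕ) / (n : ℝ)
    rw [le_div_iff₀ hn', sub_mul, one_div_mul_cancel hn'.ne']
    linarith
  · filter_upwards [eventually_ge_atTop 1] with n hn
    have hn' : (0 : ℝ) < n := by exact_mod_cast hn
    have h2 : 2 * ((n / 2 : ℕ) : ℝ) ≤ n := by exact_mod_cast (by omega : 2 * (n / 2) ≤ n)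
    change (n / 2 : ℕ) / (n : ℝ) ≤ 1 / 2
    rw [div_le_iff₀ hn']
    linarith

lemma logLogGrowth : LogLogGrowth (singleJumpModel κ).p := by
  have h1 : Tendsto (fun x : ℝ => 2 * (Real.log x / x ^ (1 / 2 : ℝ))) atTop (𝓝 0) := by
    simpa using (isLittleO_log_rpow_atTop
      (by norm_num : (0 : ℝ) < 1 / 2)).tendsto_div_nhds_zero.const_mul 2
  have h2 : Tendsto (fun n : ℕ => Real.log (Real.log n)) atTop atTop :=
    Real.tendsto_log_atTop.comp (Real.tendsto_log_atTop.comp tendsto_natCast_atTop_atTop)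
  refine squeeze_zero' ?_ ?_ (h1.comp tendsto_natCast_atTop_atTop)
  · filter_upwards [h2.eventually_ge_atTop 0] with n hn
    positivity
  · filter_upwards [h2.eventually_ge_atTop 0, eventually_ge_atTop 1] with n hn hn1
    have hn' : (1 : ℝ) ≤ n := by exact_mod_cast hn1
    have hs : (1 : ℝ) ≤ √n := Real.one_le_sqrt.2 hn'
    have hsq : √(n : ℝ) * √n = n := Real.mul_self_sqrt (by linarith)
    have hp : ((singleJumpModel κ).p n : ℝ) ≤ 2 * √n := by
      change ((n.sqrt + 1 : ℕ) : ℝ) ≤ 2 * √n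
      push_cast
      have := Real.nat_sqrt_le_real_sqrt (a := n)
      linarith
    have hl : Real.log (Real.log n) ≤ Real.log n :=
      Real.log_le_self (Real.log_nonneg hn')
    change ((singleJumpModel κ).p n : ℝ) * Real.log (Real.log n) / n ≤
      2 * (Real.log n / (n : ℝ) ^ (1 / 2 : ℝ))
    rw [← Real.sqrt_eq_rpow]
    calc ((singleJumpModel κ).p n : ℝ) * Real.log (Real.log n) / n ≤ 2 * √n * Real.log n / n := by
          gcongr
      _ = 2 * (Real.log n / √n) := by
          rw [div_eq_iff (by linarith)]
          field_simp
          rw [Real.sq_sqrt (by linarith), mul_comm]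

lemma changePointConverges : (singleJumpModel κ).ChangePointConverges := by
  refine ⟨1 / 2, ?_, tendsto_τ κ⟩
  change (1 / 2 : ℝ) ∈ Set.Ioo (1 / 4) (1 - 1 / 4)
  norm_num

lemma moderateJump {σ : ℝ} (hσ : (singleJumpModel κ).IsSigmaStar σ) :
    ModerateJump (singleJumpModel κ) 1 σ where
  diagonal := isDiagonal κ
  bounded := boundedCoeff κ
  uncorrelated := uncorrelated κ
  c_pos := one_pos
  jump_size := by
    simp_rw [norm_δ]
    exact tendsto_const_nhds
  changePoint := changePointConverges κ
  sigma := hσ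

lemma step_apply (n m₀ : ℕ) (t : ℤ) (ω : ℕ × ℤ → ℝ) :
    (singleJumpModel κ).step n m₀ t ω = 1 / 2 * ω ((κ n : ℕ), m₀ + t) := by
  rw [PanelModel.step_eq _ (isDiagonal κ) (uncorrelated κ)]
  change ∑ k : Fin (n.sqrt + 1), (singleJumpModel κ).δ n k * (singleJumpModel κ).a n 0 k *
    ω ((k : ℕ), m₀ + t) = _
  rw [Finset.sum_eq_single (κ n)]
  · rw [δ_apply, a_apply, if_pos rfl, if_pos rfl, one_mul]
  · intro k _ hk
    rw [δ_apply, if_neg hk, zero_mul, zero_mul]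
  · simp

/-- Steps are bounded above by 1/4, so to the right of the change the drift wins for every outcome
up to a null set, at every distance. -/
lemma walk_le (n m₀ : ℕ) :
    ∀ᵐ ω ∂skewArray, ∀ h : ℕ, (singleJumpModel κ).walk n m₀ h ω ≤ 1 / 4 * (h : ℝ) := by
  have h1 : ∀ᵐ ω : ℕ × ℤ → ℝ ∂skewArray, ∀ q, ω q = 1 / 2 ∨ ω q = -2 :=
    ae_all_iff.2 ae_skewArray
  filter_upwards [h1] with ω hω h
  change twoSidedSum (fun t => (singleJumpModel κ).step n m₀ t ω) h ≤ _
  rw [twoSidedSum_natCast, sum_Ioc_zero_natCast]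
  refine (Finset.sum_le_card_nsmul _ _ (1 / 4) fun i _ => ?_).trans_eq ?_
  · rw [step_apply]
    rcases hω ((κ n : ℕ), (m₀ : ℤ) + (i + 1)) with h | h <;> rw [h] <;> norm_num
  · rw [Finset.card_range, nsmul_eq_mul, mul_comm]

/-- The only step between −1 and 0 is that of time m₀ itself, the last one before the change. A
downward step there enters with reversed sign, so h = −1 beats h = 0. -/
lemma walk_neg_one (n m₀ : ℕ) {ω : ℕ × ℤ → ℝ} (hω : ω ((κ n : ℕ), m₀) = -2) :
    (singleJumpModel κ).walk n m₀ (-1) ω = 1 := by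
  change twoSidedSum (fun t => (singleJumpModel κ).step n m₀ t ω) (-(1 : ℕ) : ℤ) = 1
  rw [twoSidedSum_neg_natCast, sum_Ioc_neg_natCast]
  simp only [Finset.range_one, Finset.sum_singleton, step_apply, Nat.cast_zero, neg_zero, add_zero,
    hω]
  norm_num

/-- Up to a small probability, the estimator does not exceed the change point, and is smaller with
probability at least `1/5`. -/
lemma tendsto_measure_exception {τhat : ℕ → (ℕ × ℤ → ℝ) → ℝ} (hτ : (singleJumpModel κ).IsLSE τhat) :
    ∃ E : ℕ → Set (ℕ × ℤ → ℝ), Tendsto (fun n => skewArray (E n)) atTop (𝓝 0) ∧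
      ∀ᶠ n : ℕ in atTop, ∀ᵐ ω ∂skewArray, ω ∉ E n →
        (n : ℝ) * (τhat n ω - (singleJumpModel κ).τ n) ≤ 0 ∧
        (ω ((κ n : ℕ), ((n / 2 : ℕ) : ℤ)) = -2 →
          (n : ℝ) * (τhat n ω - (singleJumpModel κ).τ n) ≤ -1) := by
  set M := singleJumpModel κ with hMdef
  obtain ⟨K, hrow⟩ := M.exists_noiseRow (isDiagonal κ) (boundedCoeff κ)
  obtain ⟨θ, hθ0, hθ⟩ := M.exists_small_θ
  have hD : ∀ᶠ n in atTop, (1 : ℝ) ≤ ‖M.δ n‖ ^ 2 :=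
    Eventually.of_forall fun n => (norm_δ κ n).ge
  refine ⟨_, M.tendsto_measure_not_goodRow hrow
    (snrStar_of_sublinearGrowth (logLogGrowth κ).sublinearGrowth one_pos hD) one_pos hD hθ0, ?_⟩
  have hcs := M.cstar_pos
  filter_upwards [eventually_ge_atTop 1, M.τ_mem, hτ.2,
    M.eventually_shift_mem (changePointConverges κ) (-1)]
    with n hn hτn hmin hshift
  have hn' : (0 : ℝ) < n := by exact_mod_cast hn
  have hτeq : M.τ n = ((n / 2 : ℕ) : ℝ) / n := rfl
  generalize hm₀ : n / 2 = m₀ at *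
  have h₀ : (n : ℝ) * M.τ n = m₀ := by
    rw [hτeq]
    field_simp
  have hfl : ⌊(n : ℝ) * M.τ n⌋₊ = m₀ := by rw [h₀, Nat.floor_natCast]
  filter_upwards [hmin, walk_le κ n m₀] with ω hω hwalk hgood
  replace hgood : M.GoodRow n m₀ θ ω := by
    rw [hfl] at hgood
    exact not_not.1 hgood
  obtain ⟨m, hm, hmem, hle⟩ := hω
  rw [hm] at hmem
  have hZ : (n : ℝ) * (τhat n ω - M.τ n) = ((m - m₀ : ℤ) : ℝ) := by
    rw [hm, hτeq]
    push_cast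
    field_simp
  have hpos : ¬ (0 : ℤ) < m - m₀ := fun hlt => by
    obtain ⟨i, hi⟩ := Int.eq_ofNat_of_zero_le hlt.le
    have hi0 : (0 : ℝ) < i := by
      have : (0 : ℤ) < i := hi ▸ hlt
      exact_mod_cast this
    obtain ⟨r, r1, -, -, hr⟩ := M.L_expansion h₀ hn hτn hgood hmem (h := i) (by omega)
    rw [norm_δ κ n, Int.cast_natCast, abs_of_pos hi0, mul_one, mul_one] at hr
    have h1 := (abs_le.1 hr).1
    have h2 := hwalk i
    have h3 : n * (M.L n m ω - M.L n m₀ ω) ≤ 0 :=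
      mul_nonpos_of_nonneg_of_nonpos hn'.le (sub_nonpos.2 (hle m₀ (hτeq ▸ hτn)))
    have h4 : r * (1 / 2 * i) ≤ r * (i - 2 * M.walk n m₀ i ω) := by
      refine mul_le_mul_of_nonneg_left ?_ (hcs.le.trans r1)
      linarith
    have h5 : M.cstar * (1 / 2 * i) ≤ r * (1 / 2 * i) := by gcongr
    have h6 : 10 / M.cstar ^ 2 * θ * i < M.cstar / 2 * i := by gcongr
    linarith
  have hle0 : (m - m₀ : ℤ) ≤ 0 := not_lt.1 hpos
  rw [hZ]
  refine ⟨by exact_mod_cast hle0, fun hη => ?_⟩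
  have hne : (m - m₀ : ℤ) ≠ 0 := fun h0 => by
    have hmm : m = m₀ := by omega
    obtain ⟨m₁, hm₁, hm₁mem⟩ := hshift m₀ h₀
    obtain ⟨r, r1, -, -, hr⟩ := M.L_expansion h₀ hn hτn hgood hm₁mem hm₁
    rw [norm_δ κ n, walk_neg_one κ n m₀ hη] at hr
    norm_num at hr
    have h1 := (abs_le.1 hr).2
    have h3 : 0 ≤ n * (M.L n m₁ ω - M.L n m₀ ω) :=
      mul_nonneg hn'.le (sub_nonneg.2 (hmm ▸ hle m₁ hm₁mem))
    linarith
  have : (m - m₀ : ℤ) ≤ -1 := by omega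
  exact_mod_cast this

/-- The limit would give no mass to h > 0, hence by symmetry none to h < 0, yet the prelimits put at
least 1/5 minus o(1) on h ≤ −1. -/
lemma not_tendstoInDistribution {τhat : ℕ → (ℕ × ℤ → ℝ) → ℝ} (hτ : (singleJumpModel κ).IsLSE τhat)
    {s : ℝ} (hs : 0 ≤ s) {Ω' : Type*} [MeasurableSpace Ω'] {P' : Measure Ω'}
    [IsProbabilityMeasure P'] {H : Ω' → ℤ} (hH : IsBrownianArgmax P' 1 s H) :
    ¬ TendstoInDistribution
      (fun (n : ℕ) ω => (n : ℝ) * (τhat n ω - (singleJumpModel κ).τ n)) atTop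
      (fun ω' => (H ω' : ℝ)) (fun _ => skewArray) P' := by
  intro hconv
  obtain ⟨E, hE, hZ⟩ := tendsto_measure_exception κ hτ
  set Z : ℕ → (ℕ × ℤ → ℝ) → ℝ := fun n ω => (n : ℝ) * (τhat n ω - (singleJumpModel κ).τ n)
  have hHm : AEMeasurable (fun ω => (H ω : ℝ)) P' := hconv.aemeasurable_limit
  have hZm : ∀ n, AEMeasurable (Z n) skewArray := hconv.forall_aemeasurable
  have hpos : P' {ω | 0 < H ω} = 0 := by
    have h1 := ProbabilityMeasure.le_liminf_measure_open_of_tendsto hconv.tendsto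
      (isOpen_Ioi (a := (0 : ℝ)))
    change P'.map (fun ω => (H ω : ℝ)) (Set.Ioi 0) ≤
      liminf (fun n => skewArray.map (Z n) (Set.Ioi 0)) atTop at h1
    have h2 : Tendsto (fun n => skewArray.map (Z n) (Set.Ioi 0)) atTop (𝓝 0) := by
      refine tendsto_of_tendsto_of_tendsto_of_le_of_le' tendsto_const_nhds hE
        (Eventually.of_forall fun _ => zero_le) ?_
      filter_upwards [hZ] with n hn
      rw [Measure.map_apply_of_aemeasurable (hZm n) measurableSet_Ioi]
      refine measure_mono_ae ?_
      filter_upwards [hn] with ω hω hlt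
      by_contra hcon
      exact absurd (hω hcon).1 (not_le.2 hlt)
    rw [h2.liminf_eq, Measure.map_apply_of_aemeasurable hHm measurableSet_Ioi] at h1
    refine le_antisymm (le_trans (measure_mono fun ω hω => ?_) h1) zero_le
    have : 0 < H ω := hω
    change (0 : ℝ) < H ω
    exact_mod_cast this
  have hneg : P' {ω | H ω < 0} = 0 := by
    have e : {ω | H ω < 0} ⊆ ⋃ i : {i : ℤ // 0 < i}, {ω | H ω = -i} := fun ω hω =>
      Set.mem_iUnion.2 ⟨⟨-H ω, neg_pos.2 hω⟩, (neg_neg _).symm⟩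
    refine measure_mono_null e (measure_iUnion_null fun i => ?_)
    rw [hH.measure_neg one_pos hs]
    refine measure_mono_null (fun ω (hω : H ω = i) => ?_) hpos
    change 0 < H ω
    rw [hω]
    exact i.2
  have h1 := ProbabilityMeasure.limsup_measure_closed_le_of_tendsto hconv.tendsto
    (isClosed_Iic (a := (-1 : ℝ)))
  change limsup (fun n => skewArray.map (Z n) (Set.Iic (-1))) atTop ≤
    P'.map (fun ω => (H ω : ℝ)) (Set.Iic (-1)) at h1
  have h2 : P'.map (fun ω => (H ω : ℝ)) (Set.Iic (-1)) = 0 := by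
    rw [Measure.map_apply_of_aemeasurable hHm measurableSet_Iic]
    refine measure_mono_null (fun ω (hω : (H ω : ℝ) ≤ -1) => ?_) hneg
    change H ω < 0
    have : H ω ≤ -1 := by exact_mod_cast hω
    omega
  rw [h2] at h1
  -- Of the probability 1/5 of a downward step, 1/10 is given up for the exceptional event, whose
  -- probability tends to zero.
  have h3 : ENNReal.ofReal (1 / 10) ≤ limsup (fun n => skewArray.map (Z n) (Set.Iic (-1))) atTop := by
    refine le_limsup_of_frequently_le (Eventually.frequently ?_) (by isBoundedDefault)
    filter_upwards [hZ, hE.eventually (gt_mem_nhds (show (0 : ENNReal) < ENNReal.ofReal (1 / 10) by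
      simp))] with n hn hEn
    rw [Measure.map_apply_of_aemeasurable (hZm n) measurableSet_Iic]
    have h4 : ENNReal.ofReal (1 / 5) ≤ skewArray (Z n ⁻¹' Set.Iic (-1)) + skewArray (E n) := by
      refine (skewArray_singleton ((κ n : ℕ), ((n / 2 : ℕ) : ℤ))).trans
        ((measure_mono_ae ?_).trans (measure_union_le _ _))
      filter_upwards [hn] with ω hω hη
      by_contra hcon
      have hcon' := not_or.1 hcon
      exact hcon'.1 ((hω hcon'.2).2 hη)
    have h5 : ENNReal.ofReal (1 / 5) = ENNReal.ofReal (1 / 10) + ENNReal.ofReal (1 / 10) := by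
      rw [← ENNReal.ofReal_add (by norm_num) (by norm_num)]
      norm_num
    rw [h5] at h4
    exact (ENNReal.add_le_add_iff_right ENNReal.ofReal_ne_top).1
      (h4.trans (add_le_add le_rfl hEn.le))
  exact absurd (h3.trans h1) (by simp)

lemma jump_apply (k n : ℕ) :
    (singleJumpModel κ).jump k n = if k = κ n then 1 else 0 := by
  rw [PanelModel.jump]
  split_ifs with h1 h2 h2
  · exact (δ_apply κ n ⟨k, h1⟩).trans (if_pos (Fin.ext h2))
  · exact (δ_apply κ n ⟨k, h1⟩).trans (if_neg fun h => h2 (congrArg Fin.val h))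
  · exact absurd (h2 ▸ (κ n).2) h1
  · rfl

/-- The jump moves on to ever later panels: panel k carries none once `Nat.sqrt` exceeds k. Yet the
largest jump in each row is 1. -/
lemma Kn_last (n : ℕ) : (singleJumpModel fun n => Fin.last n.sqrt).Kn n = Finset.univ := by
  classical
  refine Finset.eq_univ_iff_forall.2 fun k => ?_
  simp only [PanelModel.Kn, Finset.mem_filter, Finset.mem_univ, true_and]
  refine tendsto_const_nhds.congr' ?_
  filter_upwards [eventually_ge_atTop (((k : ℕ) + 1) * ((k : ℕ) + 1))] with m hm
  have := Nat.le_sqrt.2 hm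
  rw [jump_apply, if_neg]
  rw [Fin.val_last]
  omega

lemma sigma_last : (singleJumpModel fun n => Fin.last n.sqrt).IsSigmaStar (1 / 2) := by
  refine ⟨by norm_num, tendsto_const_nhds.congr fun n => ?_⟩
  rw [Kn_last]
  change _ = ∑ k : Fin (n.sqrt + 1), _
  rw [Finset.sum_eq_single (Fin.last n.sqrt)]
  · rw [δ_apply, a_apply, if_pos rfl, if_pos rfl, one_pow, one_mul]
  · intro k _ hk
    rw [δ_apply, if_neg hk]
    simp
  · simp

/-- Panel 0 has the constant jump 1 and is therefore excluded from `Kn`; what remains has no jump at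
all, so (A9) holds trivially and σ* = 0. -/
lemma δ_eq_zero_of_mem_Kn {n : ℕ} {k : Fin (n.sqrt + 1)}
    (hk : k ∈ (singleJumpModel fun _ => 0).Kn n) : (singleJumpModel fun _ => 0).δ n k = 0 := by
  classical
  have hk' : Tendsto ((singleJumpModel fun _ => 0).jump k) atTop (𝓝 0) :=
    (Finset.mem_filter.1 hk).2
  refine (δ_apply _ n k).trans (if_neg fun h0 => ?_)
  have h1 : ∀ m, (singleJumpModel fun _ => 0).jump k m = 1 := fun m => by
    rw [jump_apply, h0, if_pos (by simp)]
  rw [funext h1] at hk'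
  exact one_ne_zero (tendsto_nhds_unique tendsto_const_nhds hk')

lemma sigma_first : (singleJumpModel fun _ => 0).IsSigmaStar 0 := by
  refine ⟨le_rfl, tendsto_const_nhds.congr fun n => ?_⟩
  rw [Finset.sum_eq_zero fun k hk => ?_]
  · norm_num
  · rw [δ_eq_zero_of_mem_Kn hk]
    simp

lemma negligibleJumps_first : (singleJumpModel fun _ => 0).NegligibleJumps := by
  refine tendsto_const_nhds.congr fun n => ?_
  have : ∀ k : (singleJumpModel fun _ => 0).Kn n, |(singleJumpModel fun _ => 0).δ n k| = 0 :=
    fun k => by rw [δ_eq_zero_of_mem_Kn k.2, abs_zero]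
  simp_rw [this]
  exact Real.iSup_const_zero.symm

end singleJumpModel

end

/-! ### Assembly of the statements -/

theorem mainTheorem6 :
    -- (A1) comparison of the assumptions
    ((∀ (Ω : Type*) [MeasurableSpace Ω] (P : Measure Ω) [IsProbabilityMeasure P]
        (M : PanelModel P), M.BoundedLead → M.Bai1 → M.BoundedCoeff) ∧
      (∀ (p : ℕ → ℕ) (δ : ∀ n, EuclideanSpace ℝ (Fin (p n))), Bai3 p δ → SNRStar p δ) ∧
      (∃ (p : ℕ → ℕ) (δ : ∀ n, EuclideanSpace ℝ (Fin (p n))),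
        Tendsto p atTop atTop ∧ SNRStar p δ ∧ ¬ Bai3 p δ) ∧
      (∃ (p : ℕ → ℕ) (δ : ∀ n, EuclideanSpace ℝ (Fin (p n))),
        Tendsto p atTop atTop ∧ SNRStar p δ ∧ ¬ Bai2 p δ) ∧
      (∃ (p : ℕ → ℕ) (δ : ∀ n, EuclideanSpace ℝ (Fin (p n))),
        Tendsto p atTop atTop ∧ Bai2 p δ ∧ ¬ SNRStar p δ) ∧
      (∀ p : ℕ → ℕ, LogLogGrowth p → SublinearGrowth p)) ∧
    -- (A2) exact recovery under (SNR*) when the jump diverges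
    (∀ (Ω : Type*) [MeasurableSpace Ω] (P : Measure Ω) [IsProbabilityMeasure P]
        (M : PanelModel P) (τhat : ℕ → Ω → ℝ),
      M.IsDiagonal → M.BoundedCoeff → SNRStar M.p M.δ →
      Tendsto (fun n => ‖M.δ n‖) atTop atTop → M.IsLSE τhat →
      Tendsto (fun n => P {ω | τhat n ω = M.τ n}) atTop (𝓝 1)) ∧
    -- (A3) Bai's result under his assumptions (1) and (3)
    (∀ (Ω : Type*) [MeasurableSpace Ω] (P : Measure Ω) [IsProbabilityMeasure P]
        (M : PanelModel P) (τhat : ℕ → Ω → ℝ),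
      M.IsDiagonal → M.BoundedLead → M.Bai1 → Bai3 M.p M.δ → M.IsLSE τhat →
      Tendsto (fun n => P {ω | τhat n ω = M.τ n}) atTop (𝓝 1)) ∧
    -- (B1) the limit variable is well defined
    (∀ c σ : ℝ, 0 < c → 0 ≤ σ →
      (∃ (Ω' : Type) (_ : MeasurableSpace Ω') (P' : Measure Ω') (_ : IsProbabilityMeasure P')
        (H : Ω' → ℤ), IsBrownianArgmax P' c σ H) ∧
      (∀ (Ω' : Type*) [MeasurableSpace Ω'] (P' : Measure Ω') [IsProbabilityMeasure P']
        (B : ℤ → Ω' → ℝ), IsBrownianAtIntegers B P' →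
        ∀ᵐ ω ∂P', ∃! h : ℤ, ∀ h' : ℤ, driftProcess c σ B h' ω ≤ driftProcess c σ B h ω)) ∧
    -- (B2) Bai's limit law holds under the two extra conditions and `p / n → 0`
    (∀ (Ω : Type*) [MeasurableSpace Ω] (P : Measure Ω) [IsProbabilityMeasure P]
        (M : PanelModel P) (τhat : ℕ → Ω → ℝ) (c σ : ℝ),
      ModerateJump M c σ → SublinearGrowth M.p → M.NegligibleJumps → (∀ n, M.K0 n = ∅) →
      M.IsLSE τhat →
      ∀ (Ω' : Type*) [MeasurableSpace Ω'] (P' : Measure Ω') [IsProbabilityMeasure P']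
        (H : Ω' → ℤ), IsBrownianArgmax P' c σ H →
        TendstoInDistribution (fun (n : ℕ) ω => (n : ℝ) * (τhat n ω - M.τ n)) atTop
          (fun ω' => (H ω' : ℝ)) (fun _ => P) P') ∧
    -- (B3) the limit law can fail without the negligibility of the largest jump
    (∃ (Ω : Type) (_ : MeasurableSpace Ω) (P : Measure Ω) (_ : IsProbabilityMeasure P)
        (M : PanelModel P) (τhat : ℕ → Ω → ℝ) (c σ : ℝ),
      ModerateJump M c σ ∧ LogLogGrowth M.p ∧ (∀ n, M.K0 n = ∅) ∧ M.IsLSE τhat ∧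
      ∀ s : ℝ, 0 ≤ s →
        ∀ (Ω' : Type) [MeasurableSpace Ω'] (P' : Measure Ω') [IsProbabilityMeasure P']
          (H : Ω' → ℤ), IsBrownianArgmax P' c s H →
          ¬ TendstoInDistribution (fun (n : ℕ) ω => (n : ℝ) * (τhat n ω - M.τ n)) atTop
            (fun ω' => (H ω' : ℝ)) (fun _ => P) P') ∧
    -- (B4) the limit law can fail if some jump does not vanish
    (∃ (Ω : Type) (_ : MeasurableSpace Ω) (P : Measure Ω) (_ : IsProbabilityMeasure P)
        (M : PanelModel P) (τhat : ℕ → Ω → ℝ) (c σ : ℝ),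
      ModerateJump M c σ ∧ LogLogGrowth M.p ∧ M.NegligibleJumps ∧ M.IsLSE τhat ∧
      ∀ s : ℝ, 0 ≤ s →
        ∀ (Ω' : Type) [MeasurableSpace Ω'] (P' : Measure Ω') [IsProbabilityMeasure P']
          (H : Ω' → ℤ), IsBrownianArgmax P' c s H →
          ¬ TendstoInDistribution (fun (n : ℕ) ω => (n : ℝ) * (τhat n ω - M.τ n)) atTop
            (fun ω' => (H ω' : ℝ)) (fun _ => P) P') := by
  refine ⟨⟨?_, ?_, exists_snrStar_not_bai3, exists_snrStar_not_bai2, exists_bai2_not_snrStar, ?_⟩,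
    ?_, ?_, ?_, ?_, ?_, ?_⟩
  · intro Ω _ P _ M h₀ h₁
    exact PanelModel.BoundedLead.boundedCoeff h₀ h₁
  · intro p δ h
    exact h.snrStar
  · intro p h
    exact h.sublinearGrowth
  · intro Ω _ P _ M τhat hD hC hS hδ hL
    exact M.tendsto_measure_eq_τ hD hC hS hδ hL
  · intro Ω _ P _ M τhat hD h₀ h₁ h₃ hL
    exact M.tendsto_measure_eq_τ hD (PanelModel.BoundedLead.boundedCoeff h₀ h₁) h₃.snrStar h₃.1 hL
  · intro c σ hc hσ
    obtain ⟨H, hH⟩ := exists_isBrownianArgmax hc hσ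
    refine ⟨⟨ℤ → ℝ, inferInstance, stepLaw, inferInstance, H, hH⟩, ?_⟩
    intro Ω' _ P' _ B hB
    exact hB.ae_existsUnique hc hσ
  · intro Ω _ P _ M τhat c σ hM hp hN h0 hτ Ω' _ P' _ H hH
    exact M.tendstoInDistribution_argmax hM hp hN h0 hτ hH
  · obtain ⟨τhat, hτ⟩ := (singleJumpModel fun n => Fin.last n.sqrt).exists_isLSE
    refine ⟨ℕ × ℤ → ℝ, inferInstance, skewArray, inferInstance, _, τhat, 1, 1 / 2,
      singleJumpModel.moderateJump _ singleJumpModel.sigma_last, singleJumpModel.logLogGrowth _,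
      fun n => ?_, hτ, ?_⟩
    · rw [PanelModel.K0, Finset.compl_eq_empty_iff]
      exact singleJumpModel.Kn_last n
    · intro s hs Ω' _ P' _ H hH
      exact singleJumpModel.not_tendstoInDistribution _ hτ hs hH
  · obtain ⟨τhat, hτ⟩ := (singleJumpModel fun _ => 0).exists_isLSE
    refine ⟨ℕ × ℤ → ℝ, inferInstance, skewArray, inferInstance, _, τhat, 1, 0,
      singleJumpModel.moderateJump _ singleJumpModel.sigma_first, singleJumpModel.logLogGrowth _,
      singleJumpModel.negligibleJumps_first, hτ, ?_⟩
    intro s hs Ω' _ P' _ H hH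
    exact singleJumpModel.not_tendstoInDistribution _ hτ hs hH
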